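/- **Setting.** Let $\mathcal H$ be a complex Hilbert space with inner product $(\cdot,\cdot)$, linear in the second argument, and put $\varphi^*=(\varphi,\cdot)\in\mathcal H^*$. Let $\mathcal F=\bigoplus_{n\ge0}\mathrm{Sym}\,\mathcal H^{\otimes n}$ be the Fock space with vacuum $|0\rangle$ and creation and annihilation operators $a^\pm[f]$, $[a^-[f],a^+[g]]=(f,g)$, and let $S\subset\mathcal F$ be the set of all $\Psi$ with $\sup_n n^m\|\Psi_n\|<\infty$ for every $m$. Regard $\mathcal H$ as a real space with the form $\omega(f,g)=i((f,g)-(g,f))$ and put $\Omega[f]=-i(a^+[f]-a^-[f])$. Let $\mathcal L\subset\mathcal H$ be a real subspace of finite dimension $k$ that is isotropic for $\omega$, with a translation-invariant (Haar) measure $\mu$. For $\Phi,\Psi\in S$ put $$\langle\Phi,\Psi\rangle=\int_{\mathcal L}d\mu(\varphi)\,(\Phi,e^{i\Omega[\varphi]}\Psi),\qquad \Phi\sim\Psi\iff\langle\Phi-\Psi,\Phi-\Psi\rangle=0 .$$ Let $B$ be a self-adjoint, possibly unbounded, operator in $\mathcal H$ with domain $D(B)$. For a symmetric Hilbert–Schmidt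 operator $M:\mathcal H^*\to\mathcal H$ (symmetric: $(f,Mg^*)=(g,Mf^*)$) write $a^+Ma^+=\sum_{p,q}a^+[f_p]\,(f_p,Mf_q^*)\,a^+[f_q]$ for an orthonormal basis $(f_p)$, and let $a^-M^*a^-$ be its formal adjoint. We write $M\in D(B)\otimes D(B)$ if $M$ maps into $D(B)$ and $BM$ is Hilbert–Schmidt. Let $A:\mathcal H^*\to\mathcal H$ be symmetric, Hilbert–Schmidt, with $A\in D(B)\otimes D(B)$, let $\varepsilon\in\mathbb C$, and let $$H=\tfrac12a^+Aa^++a^+Ba^-+\tfrac12a^-A^*a^-+\varepsilon,\qquad L\varphi=-iB\varphi-iA\varphi^*\quad(\varphi\in D(B)),$$ where $a^+Ba^-$ is the second quantization of $B$. Assume that $\mathcal L\subset D(B)$, $L\mathcal L\subset\mathcal L$ and $\operatorname{Im}\varepsilon=-\frac12\operatorname{Tr}L|_{\mathcal L}$. Let $\mathcal L^{\perp\omega}=\{\chi\in\mathcal H:\omega(\chi,\varphi)=0\ \text{for all}\ \varphi\in\mathcal L\}$, and let $\mathcal R=\mathcal L^{\perp\omega}/\mathcal L$ carry the norm $\|[\chi]\|_{\mathcal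 R}=\inf_{\varphi\in\mathcal L}\|\chi+\varphi\|$. **Lemma.** Let $M:\mathcal H^*\to\mathcal H$ be a symmetric Hilbert–Schmidt operator with $\|M\|<1$ and $M\in D(B)\otimes D(B)$, and suppose that the Gaussian vector $\Psi_M=\exp[\frac12a^+Ma^+]|0\rangle$ is an eigenfunction of $H$ in the physical Hilbert space: $\Psi_M\not\sim0$ and $H\Psi_M\sim E\Psi_M$ for some number $E$. Then the classical linear system $\dot\chi=L\chi$ is stable in $\mathcal R$: for every $r>0$ there is $\delta>0$ such that every solution $\chi:\mathbb R\to\mathcal H$ (a norm-continuous weak solution; classical solutions are included) with $\chi(0)\in\mathcal L^{\perp\omega}$ and $\|[\chi(0)]\|_{\mathcal R}<\delta$ satisfies $\chi(t)\in\mathcal L^{\perp\omega}$ and $\|[\chi(t)]\|_{\mathcal R}<r$ for all $t\in\mathbb R$. -/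

import Mathlib

open MeasureTheory Filter Topology
open scoped InnerProductSpace

noncomputable section

namespace ConstrainedFock

variable {ι H : Type*} [NormedAddCommGroup H] [InnerProductSpace ℂ H]

/-! ### Fock space over the one-particle space `H`

An orthonormal basis `b` of `H` identifies `H^{⊗n}` with `ℓ²(ι^n)`.  A family `Ψ` of functions
`Ψ n : (Fin n → ι) → ℂ` lists the coordinates of the components of a vector of the direct sum. -/

/-- Families of `n`-particle coordinate functions, without summability or symmetry conditions. -/
abbrev Family (ι : Type*) := (n : ℕ) → (Fin n → ι) → ℂ

/-- Membership in the Fock space `⊕ₙ Sym H^{⊗n}`. -/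
structure IsFock (Ψ : Family ι) : Prop where
  symm : ∀ (n : ℕ) (σ : Equiv.Perm (Fin n)) (i : Fin n → ι), Ψ n (i ∘ σ) = Ψ n i
  summable : Summable fun x : (n : ℕ) × (Fin n → ι) => ‖Ψ x.1 x.2‖ ^ 2

/-- The norm `‖Ψₙ‖` of the `n`-particle component. -/
def sectorNorm (Ψ : Family ι) (n : ℕ) : ℝ := √(∑' i, ‖Ψ n i‖ ^ 2)

/-- The space `S` of Fock vectors with `sup_n n^m ‖Ψₙ‖ < ∞` for every `m`. -/
structure IsSchwartz (Ψ : Family ι) : Prop extends IsFock Ψ where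
  decay : ∀ m : ℕ, ∃ C : ℝ, ∀ n : ℕ, (n : ℝ) ^ m * sectorNorm Ψ n ≤ C

/-- The inner product of the Fock space, linear in the second argument. -/
def fockInner (Φ Ψ : Family ι) : ℂ :=
  ∑' x : (n : ℕ) × (Fin n → ι), starRingEnd ℂ (Φ x.1 x.2) * Ψ x.1 x.2

/-- The vacuum vector. -/
def vacuum : Family ι := fun n _ => if n = 0 then 1 else 0

/-- The creation operator `a⁺[f]`; on symmetric `Ψₙ` it is `√(n+1) Sym (f ⊗ Ψₙ)`. -/
def creation (b : HilbertBasis ι ℂ H) (f : H) (Ψ : Family ι) : Family ι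
  | 0, _ => 0
  | n + 1, i => ((√(n + 1 : ℝ))⁻¹ : ℝ) *
      ∑ j : Fin (n + 1), ⟪b (i j), f⟫_ℂ * Ψ n (fun l => i (j.succAbove l))

/-- The annihilation operator `a⁻[f]`, adjoint to `a⁺[f]` on symmetric families. -/
def annihilation (b : HilbertBasis ι ℂ H) (f : H) (Ψ : Family ι) : Family ι :=
  fun n i => (√(n + 1 : ℝ) : ℝ) * ∑' p : ι, ⟪f, b p⟫_ℂ * Ψ (n + 1) (Fin.cons p i)

/-- The field operator `Ω[f] = -i (a⁺[f] - a⁻[f])`. -/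
def fieldOp (b : HilbertBasis ι ℂ H) (f : H) (Ψ : Family ι) : Family ι :=
  (-Complex.I) • (creation b f Ψ - annihilation b f Ψ)

/-- Truncation to at most `N` particles. -/
def truncate (N : ℕ) (Ψ : Family ι) : Family ι := fun n i => if n ≤ N then Ψ n i else 0

/-- The unitary operator `exp(iΩ[f])`: the exponential series converges on vectors with boundedly
many particles (they are analytic vectors of `Ω[f]`), and the operator is extended from these to
the Fock space by continuity. -/
def weyl (b : HilbertBasis ι ℂ H) (f : H) (Ψ : Family ι) : Family ι := fun n i =>
  limUnder atTop fun N : ℕ => ∑' m : ℕ, ((m.factorial : ℂ))⁻¹ *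
    ((fun Φ : Family ι => Complex.I • fieldOp b f Φ)^[m] (truncate N Ψ)) n i

/-! ### Quadratic forms in the creation and annihilation operators

A linear operator `M : H* → H` is given as the conjugate-linear operator `φ ↦ M φ*` of `H`, where
`φ* = (φ, ·)`.  Its kernel has the matrix `(b p, M (b q)*)`. -/

/-- `a⁺Ma⁺ = ∑ a⁺[b p] (b p, M (b q)*) a⁺[b q]`. -/
def createPair (b : HilbertBasis ι ℂ H) (M : H →L⋆[ℂ] H) (Ψ : Family ι) : Family ι := fun n i =>
  ∑' x : ι × ι, ⟪b x.1, M (b x.2)⟫_ℂ * creation b (b x.1) (creation b (b x.2) Ψ) n i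

/-- `a⁻M*a⁻`, the formal adjoint of `a⁺Ma⁺` for symmetric `M`. -/
def annihilatePair (b : HilbertBasis ι ℂ H) (M : H →L⋆[ℂ] H) (Ψ : Family ι) : Family ι :=
  fun n i => ∑' x : ι × ι, starRingEnd ℂ ⟪b x.1, M (b x.2)⟫_ℂ *
    annihilation b (b x.1) (annihilation b (b x.2) Ψ) n i

/-- The inner product `(h₁ ⊗ ⋯ ⊗ hₙ, T)` in `H^{⊗n}`. -/
def tensorPairing (b : HilbertBasis ι ℂ H) {n : ℕ} (h : Fin n → H) (T : (Fin n → ι) → ℂ) : ℂ :=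
  ∑' i : Fin n → ι, (∏ l, ⟪h l, b (i l)⟫_ℂ) * T i

/-- The graph of the operator `a⁺Ba⁻` (the second quantization of `B`).  For self-adjoint `B` the
operator `∑ⱼ 1 ⊗ ⋯ ⊗ B ⊗ ⋯ ⊗ 1` is essentially self-adjoint on the algebraic tensor product of
copies of `D(B)`; its closure is its adjoint, whose graph is described here. -/
def IsSecondQuantization (b : HilbertBasis ι ℂ H) (B : H →ₗ.[ℂ] H) (Ψ Ξ : Family ι) : Prop :=
  IsFock Ψ ∧ IsFock Ξ ∧ ∀ (n : ℕ) (h : Fin n → B.domain),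
    ∑ j, tensorPairing b (Function.update (fun l => (h l : H)) j (B (h j))) (Ψ n) =
      tensorPairing b (fun l => (h l : H)) (Ξ n)

/-- The Gaussian vector `Ψ_M = exp(½ a⁺Ma⁺)|0⟩`; in each sector one term of the series survives. -/
def gaussian (b : HilbertBasis ι ℂ H) (M : H →L⋆[ℂ] H) : Family ι := fun n i =>
  ∑' m : ℕ, ((m.factorial : ℂ))⁻¹ *
    ((fun Φ : Family ι => (1 / 2 : ℂ) • createPair b M Φ)^[m] vacuum) n i

/-- Symmetry of the kernel: `(f, M g*) = (g, M f*)`. -/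
def IsSymmKernel (M : H →L⋆[ℂ] H) : Prop := ∀ f g : H, ⟪f, M g⟫_ℂ = ⟪g, M f⟫_ℂ

/-- `M` is Hilbert–Schmidt, maps into `D(B)`, and `B M` is Hilbert–Schmidt.  For symmetric `M` this
says that the kernel lies in the domains of `B ⊗ 1` and `1 ⊗ B`, which holds for every kernel in
`D(B) ⊗ D(B)`, be the tensor product algebraic or completed in the graph norm. -/
def HasKernelInDomain (b : HilbertBasis ι ℂ H) (B : H →ₗ.[ℂ] H) (M : H →L⋆[ℂ] H) : Prop :=
  (Summable fun p => ‖M (b p)‖ ^ 2) ∧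
    ∃ h : ∀ f : H, M f ∈ B.domain, Summable fun p => ‖B ⟨M (b p), h (b p)⟩‖ ^ 2

/-! ### The classical phase space and the constrained quadratic system -/

/-- The symplectic form `ω(f, g) = i ((f, g) - (g, f))` on `H` regarded as a real space. -/
def sympl (f g : H) : ℂ := Complex.I * (⟪f, g⟫_ℂ - ⟪g, f⟫_ℂ)

/-- The skew-orthogonal complement `ℒ^{⊥ω}`. -/
def skewOrthogonal (ℒ : Submodule ℝ H) : Submodule ℝ H where
  carrier := {χ | ∀ φ ∈ ℒ, sympl χ φ = 0}
  zero_mem' := by intro φ _; simp [sympl]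
  add_mem' := by
    intro x y hx hy φ hφ
    have h₁ := hx φ hφ
    have h₂ := hy φ hφ
    simp only [sympl, inner_add_left, inner_add_right] at h₁ h₂ ⊢
    linear_combination h₁ + h₂
  smul_mem' := by
    intro c x hx φ hφ
    have h₁ := hx φ hφ
    have hc : c • x = (c : ℂ) • x := rfl
    simp only [sympl, hc, inner_smul_left, inner_smul_right, Complex.conj_ofReal] at h₁ ⊢
    linear_combination (c : ℂ) * h₁

/-- The reduced phase space `ℛ = ℒ^{⊥ω} / ℒ`, with the quotient (semi)norm
`‖[χ]‖ = inf ‖χ + φ‖`, `φ ∈ ℒ`. -/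
abbrev Reduced (ℒ : Submodule ℝ H) : Type _ :=
  skewOrthogonal ℒ ⧸ ℒ.submoduleOf (skewOrthogonal ℒ)

/-- The class `[χ] ∈ ℛ` of `χ ∈ ℒ^{⊥ω}`. -/
def toReduced (ℒ : Submodule ℝ H) (χ : H) (hχ : χ ∈ skewOrthogonal ℒ) : Reduced ℒ :=
  Submodule.Quotient.mk ⟨χ, hχ⟩

/-- The generator `L φ = -i B φ - i A φ*` of the classical system, on `D(B)`; the second component
of `(φ, φ*)` evolves by the conjugate expression. -/
def generator (B : H →ₗ.[ℂ] H) (A : H →L⋆[ℂ] H) : B.domain →ₗ[ℝ] H where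
  toFun φ := -(Complex.I • B φ) - Complex.I • A φ
  map_add' x y := by
    simp only [B.map_add, Submodule.coe_add, map_add, smul_add]
    abel
  map_smul' c x := by
    have hB : B (c • x) = (c : ℂ) • B x := B.map_smul (c : ℂ) x
    have hA : A ((c • x : B.domain) : H) = (c : ℂ) • A x := by
      have h := A.map_smulₛₗ (c : ℂ) (x : H)
      rwa [Complex.conj_ofReal] at h
    have hc : ∀ v : H, (RingHom.id ℝ) c • v = (c : ℂ) • v := fun _ => rfl
    rw [hB, hA, hc, smul_sub, smul_neg, smul_comm (c : ℂ), smul_comm (c : ℂ)]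

/-- A quadratic Hamiltonian `½ a⁺Aa⁺ + a⁺Ba⁻ + ½ a⁻A*a⁻ + ε` together with a finite-dimensional
isotropic plane `ℒ` of constraints that is compatible with it. -/
structure QuadraticSystem [CompleteSpace H] (b : HilbertBasis ι ℂ H) where
  B : H →ₗ.[ℂ] H
  A : H →L⋆[ℂ] H
  ε : ℂ
  ℒ : Submodule ℝ H
  selfAdjoint : IsSelfAdjoint B
  symmA : IsSymmKernel A
  kernelA : HasKernelInDomain b B A
  finiteDimensional : FiniteDimensional ℝ ℒ
  isotropic : ∀ φ ∈ ℒ, ∀ ψ ∈ ℒ, sympl φ ψ = 0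
  le_domain : ∀ φ ∈ ℒ, φ ∈ B.domain
  invariant : ∀ φ : ℒ, generator B A ⟨φ, le_domain φ φ.2⟩ ∈ ℒ
  im_ε : ε.im = -(1 / 2) * LinearMap.trace ℝ ℒ
    (LinearMap.codRestrict ℒ
      (generator B A ∘ₗ
        LinearMap.codRestrict (B.domain.restrictScalars ℝ) ℒ.subtype (fun φ => le_domain φ φ.2))
      invariant)

namespace QuadraticSystem

variable [CompleteSpace H] {b : HilbertBasis ι ℂ H} (Q : QuadraticSystem b)

/-- The graph of the Hamiltonian on `S ∩ D(a⁺Ba⁻)`, with values in `S`: `H Ψ = Θ`. -/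
def IsHamiltonianImage (Ψ Θ : Family ι) : Prop :=
  IsSchwartz Ψ ∧ IsSchwartz Θ ∧ ∃ Ξ : Family ι, IsSecondQuantization b Q.B Ψ Ξ ∧
    Θ = (1 / 2 : ℂ) • createPair b Q.A Ψ + Ξ + (1 / 2 : ℂ) • annihilatePair b Q.A Ψ + Q.ε • Ψ

/-- The inner product `⟨Φ, Ψ⟩ = ∫_ℒ dμ(φ) (Φ, exp(iΩ[φ]) Ψ)` on `S`. -/
def physInner [MeasurableSpace H] (μ : Measure Q.ℒ) (Φ Ψ : Family ι) : ℂ :=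
  ∫ φ : Q.ℒ, fockInner Φ (weyl b (φ : H) Ψ) ∂μ

/-- Equivalence `Φ ∼ Ψ`: the difference has zero physical norm. -/
def Equivalent [MeasurableSpace H] (μ : Measure Q.ℒ) (Φ Ψ : Family ι) : Prop :=
  Q.physInner μ (Φ - Ψ) (Φ - Ψ) = 0

/-- `[Ψ]` is an eigenvector of the Hamiltonian in the physical Hilbert space. -/
def IsEigenvector [MeasurableSpace H] (μ : Measure Q.ℒ) (Ψ : Family ι) : Prop :=
  ¬ Q.Equivalent μ Ψ 0 ∧
    ∃ (E : ℂ) (Θ : Family ι), Q.IsHamiltonianImage Ψ Θ ∧ Q.Equivalent μ Θ (E • Ψ)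

/-- Solutions of `χ' = L χ`, in the weak sense: the equation holds after pairing with the elements
of `D(B)`, where `B` is moved to the test vector.  These are the classical solutions and, more
generally, the orbits `t ↦ u_t χ₀`, `χ₀ ∈ H`, of the continuous extension of the classical flow. -/
def IsSolution (χ : ℝ → H) : Prop :=
  Continuous χ ∧ ∀ (h : Q.B.domain) (t : ℝ),
    HasDerivAt (fun s => ⟪(h : H), χ s⟫_ℂ)
      (-(Complex.I * ⟪Q.B h, χ t⟫_ℂ) - Complex.I * ⟪(h : H), Q.A (χ t)⟫_ℂ) t

/-- Lyapunov stability in the reduced space `ℛ`, for all times of both signs; it includes that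
solutions starting in `ℒ^{⊥ω}` remain there, so that they define curves in `ℛ`. -/
def IsStable : Prop :=
  ∀ r > (0 : ℝ), ∃ δ > (0 : ℝ), ∀ χ : ℝ → H, Q.IsSolution χ →
    ∀ h₀ : χ 0 ∈ skewOrthogonal Q.ℒ, ‖toReduced Q.ℒ (χ 0) h₀‖ < δ →
      ∀ t : ℝ, ∃ h : χ t ∈ skewOrthogonal Q.ℒ, ‖toReduced Q.ℒ (χ t) h‖ < r

end QuadraticSystem

end ConstrainedFock

end

/-! The Gaussian vector is killed by `D_v = a⁻[v] - a⁺[M v]` for every `v`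
(`annihilation_gaussian`). Commuting `D_v` through the Hamiltonian gives `D_v HΨ = a⁺[K v] Ψ` with
the Riccati expression `K v = A v + B M v + M B v + M A M v` (`annihilation_hamiltonian`). If `HΨ =
EΨ` held exactly, `K` would vanish. Here it holds only up to a vector `n` of zero physical norm, and
`D_v` may be applied to `n` only when it has an adjoint for the physical product. By the
intertwining relations of the Weyl operators this is so when `(v, φ - M φ) = 0` for all `φ ∈ ℒ`;
such `v` are called admissible (`phys_gaussAn`). For them `D_v D_v n = (v, K v) Ψ`, so `(v, K v)⟨Ψ,
Ψ⟩` is a product of `n` with another vector. The physical form is positive semidefinite, hence null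
vectors are orthogonal to everything (`phys_eq_zero_of_null`). Since `Ψ` is not null, `(v, K v) = 0`
(`inner_riccatiForm_eq_zero`).

The classical half uses the decomposition `χ = v + M v + φ` of each `χ ∈ ℒ^{⊥ω}` with `v` admissible
and `φ ∈ ℒ` (`exists_decomposition`). The class of `χ` in `ℛ` is controlled by `v` and controls it,
because `‖M‖ < 1` (`one_sub_norm_mul_le`). The function `‖v‖² - ‖M v‖²` is constant along the flow:
its derivative is `2 Re ((v, Lχ) - (Lχ, M v))`, which vanishes by `(v, K v) = 0`, self-adjointness
of `B` and invariance of `ℒ` (`re_inner_generator_eq_zero`). It lies between `(1 - ‖M‖²)‖v‖²` and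
`‖v‖²`, which is stability. Weak solutions are reached through their Steklov averages, which are
strong solutions (`isStable_of_riccati`). -/

noncomputable section

namespace ConstrainedFock

/-! ### Conservation laws and stability of the classical system -/

section Classical

variable {H : Type*} [NormedAddCommGroup H] [InnerProductSpace ℂ H]

/-- A conjugate-linear operator as a real-linear operator. -/
def toRealCLM (M : H →L⋆[ℂ] H) : H →L[ℝ] H where
  toFun := M
  map_add' := M.map_add
  map_smul' c x := by
    have h := M.map_smulₛₗ (c : ℂ) x
    rwa [Complex.conj_ofReal] at h
  cont := M.continuous

@[simp]
theorem toRealCLM_apply (M : H →L⋆[ℂ] H) (x : H) : toRealCLM M x = M x := rfl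

theorem norm_toRealCLM_le (M : H →L⋆[ℂ] H) : ‖toRealCLM M‖ ≤ ‖M‖ :=
  ContinuousLinearMap.opNorm_le_bound _ (norm_nonneg _) fun x => M.le_opNorm x

theorem sympl_eq_zero_iff {f g : H} : sympl f g = 0 ↔ (⟪g, f⟫_ℂ).im = 0 := by
  have h : ⟪f, g⟫_ℂ = starRingEnd ℂ ⟪g, f⟫_ℂ := (inner_conj_symm f g).symm
  rw [sympl, h, mul_eq_zero, or_iff_right Complex.I_ne_zero]
  generalize ⟪g, f⟫_ℂ = z
  simp only [Complex.ext_iff, Complex.sub_re, Complex.sub_im, Complex.conj_re, Complex.conj_im,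
    Complex.zero_re, Complex.zero_im, sub_self, true_and]
  constructor <;> intro h <;> linarith

theorem mem_skewOrthogonal {ℒ : Submodule ℝ H} {χ : H} :
    χ ∈ skewOrthogonal ℒ ↔ ∀ φ ∈ ℒ, (⟪φ, χ⟫_ℂ).im = 0 :=
  forall₂_congr fun _ _ => sympl_eq_zero_iff

/-- The vectors orthogonal to `φ - M φ` for every `φ ∈ ℒ`. -/
def IsAdmissible (M : H →L⋆[ℂ] H) (ℒ : Submodule ℝ H) (v : H) : Prop :=
  ∀ φ ∈ ℒ, ⟪v, φ - M φ⟫_ℂ = 0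

/-- Neumann series. It is taken over the reals, since `1 + M` is only real-linear for a
conjugate-linear `M`. -/
theorem exists_rightInverse_one_add [CompleteSpace H] {M : H →L⋆[ℂ] H} (hM : ‖M‖ < 1) :
    ∃ G : H →L[ℝ] H, ∀ x, G x + M (G x) = x := by
  have h : ‖-toRealCLM M‖ < 1 := by
    rw [norm_neg]
    exact (norm_toRealCLM_le M).trans_lt hM
  obtain ⟨u, hu⟩ := isUnit_one_sub_of_norm_lt_one h
  refine ⟨(↑u⁻¹ : H →L[ℝ] H), fun x => ?_⟩
  have h₂ := congrArg (fun T : H →L[ℝ] H => T x) u.mul_inv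
  rw [hu] at h₂
  simpa using h₂

/-- Symmetry turns `(φ, M v)` into `(v, M φ)`, so `φ` enters only through `(v, φ - M φ)`, and the
two terms `(v, M v)` cancel. -/
theorem norm_sq_sub_norm_sq_eq {M : H →L⋆[ℂ] H} (hs : IsSymmKernel M) (v φ : H)
    (hv : ⟪v, φ - M φ⟫_ℂ = 0) :
    ⟪v, v + M v + φ⟫_ℂ - ⟪v + M v + φ, M v⟫_ℂ = ⟪v, v⟫_ℂ - ⟪M v, M v⟫_ℂ := by
  have h := hs v φ
  rw [inner_sub_right, sub_eq_zero] at hv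
  simp only [inner_add_left, inner_add_right]
  linear_combination hv + h

/-- With `χ = v + M v + φ`, Cauchy–Schwarz in the preceding identity gives `‖v‖² - ‖M v‖² ≤ ‖χ‖ (‖v‖
+ ‖M v‖)`; divide by the sum of the norms. The bound does not see the size of `φ`, so it bounds `v`
by the quotient norm. -/
theorem one_sub_norm_mul_le {M : H →L⋆[ℂ] H} (hs : IsSymmKernel M) {v φ : H}
    (hv : ⟪v, φ - M φ⟫_ℂ = 0) : (1 - ‖M‖) * ‖v‖ ≤ ‖v + M v + φ‖ := by
  rcases eq_or_ne v 0 with rfl | hv0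
  · simp
  have h := congrArg Complex.re (norm_sq_sub_norm_sq_eq hs v φ hv)
  have e₁ : (⟪v, v⟫_ℂ).re = ‖v‖ ^ 2 := inner_self_eq_norm_sq (𝕜 := ℂ) v
  have e₂ : (⟪M v, M v⟫_ℂ).re = ‖M v‖ ^ 2 := inner_self_eq_norm_sq (𝕜 := ℂ) (M v)
  rw [Complex.sub_re, Complex.sub_re, e₁, e₂] at h
  have b₁ : (⟪v, v + M v + φ⟫_ℂ).re ≤ ‖v‖ * ‖v + M v + φ‖ := re_inner_le_norm (𝕜 := ℂ) _ _
  have b₂ : -(⟪v + M v + φ, M v⟫_ℂ).re ≤ ‖v + M v + φ‖ * ‖M v‖ :=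
    (neg_le_abs _).trans ((Complex.abs_re_le_norm _).trans (norm_inner_le_norm _ _))
  have b₃ := M.le_opNorm v
  have hp : 0 < ‖v‖ := norm_pos_iff.2 hv0
  have h0 := norm_nonneg (v + M v + φ)
  have hM0 := norm_nonneg M
  have hMv0 := norm_nonneg (M v)
  by_contra! hlt
  nlinarith [mul_nonneg h0 hMv0, mul_lt_mul_of_pos_right hlt (by linarith : 0 < ‖v‖ + ‖M v‖),
    mul_nonneg hp.le hMv0]

/-- Decomposition `χ = v + M v + φ` of the elements of `ℒ^{⊥ω}`. -/
theorem exists_decomposition [CompleteSpace H] {M : H →L⋆[ℂ] H} (hM : ‖M‖ < 1)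
    (hs : IsSymmKernel M) (ℒ : Submodule ℝ H) [FiniteDimensional ℝ ℒ]
    (hiso : ∀ φ ∈ ℒ, ∀ ψ ∈ ℒ, sympl φ ψ = 0) :
    ∃ V : H →L[ℝ] H, ∀ χ ∈ skewOrthogonal ℒ,
      IsAdmissible M ℒ (V χ) ∧ ∃ φ ∈ ℒ, χ = V χ + M (V χ) + φ := by
  obtain ⟨G, hG⟩ := exists_rightInverse_one_add hM
  let bs := Module.finBasis ℝ ℒ
  -- Only real parts are imposed: `dim ℒ` real conditions, to be solved with the `dim ℒ` real
  -- parameters of a vector of `ℒ`.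
  let Λ : H →L[ℝ] (Fin (Module.finrank ℝ ℒ) → ℝ) := ContinuousLinearMap.pi fun j =>
    Complex.reCLM ∘L ((innerSL ℂ ((bs j : H) - M (bs j))).restrictScalars ℝ) ∘L G
  have hΛ : ∀ x j, Λ x j = (⟪(bs j : H) - M (bs j), G x⟫_ℂ).re := fun _ _ => rfl
  have hΛ' : ∀ x, Λ x = 0 → ∀ ψ ∈ ℒ, (⟪ψ - M ψ, G x⟫_ℂ).re = 0 := by
    intro x hx ψ hψ
    let q : H →L[ℝ] ℝ := Complex.reCLM ∘L ((innerSL ℂ (G x)).restrictScalars ℝ) ∘L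
      (ContinuousLinearMap.id ℝ H - toRealCLM M)
    have hq : ∀ y, q y = (⟪G x, y - M y⟫_ℂ).re := fun _ => rfl
    have hz : (q : H →ₗ[ℝ] ℝ) ∘ₗ ℒ.subtype = 0 := by
      refine bs.ext fun j => ?_
      have h := congrFun hx j
      rw [hΛ, ← inner_conj_symm, Complex.conj_re] at h
      exact h
    have h := congrArg (fun T => T ⟨ψ, hψ⟩) hz
    rw [← inner_conj_symm, Complex.conj_re]
    exact h
  -- The imaginary half of admissibility is automatic: by symmetry of `M` it is `-Im (ψ, Gχ + M Gχ)
  -- = -Im (ψ, χ)`.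
  have him : ∀ χ ∈ skewOrthogonal ℒ, ∀ ψ ∈ ℒ, (⟪G χ, ψ - M ψ⟫_ℂ).im = 0 := by
    intro χ hχ ψ hψ
    have h := mem_skewOrthogonal.1 hχ ψ hψ
    rw [← hG χ, inner_add_right] at h
    have h₁ := hs (G χ) ψ
    have h₂ : (⟪G χ, ψ⟫_ℂ).im = -(⟪ψ, G χ⟫_ℂ).im := by
      rw [← inner_conj_symm, Complex.conj_im]
    rw [inner_sub_right, h₁, Complex.sub_im, h₂]
    rw [Complex.add_im] at h
    linarith
  have hzero : ∀ χ ∈ skewOrthogonal ℒ, Λ χ = 0 → IsAdmissible M ℒ (G χ) := by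
    intro χ hχ h0 ψ hψ
    refine Complex.ext ?_ (him χ hχ ψ hψ)
    rw [← inner_conj_symm, Complex.conj_re]
    exact hΛ' χ h0 ψ hψ
  have hle : ∀ φ ∈ ℒ, φ ∈ skewOrthogonal ℒ := fun φ hφ ψ hψ => hiso φ hφ ψ hψ
  -- If `Λ φ = 0` then `Gφ` is admissible, and the norm estimate applied to `Gφ + M Gφ - φ = 0`
  -- gives `Gφ = 0`, hence `φ = 0`. Equality of dimensions then makes `Λ` bijective on `ℒ`.
  have hinj : Function.Injective (Λ.toLinearMap ∘ₗ ℒ.subtype) := by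
    rw [injective_iff_map_eq_zero]
    intro φ hφ
    have hadm := hzero φ (hle φ φ.2) hφ
    have hb := one_sub_norm_mul_le hs (v := G φ) (φ := -(φ : H)) (by
      have := hadm φ φ.2
      rw [map_neg, ← neg_sub', inner_neg_right, this, neg_zero])
    rw [hG, add_neg_cancel, norm_zero] at hb
    have hG0 : G φ = 0 := by
      rw [← norm_le_zero_iff]
      by_contra! hlt
      nlinarith
    have := hG φ
    rw [hG0] at this
    exact Subtype.ext (by simpa using this.symm)
  let e : ℒ ≃ₗ[ℝ] (Fin (Module.finrank ℝ ℒ) → ℝ) :=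
    LinearEquiv.ofInjectiveOfFinrankEq _ hinj (by simp)
  let P : H →L[ℝ] H := ℒ.subtypeL ∘L (LinearMap.toContinuousLinearMap
    (e.symm : (Fin (Module.finrank ℝ ℒ) → ℝ) →ₗ[ℝ] ℒ)) ∘L Λ
  have hP : ∀ x, P x ∈ ℒ := fun x => (e.symm (Λ x)).2
  have hΛP : ∀ x, Λ (P x) = Λ x := fun x => e.apply_symm_apply (Λ x)
  refine ⟨G ∘L (ContinuousLinearMap.id ℝ H - P), fun χ hχ => ⟨?_, P χ, hP χ, ?_⟩⟩
  · have hmem : χ - P χ ∈ skewOrthogonal ℒ := Submodule.sub_mem _ hχ (hle _ (hP χ))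
    exact hzero (χ - P χ) hmem (by rw [map_sub, hΛP, sub_self])
  · have := hG (χ - P χ)
    change χ = G (χ - P χ) + M (G (χ - P χ)) + P χ
    rw [this, sub_add_cancel]

/-! ### Self-adjointness of `B` and the infinitesimal conservation law. -/

theorem mem_domain_of_isSelfAdjoint [CompleteSpace H] {B : H →ₗ.[ℂ] H} (hB : IsSelfAdjoint B)
    {x w : H} (h : ∀ y : B.domain, ⟪w, y⟫_ℂ = ⟪x, B y⟫_ℂ) :
    ∃ hx : x ∈ B.domain, B ⟨x, hx⟩ = w := by
  have hd := hB.dense_domain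
  have hle : B.adjoint ≤ B := le_of_eq hB
  have hx : x ∈ B.adjoint.domain := B.mem_adjoint_domain_of_exists x ⟨w, h⟩
  refine ⟨hle.1 hx, ?_⟩
  rw [← hle.2 (x := ⟨x, hx⟩) rfl]
  exact LinearPMap.adjoint_apply_eq hd _ h

theorem inner_apply_of_isSelfAdjoint [CompleteSpace H] {B : H →ₗ.[ℂ] H} (hB : IsSelfAdjoint B)
    (x y : B.domain) : ⟪B x, (y : H)⟫_ℂ = ⟪(x : H), B y⟫_ℂ := by
  have h := LinearPMap.adjoint_isFormalAdjoint hB.dense_domain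
  rw [show B.adjoint = B from hB] at h
  exact h x y

/-- The quadratic expression whose vanishing on admissible vectors makes the reduced flow
preserve `‖v‖² - ‖M v‖²`. -/
def riccatiForm (B : H →ₗ.[ℂ] H) (A M : H →L⋆[ℂ] H) (hMd : ∀ f, M f ∈ B.domain)
    (v : B.domain) : H :=
  A v + B ⟨M v, hMd v⟩ + M (B v) + M (A (M v))

theorem generator_apply (B : H →ₗ.[ℂ] H) (A : H →L⋆[ℂ] H) (x : B.domain) :
    generator B A x = -(Complex.I • B x) - Complex.I • A x := rfl

/-- Along the classical flow `Re ((v, dχ/dt) - (dχ/dt, M v))` vanishes. -/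
theorem re_inner_generator_eq_zero [CompleteSpace H] {B : H →ₗ.[ℂ] H} (hB : IsSelfAdjoint B)
    {A M : H →L⋆[ℂ] H} (hA : IsSymmKernel A) (hs : IsSymmKernel M) (hMd : ∀ f, M f ∈ B.domain)
    (v φ x : B.domain) (hx : (x : H) = v + M v + φ)
    (hφ : ⟪(v : H), generator B A φ - M (generator B A φ)⟫_ℂ = 0)
    (hK : ⟪(v : H), riccatiForm B A M hMd v⟫_ℂ = 0) :
    (⟪(v : H), generator B A x⟫_ℂ - ⟪generator B A x, M v⟫_ℂ).re = 0 := by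
  let m : B.domain := ⟨M v, hMd v⟩
  have hm : (m : H) = M v := rfl
  have hxe : x = v + m + φ := Subtype.ext hx
  have hL : ⟪(v : H), generator B A φ⟫_ℂ - ⟪generator B A φ, M v⟫_ℂ = 0 := by
    rw [← hs, ← inner_sub_right, hφ]
  rw [hxe, map_add, inner_add_right, inner_add_left]
  -- Four of the eight terms add up to `(v, K v) = 0`. The rest is `-i` times a sum of diagonal
  -- matrix elements of `B` and a number plus its conjugate, that is, `-i` times a real number.
  have e : ⟪(v : H), generator B A (v + m)⟫_ℂ - ⟪generator B A (v + m), M v⟫_ℂ =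
      -Complex.I * (⟪(v : H), B v⟫_ℂ + ⟪B m, (m : H)⟫_ℂ +
        (⟪(v : H), A (M v)⟫_ℂ + starRingEnd ℂ ⟪(v : H), A (M v)⟫_ℂ)) := by
    have h₁ : ⟪B v, (m : H)⟫_ℂ = ⟪(v : H), M (B v)⟫_ℂ := (hs _ _).symm
    have h₂ : ⟪A (M v), M v⟫_ℂ = ⟪(v : H), M (A (M v))⟫_ℂ := (hs _ _).symm
    have h₃ : ⟪A v, M v⟫_ℂ = starRingEnd ℂ ⟪(v : H), A (M v)⟫_ℂ := by
      rw [hA, inner_conj_symm]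
    have hK' := hK
    simp only [riccatiForm, inner_add_right] at hK'
    have hBm : B ⟨M v, hMd v⟩ = B m := rfl
    rw [hBm] at hK'
    simp only [generator_apply, map_add, hm, inner_add_right,
      inner_add_left, inner_sub_left, inner_sub_right, inner_neg_left, inner_neg_right,
      inner_smul_left, inner_smul_right, Complex.conj_I, h₂, h₃] at h₁ ⊢
    rw [h₁]
    linear_combination (-Complex.I) * hK'
  have r : ∀ z : B.domain, (⟪(z : H), B z⟫_ℂ).im = 0 := by
    intro z
    have h := inner_apply_of_isSelfAdjoint hB z z
    rw [← inner_conj_symm, Complex.conj_eq_iff_im] at h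
    exact h
  have r₂ : (⟪B m, (m : H)⟫_ℂ).im = 0 := by rw [inner_apply_of_isSelfAdjoint hB, r]
  have split : ∀ a b c d : ℂ, (a + b - (c + d)).re = (a - c).re + (b - d).re := by
    intro a b c d; simp only [Complex.add_re, Complex.sub_re]; ring
  rw [split, hL, e]
  generalize ⟪(v : H), A (M v)⟫_ℂ = z
  simp [r, r₂]

theorem hasDerivAt_inner_const {X : ℝ → H} {X' : H} {t : ℝ} (h : HasDerivAt X X' t) (φ : H) :
    HasDerivAt (fun s => ⟪φ, X s⟫_ℂ) ⟪φ, X'⟫_ℂ t :=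
  ((innerSL ℂ φ).restrictScalars ℝ).hasFDerivAt.comp_hasDerivAt t h

theorem hasDerivAt_im {f : ℝ → ℂ} {f' : ℂ} {t : ℝ} (h : HasDerivAt f f' t) :
    HasDerivAt (fun s => (f s).im) f'.im t :=
  Complex.imCLM.hasFDerivAt.comp_hasDerivAt t h

theorem hasDerivAt_norm_sq {X : ℝ → H} {X' : H} {t : ℝ} (h : HasDerivAt X X' t) :
    HasDerivAt (fun s => ‖X s‖ ^ 2) (2 * (⟪X t, X'⟫_ℂ).re) t := by
  have h₁ := Complex.reCLM.hasFDerivAt.comp_hasDerivAt t (h.inner ℂ h)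
  have e : (fun s => ‖X s‖ ^ 2) = Complex.reCLM ∘ fun s => ⟪X s, X s⟫_ℂ := by
    ext s
    exact (inner_self_eq_norm_sq (𝕜 := ℂ) (X s)).symm
  rw [e]
  have e₂ : 2 * (⟪X t, X'⟫_ℂ).re = Complex.reCLM (⟪X t, X'⟫_ℂ + ⟪X', X t⟫_ℂ) := by
    rw [Complex.reCLM_apply, Complex.add_re, two_mul, ← inner_conj_symm X' (X t), Complex.conj_re]
  rw [e₂]
  exact h₁

/-! ### Solutions, the conserved form and stability. -/

namespace QuadraticSystem

variable [CompleteSpace H] {ι : Type*} {b : HilbertBasis ι ℂ H} (Q : QuadraticSystem b)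

/-- Strong solutions of `dχ/dt = L χ`. -/
def IsStrongSolution (X : ℝ → H) : Prop :=
  ∀ t, ∃ h : X t ∈ Q.B.domain, HasDerivAt X (generator Q.B Q.A ⟨X t, h⟩) t

variable {Q} in
-- Because `ℒ` is invariant under `L`, the numbers `Im (φⱼ, χ)` for a basis `φⱼ` of `ℒ` satisfy a
-- closed linear system of ordinary differential equations, so they vanish for all times if they
-- vanish at time `0`.
theorem IsSolution.mem_skewOrthogonal {χ : ℝ → H} (hχ : Q.IsSolution χ)
    (h₀ : χ 0 ∈ skewOrthogonal Q.ℒ) (t : ℝ) : χ t ∈ skewOrthogonal Q.ℒ := by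
  have := Q.finiteDimensional
  let bs := Module.finBasis ℝ Q.ℒ
  let Λ : Q.ℒ → Q.ℒ := fun φ => ⟨_, Q.invariant φ⟩
  -- `L` is skew for `ω`: the derivative of `Im (φ, χ)` is `-Im (L φ, χ)`.
  have hd : ∀ (φ : Q.ℒ) (t : ℝ), HasDerivAt (fun s => (⟪(φ : H), χ s⟫_ℂ).im)
      (-(⟪(Λ φ : H), χ t⟫_ℂ).im) t := by
    intro φ t
    have h := hasDerivAt_im (hχ.2 ⟨φ, Q.le_domain φ φ.2⟩ t)
    have e : -(⟪(Λ φ : H), χ t⟫_ℂ).im = (-(Complex.I * ⟪Q.B ⟨φ, Q.le_domain φ φ.2⟩, χ t⟫_ℂ) -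
        Complex.I * ⟪(φ : H), Q.A (χ t)⟫_ℂ).im := by
      rw [Q.symmA, ← inner_conj_symm (χ t)]
      simp only [Λ, generator_apply, inner_sub_left, inner_neg_left, inner_smul_left,
        Complex.conj_I]
      generalize ⟪Q.A φ, χ t⟫_ℂ = z
      simp
      ring
    rw [e]
    exact h
  have hsum : ∀ (φ : Q.ℒ) (y : H),
      (⟪(φ : H), y⟫_ℂ).im = ∑ l, bs.repr φ l * (⟪(bs l : H), y⟫_ℂ).im := by
    intro φ y
    let q : Q.ℒ →ₗ[ℝ] ℝ := (Complex.imCLM ∘L ((innerSL ℂ y).restrictScalars ℝ)).toLinearMap ∘ₗ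
      Q.ℒ.subtype
    have hq : ∀ φ : Q.ℒ, (⟪(φ : H), y⟫_ℂ).im = -q φ := by
      intro φ
      rw [← inner_conj_symm, Complex.conj_im]
      rfl
    rw [hq, ← bs.sum_repr φ, map_sum, ← Finset.sum_neg_distrib]
    refine Finset.sum_congr rfl fun l _ => ?_
    rw [hq, map_smul, bs.sum_repr, smul_eq_mul, mul_neg]
  let G : (Fin (Module.finrank ℝ Q.ℒ) → ℝ) →L[ℝ] (Fin (Module.finrank ℝ Q.ℒ) → ℝ) :=
    ContinuousLinearMap.pi fun j => -∑ l, bs.repr (Λ (bs j)) l • ContinuousLinearMap.proj l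
  let x : ℝ → Fin (Module.finrank ℝ Q.ℒ) → ℝ := fun s j => (⟪(bs j : H), χ s⟫_ℂ).im
  have hx : ∀ s, HasDerivAt x (G (x s)) s := by
    intro s
    rw [hasDerivAt_pi]
    intro j
    have h := hd (bs j) s
    rw [hsum] at h
    simpa [G, x] using h
  have hxz : x = 0 := by
    refine ODE_solution_unique_univ (v := fun _ => G) (s := fun _ => Set.univ) (t₀ := 0)
      (fun _ => G.lipschitz.lipschitzOnWith) (fun s => ⟨hx s, Set.mem_univ _⟩)
      (fun s => ⟨?_, Set.mem_univ _⟩) ?_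
    · simp
    · ext j
      exact ConstrainedFock.mem_skewOrthogonal.1 h₀ (bs j) (bs j).2
  refine ConstrainedFock.mem_skewOrthogonal.2 fun φ hφ => ?_
  rw [hsum ⟨φ, hφ⟩]
  refine Finset.sum_eq_zero fun l _ => ?_
  rw [show (⟪(bs l : H), χ t⟫_ℂ).im = 0 from congrFun (congrFun hxz t) l, mul_zero]

variable {Q} in
/-- The Steklov averages of weak solutions are strong solutions. -/
theorem IsSolution.isStrongSolution_average {χ : ℝ → H} (hχ : Q.IsSolution χ) (ε : ℝ) :
    Q.IsStrongSolution fun t => ∫ s in t..t + ε, χ s := by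
  intro t
  have hc := hχ.1
  have hinteg : ∀ a c : ℝ, IntervalIntegrable χ volume a c := fun a c => hc.intervalIntegrable a c
  set X := ∫ s in t..t + ε, χ s with hX
  have hderiv : HasDerivAt (fun t => ∫ s in t..t + ε, χ s) (χ (t + ε) - χ t) t := by
    have h₁ : ∀ u, HasDerivAt (fun u => ∫ s in (0 : ℝ)..u, χ s) (χ u) u := fun u =>
      intervalIntegral.integral_hasDerivAt_right (hinteg _ _)
        (hc.stronglyMeasurableAtFilter _ _) hc.continuousAt
    have h₂ := ((h₁ (t + ε)).comp_add_const t ε).sub (h₁ t)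
    refine h₂.congr_of_eventuallyEq (Eventually.of_forall fun u => ?_)
    exact (intervalIntegral.integral_interval_sub_left (hinteg _ _) (hinteg _ _)).symm
  have hin : ∀ h : H, ⟪h, X⟫_ℂ = ∫ s in t..t + ε, ⟪h, χ s⟫_ℂ := fun h =>
    ((innerSL ℂ h).intervalIntegral_comp_comm (hinteg _ _)).symm
  have hA : Q.A X = ∫ s in t..t + ε, Q.A (χ s) :=
    ((toRealCLM Q.A).intervalIntegral_comp_comm (hinteg _ _)).symm
  have hAc : Continuous fun s => Q.A (χ s) := Q.A.continuous.comp hc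
  have hinA : ∀ h : H, ⟪h, Q.A X⟫_ℂ = ∫ s in t..t + ε, ⟪h, Q.A (χ s)⟫_ℂ := fun h => by
    rw [hA]
    exact ((innerSL ℂ h).intervalIntegral_comp_comm (hAc.intervalIntegrable _ _)).symm
  -- The weak equation integrated over `[t, t + ε]`.
  have key : ∀ h : Q.B.domain, ⟪(h : H), χ (t + ε) - χ t⟫_ℂ =
      -(Complex.I * ⟪Q.B h, X⟫_ℂ) - Complex.I * ⟪(h : H), Q.A X⟫_ℂ := by
    intro h
    have c₁ : Continuous fun s => ⟪Q.B h, χ s⟫_ℂ := by fun_prop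
    have c₂ : Continuous fun s => ⟪(h : H), Q.A (χ s)⟫_ℂ := by fun_prop
    rw [inner_sub_right, ← intervalIntegral.integral_eq_sub_of_hasDerivAt
      (fun s _ => hχ.2 h s) (Continuous.intervalIntegrable (by fun_prop) _ _), hin, hinA,
      intervalIntegral.integral_sub (Continuous.intervalIntegrable (by fun_prop) _ _)
        (Continuous.intervalIntegrable (by fun_prop) _ _),
      intervalIntegral.integral_neg, intervalIntegral.integral_const_mul,
      intervalIntegral.integral_const_mul]
  -- The witness comes from solving `-i B X - i A X = χ(t + ε) - χ(t)` for `B X`. The integrated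
  -- identity says that `X` lies in the domain of the adjoint of `B`, which is `B`.
  obtain ⟨hd, hB⟩ := mem_domain_of_isSelfAdjoint Q.selfAdjoint (x := X)
    (w := Complex.I • (χ (t + ε) - χ t) - Q.A X) (by
      intro y
      have h := congrArg (starRingEnd ℂ) (key y)
      rw [inner_conj_symm] at h
      simp only [map_sub, map_neg, map_mul, Complex.conj_I, inner_conj_symm] at h
      rw [inner_sub_left, inner_smul_left, Complex.conj_I, h]
      linear_combination (⟪X, Q.B y⟫_ℂ + ⟪Q.A X, y⟫_ℂ) * (-Complex.I_mul_I))
  refine ⟨hd, ?_⟩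
  have e : generator Q.B Q.A ⟨X, hd⟩ = χ (t + ε) - χ t := by
    rw [generator_apply, hB, smul_sub, smul_smul, Complex.I_mul_I]
    simp
  rw [e]
  exact hderiv

variable {Q} in
theorem IsStrongSolution.norm_sq_sub_norm_sq_const {M : H →L⋆[ℂ] H}
    (hs : IsSymmKernel M) (hMd : ∀ f, M f ∈ Q.B.domain)
    (hK : ∀ v : Q.B.domain, IsAdmissible M Q.ℒ v → ⟪(v : H), riccatiForm Q.B Q.A M hMd v⟫_ℂ = 0)
    {V : H →L[ℝ] H} (hV : ∀ χ ∈ skewOrthogonal Q.ℒ,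
      IsAdmissible M Q.ℒ (V χ) ∧ ∃ φ ∈ Q.ℒ, χ = V χ + M (V χ) + φ)
    {X : ℝ → H} (hX : Q.IsStrongSolution X) (hmem : ∀ t, X t ∈ skewOrthogonal Q.ℒ) (t : ℝ) :
    ‖V (X t)‖ ^ 2 - ‖M (V (X t))‖ ^ 2 = ‖V (X 0)‖ ^ 2 - ‖M (V (X 0))‖ ^ 2 := by
  have hd : ∀ t, HasDerivAt (fun t => ‖V (X t)‖ ^ 2 - ‖M (V (X t))‖ ^ 2) 0 t := by
    intro t
    obtain ⟨hdom, hX'⟩ := hX t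
    set X' := generator Q.B Q.A ⟨X t, hdom⟩
    have hv : HasDerivAt (fun t => V (X t)) (V X') t := V.hasFDerivAt.comp_hasDerivAt t hX'
    have hMv : HasDerivAt (fun t => M (V (X t))) (M (V X')) t :=
      (toRealCLM M).hasFDerivAt.comp_hasDerivAt t hv
    have h := (hasDerivAt_norm_sq hv).sub (hasDerivAt_norm_sq hMv)
    obtain ⟨hadm, φ, hφ, hdec⟩ := hV _ (hmem t)
    -- The velocity also lies in `ℒ^{⊥ω}`, so it can be decomposed, and its component `V X'` is the
    -- derivative of `V X`.
    have hX'mem : X' ∈ skewOrthogonal Q.ℒ := by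
      refine ConstrainedFock.mem_skewOrthogonal.2 fun ψ hψ => ?_
      have h₁ := hasDerivAt_im (hasDerivAt_inner_const hX' ψ)
      have h₂ : (fun s => (⟪ψ, X s⟫_ℂ).im) = fun _ => 0 :=
        funext fun s => ConstrainedFock.mem_skewOrthogonal.1 (hmem s) ψ hψ
      rw [h₂] at h₁
      exact h₁.unique (hasDerivAt_const t 0)
    obtain ⟨hadm', φ', hφ', hdec'⟩ := hV _ hX'mem
    have hvd : V (X t) ∈ Q.B.domain := by
      have : V (X t) = X t - M (V (X t)) - φ := by
        nth_rw 2 [hdec]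
        abel
      rw [this]
      exact Q.B.domain.sub_mem (Q.B.domain.sub_mem hdom (hMd _)) (Q.le_domain φ hφ)
    have hz := re_inner_generator_eq_zero Q.selfAdjoint Q.symmA hs hMd ⟨V (X t), hvd⟩
      ⟨φ, Q.le_domain φ hφ⟩ ⟨X t, hdom⟩ hdec (hadm _ (Q.invariant ⟨φ, hφ⟩)) (hK _ hadm)
    -- Substituting the decomposition of `X'` leaves half the derivative of the conserved form, up
    -- to its imaginary part; the contribution of `φ'` drops out since `V (X t)` is admissible.
    have e : ⟪V (X t), X'⟫_ℂ - ⟪X', M (V (X t))⟫_ℂ =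
        ⟪V (X t), V X'⟫_ℂ - ⟪M (V X'), M (V (X t))⟫_ℂ := by
      have h₁ := hadm φ' hφ'
      have h₂ := hs (V (X t)) φ'
      have h₃ := hs (V (X t)) (V X')
      rw [inner_sub_right, sub_eq_zero] at h₁
      have h₄ := congrArg (fun y => ⟪V (X t), y⟫_ℂ - ⟪y, M (V (X t))⟫_ℂ) hdec'
      simp only [inner_add_left, inner_add_right] at h₄
      linear_combination h₄ + h₁ + h₂ + h₃
    have hz' : (⟪V (X t), V X'⟫_ℂ - ⟪M (V X'), M (V (X t))⟫_ℂ).re = 0 := by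
      rw [← e]
      exact hz
    rw [Complex.sub_re, ← inner_conj_symm (M (V X')), Complex.conj_re] at hz'
    have hz'' : 2 * (⟪V (X t), V X'⟫_ℂ).re - 2 * (⟪M (V (X t)), M (V X')⟫_ℂ).re = 0 := by linarith
    rwa [hz''] at h
  exact is_const_of_deriv_eq_zero (fun t => (hd t).differentiableAt) (fun t => (hd t).deriv) t 0

theorem isStable_of_riccati {M : H →L⋆[ℂ] H} (hM : ‖M‖ < 1)
    (hs : IsSymmKernel M) (hMd : ∀ f, M f ∈ Q.B.domain)
    (hK : ∀ v : Q.B.domain, IsAdmissible M Q.ℒ v → ⟪(v : H), riccatiForm Q.B Q.A M hMd v⟫_ℂ = 0) :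
    Q.IsStable := by
  have := Q.finiteDimensional
  obtain ⟨V, hV⟩ := exists_decomposition hM hs Q.ℒ Q.isotropic
  -- The form is continuous and homogeneous of degree two, so conservation passes from the averages
  -- divided by `ε` to their limit `χ`.
  have hcons : ∀ χ : ℝ → H, Q.IsSolution χ → χ 0 ∈ skewOrthogonal Q.ℒ → ∀ t,
      ‖V (χ t)‖ ^ 2 - ‖M (V (χ t))‖ ^ 2 = ‖V (χ 0)‖ ^ 2 - ‖M (V (χ 0))‖ ^ 2 := by
    intro χ hχ h₀ t
    have hc := hχ.1
    have hinteg : ∀ a c : ℝ, IntervalIntegrable χ volume a c := fun a c => hc.intervalIntegrable a c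
    have hmem := hχ.mem_skewOrthogonal h₀
    have hav : ∀ ε t : ℝ, ∫ s in t..t + ε, χ s ∈ skewOrthogonal Q.ℒ := by
      refine fun ε t => ConstrainedFock.mem_skewOrthogonal.2 fun φ hφ => ?_
      have h := (Complex.imCLM ∘L ((innerSL ℂ φ).restrictScalars ℝ)).intervalIntegral_comp_comm
        (hinteg t (t + ε))
      refine h.symm.trans ?_
      have hz : ∀ s, (Complex.imCLM ∘L ((innerSL ℂ φ).restrictScalars ℝ)) (χ s) = 0 :=
        fun s => ConstrainedFock.mem_skewOrthogonal.1 (hmem s) φ hφ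
      simp only [hz, intervalIntegral.integral_zero]
    have hlim : ∀ t, Tendsto (fun ε : ℝ => ε⁻¹ • ∫ s in t..t + ε, χ s) (𝓝[≠] 0) (𝓝 (χ t)) := by
      intro t
      have h₁ : HasDerivAt (fun u => ∫ s in t..u, χ s) (χ t) t :=
        intervalIntegral.integral_hasDerivAt_right (hinteg _ _)
          (hc.stronglyMeasurableAtFilter _ _) hc.continuousAt
      simpa using h₁.tendsto_slope_zero
    have hF : Continuous fun x : H => ‖V x‖ ^ 2 - ‖M (V x)‖ ^ 2 := by fun_prop
    have hsc : ∀ (c : ℝ) (x : H),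
        ‖V (c • x)‖ ^ 2 - ‖M (V (c • x))‖ ^ 2 = c ^ 2 * (‖V x‖ ^ 2 - ‖M (V x)‖ ^ 2) := by
      intro c x
      rw [map_smul, ← toRealCLM_apply M (c • V x), map_smul, toRealCLM_apply, norm_smul, norm_smul,
        Real.norm_eq_abs, mul_pow, mul_pow, sq_abs]
      ring
    refine tendsto_nhds_unique ((hF.tendsto _).comp (hlim t))
      (((hF.tendsto _).comp (hlim 0)).congr fun ε => ?_)
    simp only [Function.comp_apply, hsc]
    rw [(hχ.isStrongSolution_average ε).norm_sq_sub_norm_sq_const hs hMd hK hV (hav ε) t]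
  intro r hr
  have hm : 0 < 1 - ‖M‖ := by linarith
  -- One factor `1 - ‖M‖` is lost when `v(0)` is bounded by the initial class, one in the comparison
  -- of `v(t)` with `v(0)`, and a factor `2` in `‖v + M v‖ ≤ 2‖v‖`.
  refine ⟨r * (1 - ‖M‖) ^ 2 / 2, by positivity, fun χ hχ h₀ hδ t => ?_⟩
  have ht := hχ.mem_skewOrthogonal h₀ t
  refine ⟨ht, ?_⟩
  obtain ⟨⟨y, hy⟩, hy₁, hy₂⟩ := Submodule.Quotient.norm_mk_lt (toReduced Q.ℒ (χ 0) h₀)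
    (sub_pos.2 hδ)
  rw [add_sub_cancel] at hy₂
  obtain ⟨hadm, φ, hφ, hdec⟩ := hV _ h₀
  -- The nearly minimal representative `y` has the same `v`-component; only `φ` changes, by `y - χ 0
  -- ∈ ℒ`.
  have hb₀ : (1 - ‖M‖) * ‖V (χ 0)‖ ≤ ‖y‖ := by
    have hmem : y - χ 0 ∈ Q.ℒ :=
      (Submodule.Quotient.eq (Q.ℒ.submoduleOf (skewOrthogonal Q.ℒ))).1 hy₁
    have h := one_sub_norm_mul_le hs (hadm _ (Q.ℒ.add_mem hφ hmem))
    rwa [← add_assoc, ← hdec, add_sub_cancel] at h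
  obtain ⟨hadm', φ', hφ', hdec'⟩ := hV _ ht
  -- Conservation gives `(1 - ‖M‖²)‖v(t)‖² ≤ ‖v(0)‖²`, and `(1 - ‖M‖)² ≤ 1 - ‖M‖²`.
  have hb₁ : (1 - ‖M‖) * ‖V (χ t)‖ ≤ ‖V (χ 0)‖ := by
    have h := hcons χ hχ h₀ t
    have h₂ := M.le_opNorm (V (χ t))
    have h₃ := norm_nonneg M
    have h₄ := norm_nonneg (V (χ t))
    have h₅ := norm_nonneg (M (V (χ t)))
    refine le_of_sq_le_sq ?_ (norm_nonneg _)
    have h₆ : ‖M (V (χ t))‖ ^ 2 ≤ (‖M‖ * ‖V (χ t)‖) ^ 2 := pow_le_pow_left₀ h₅ h₂ 2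
    have h₇ : 0 ≤ ‖M‖ * (1 - ‖M‖) * ‖V (χ t)‖ ^ 2 := by positivity
    nlinarith [sq_nonneg ‖M (V (χ 0))‖]
  have hb₂ : ‖toReduced Q.ℒ (χ t) ht‖ ≤ ‖V (χ t) + M (V (χ t))‖ := by
    have hle : V (χ t) + M (V (χ t)) ∈ skewOrthogonal Q.ℒ := by
      have : V (χ t) + M (V (χ t)) = χ t - φ' := by
        nth_rw 3 [hdec']
        abel
      rw [this]
      exact Submodule.sub_mem _ ht fun ψ hψ => Q.isotropic _ hφ' _ hψ
    have he : toReduced Q.ℒ (χ t) ht = Submodule.Quotient.mk ⟨_, hle⟩ := by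
      refine (Submodule.Quotient.eq _).2 ?_
      change χ t - (V (χ t) + M (V (χ t))) ∈ Q.ℒ
      nth_rw 1 [hdec']
      rwa [add_sub_cancel_left]
    rw [he]
    exact Submodule.Quotient.norm_mk_le _ _
  have hb₃ : ‖V (χ t) + M (V (χ t))‖ ≤ 2 * ‖V (χ t)‖ := by
    have h₂ := M.le_opNorm (V (χ t))
    have h₃ := norm_add_le (V (χ t)) (M (V (χ t)))
    nlinarith [norm_nonneg (V (χ t))]
  have hy₃ : ‖y‖ < r * (1 - ‖M‖) ^ 2 / 2 := hy₂
  refine (hb₂.trans hb₃).trans_lt ?_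
  by_contra! hge
  nlinarith [mul_le_mul_of_nonneg_left hb₁ hm.le, mul_le_mul_of_nonneg_left hge (sq_nonneg (1 - ‖M‖))]

end QuadraticSystem

end Classical

/-! ### Square-summable functions -/

section SqSum

variable {α β : Type*}

/-- Square-summable functions. -/
def SqSum (f : α → ℂ) : Prop := Summable fun a => ‖f a‖ ^ 2

/-- The square of the `ℓ²` norm. -/
def sqNorm (f : α → ℂ) : ℝ := ∑' a, ‖f a‖ ^ 2

theorem sqNorm_nonneg (f : α → ℂ) : 0 ≤ sqNorm f := tsum_nonneg fun _ => by positivity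

theorem SqSum.memℓp {f : α → ℂ} (hf : SqSum f) : Memℓp f 2 := by
  rw [memℓp_gen_iff (by norm_num)]
  simpa [SqSum] using hf

/-- A square-summable function as an element of `ℓ²`. -/
def SqSum.toLp {f : α → ℂ} (hf : SqSum f) : lp (fun _ : α => ℂ) 2 := ⟨f, hf.memℓp⟩

@[simp]
theorem SqSum.toLp_apply {f : α → ℂ} (hf : SqSum f) (a : α) : hf.toLp a = f a := rfl

theorem sqSum_lp (x : lp (fun _ : α => ℂ) 2) : SqSum (x : α → ℂ) := by
  have := (memℓp_gen_iff (p := 2) (by norm_num)).1 (lp.memℓp x)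
  simpa [SqSum] using this

theorem sqNorm_lp (x : lp (fun _ : α => ℂ) 2) : sqNorm (x : α → ℂ) = ‖x‖ ^ 2 := by
  have h := lp.norm_rpow_eq_tsum (p := 2) (by norm_num) x
  simp only [ENNReal.toReal_ofNat, Real.rpow_ofNat] at h
  exact h.symm

theorem SqSum.norm_toLp_sq {f : α → ℂ} (hf : SqSum f) : ‖hf.toLp‖ ^ 2 = sqNorm f :=
  (sqNorm_lp hf.toLp).symm

theorem SqSum.conj {f : α → ℂ} (hf : SqSum f) : SqSum fun a => starRingEnd ℂ (f a) := by
  simpa [SqSum] using hf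

theorem sqNorm_conj (f : α → ℂ) : sqNorm (fun a => starRingEnd ℂ (f a)) = sqNorm f := by
  simp [sqNorm]

theorem SqSum.summable_norm_mul {f g : α → ℂ} (hf : SqSum f) (hg : SqSum g) :
    Summable fun a => ‖f a * g a‖ := by
  refine Summable.of_nonneg_of_le (fun _ => norm_nonneg _) (fun a => ?_) (Summable.add hf hg)
  rw [norm_mul]
  nlinarith [sq_nonneg (‖f a‖ - ‖g a‖), sq_nonneg ‖f a‖, sq_nonneg ‖g a‖]

theorem SqSum.summable_mul {f g : α → ℂ} (hf : SqSum f) (hg : SqSum g) :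
    Summable fun a => f a * g a := (hf.summable_norm_mul hg).of_norm

theorem SqSum.norm_tsum_mul_sq_le {f g : α → ℂ} (hf : SqSum f) (hg : SqSum g) :
    ‖∑' a, f a * g a‖ ^ 2 ≤ sqNorm f * sqNorm g := by
  have e : ∑' a, f a * g a = ⟪hf.conj.toLp, hg.toLp⟫_ℂ := by
    rw [lp.inner_eq_tsum]
    refine tsum_congr fun a => ?_
    simp [mul_comm]
  rw [e, ← sqNorm_conj f, ← hf.conj.norm_toLp_sq, ← hg.norm_toLp_sq, ← mul_pow]
  exact pow_le_pow_left₀ (norm_nonneg _) (norm_inner_le_norm _ _) 2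

theorem SqSum.of_le {f : α → ℂ} {g : α → ℝ} (hg : Summable g) (h : ∀ a, ‖f a‖ ^ 2 ≤ g a) :
    SqSum f :=
  Summable.of_nonneg_of_le (fun _ => by positivity) h hg

theorem norm_add_sq_le_two (x y : ℂ) : ‖x + y‖ ^ 2 ≤ 2 * ‖x‖ ^ 2 + 2 * ‖y‖ ^ 2 := by
  have h := pow_le_pow_left₀ (norm_nonneg _) (norm_add_le x y) 2
  nlinarith [sq_nonneg (‖x‖ - ‖y‖)]

theorem SqSum.add {f g : α → ℂ} (hf : SqSum f) (hg : SqSum g) : SqSum (f + g) :=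
  SqSum.of_le ((Summable.mul_left 2 hf).add (Summable.mul_left 2 hg))
    fun _ => norm_add_sq_le_two _ _

theorem SqSum.smul {f : α → ℂ} (c : ℂ) (hf : SqSum f) : SqSum (c • f) :=
  SqSum.of_le (Summable.mul_left (‖c‖ ^ 2) hf) fun a => by simp [mul_pow]

theorem SqSum.neg {f : α → ℂ} (hf : SqSum f) : SqSum (-f) := by
  simpa [SqSum] using hf

theorem SqSum.sub {f g : α → ℂ} (hf : SqSum f) (hg : SqSum g) : SqSum (f - g) := by
  rw [sub_eq_add_neg]
  exact hf.add hg.neg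

theorem sqSum_zero : SqSum (0 : α → ℂ) := by
  simp [SqSum]

theorem sqNorm_zero : sqNorm (0 : α → ℂ) = 0 := by simp [sqNorm]

theorem sqNorm_add_le {f g : α → ℂ} (hf : SqSum f) (hg : SqSum g) :
    sqNorm (f + g) ≤ 2 * sqNorm f + 2 * sqNorm g := by
  rw [sqNorm, sqNorm, sqNorm, ← tsum_mul_left, ← tsum_mul_left,
    ← (Summable.mul_left 2 hf).tsum_add (Summable.mul_left 2 hg)]
  exact (hf.add hg).tsum_le_tsum (fun a => norm_add_sq_le_two _ _)
    ((Summable.mul_left 2 hf).add (Summable.mul_left 2 hg))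

theorem sqNorm_smul (c : ℂ) (f : α → ℂ) : sqNorm (c • f) = ‖c‖ ^ 2 * sqNorm f := by
  rw [sqNorm, sqNorm, ← tsum_mul_left]
  exact tsum_congr fun a => by simp [mul_pow]

theorem SqSum.comp_injective {f : α → ℂ} (hf : SqSum f) {e : β → α} (he : Function.Injective e) :
    SqSum fun x => f (e x) :=
  Summable.comp_injective hf he

theorem sqSum_equiv {f : α → ℂ} (e : β ≃ α) : (SqSum fun x => f (e x)) ↔ SqSum f :=
  e.summable_iff (f := fun a => ‖f a‖ ^ 2)

theorem sqNorm_equiv (f : α → ℂ) (e : β ≃ α) : sqNorm (fun x => f (e x)) = sqNorm f :=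
  e.tsum_eq fun a => ‖f a‖ ^ 2

theorem SqSum.tensor {f : α → ℂ} {g : β → ℂ} (hf : SqSum f) (hg : SqSum g) :
    SqSum fun x : α × β => f x.1 * g x.2 := by
  have h := Summable.mul_of_nonneg hf hg (fun _ => by positivity) (fun _ => by positivity)
  simpa [SqSum, mul_pow] using h

theorem SqSum.sqNorm_tensor {f : α → ℂ} {g : β → ℂ} (hf : SqSum f) (hg : SqSum g) :
    sqNorm (fun x : α × β => f x.1 * g x.2) = sqNorm f * sqNorm g := by
  have h := Summable.mul_of_nonneg hf hg (fun _ => by positivity) (fun _ => by positivity)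
  rw [sqNorm, sqNorm, sqNorm, Summable.tsum_mul_tsum hf hg h]
  simp [mul_pow]

theorem sqSum_prod_of_fiberwise {f : α × β → ℂ} (h₁ : ∀ a, SqSum fun y => f (a, y))
    (h₂ : Summable fun a => sqNorm fun y => f (a, y)) : SqSum f :=
  (summable_prod_of_nonneg fun _ => by positivity).2 ⟨h₁, h₂⟩

theorem SqSum.fiber' {f : α × β → ℂ} (hf : SqSum f) (y : β) : SqSum fun a => f (a, y) :=
  hf.comp_injective (Prod.mk_left_injective y)

theorem SqSum.hasSum_sqNorm_snd {f : α × β → ℂ} (hf : SqSum f) :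
    HasSum (fun y => sqNorm fun a => f (a, y)) (sqNorm f) := by
  have hf' : Summable fun x : β × α => ‖f (x.2, x.1)‖ ^ 2 := (Equiv.prodComm β α).summable_iff.2 hf
  have h := hf'.hasSum.prod_fiberwise fun y => (hf.fiber' y).hasSum
  have e : sqNorm f = ∑' x : β × α, ‖f (x.2, x.1)‖ ^ 2 :=
    ((Equiv.prodComm β α).tsum_eq fun x => ‖f x‖ ^ 2).symm
  rw [e]
  exact h

theorem norm_sum_sq_le_card {n : ℕ} (c : Fin n → ℂ) :
    ‖∑ j, c j‖ ^ 2 ≤ n * ∑ j, ‖c j‖ ^ 2 := by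
  refine (pow_le_pow_left₀ (norm_nonneg _) (norm_sum_le _ _) 2).trans ?_
  simpa using sq_sum_le_card_mul_sum_sq (s := Finset.univ) (f := fun j => ‖c j‖)

end SqSum

/-! ### Coordinates with respect to the orthonormal basis. -/

section Basis

variable {ι H : Type*} [NormedAddCommGroup H] [InnerProductSpace ℂ H] (b : HilbertBasis ι ℂ H)

theorem sqSum_coord (x : H) : SqSum fun p => ⟪b p, x⟫_ℂ := by
  simpa only [← HilbertBasis.repr_apply_apply] using sqSum_lp (b.repr x)

theorem sqNorm_coord (x : H) : sqNorm (fun p => ⟪b p, x⟫_ℂ) = ‖x‖ ^ 2 := by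
  have := sqNorm_lp (b.repr x)
  simpa [← HilbertBasis.repr_apply_apply] using this

theorem sqSum_coord_left (x : H) : SqSum fun p => ⟪x, b p⟫_ℂ := by
  simpa using (sqSum_coord b x).conj

theorem sqNorm_coord_left (x : H) : sqNorm (fun p => ⟪x, b p⟫_ℂ) = ‖x‖ ^ 2 := by
  rw [← sqNorm_coord b x, ← sqNorm_conj]
  simp

theorem inner_basis [DecidableEq ι] (p q : ι) : ⟪b p, b q⟫_ℂ = if p = q then 1 else 0 :=
  orthonormal_iff_ite.1 b.orthonormal p q

theorem tsum_inner_basis_mul (q : ι) (c : ι → ℂ) : ∑' p, ⟪b q, b p⟫_ℂ * c p = c q := by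
  classical
  simp [inner_basis b]

end Basis

/-! ### Creation and annihilation of families -/

section Families

variable {ι H : Type*} [NormedAddCommGroup H] [InnerProductSpace ℂ H] (b : HilbertBasis ι ℂ H)

/-- All `n`-particle components are square-summable. -/
def SectorSq (Ψ : Family ι) : Prop := ∀ n, SqSum (Ψ n)

/-- All `n`-particle components are symmetric. -/
def IsSymmFamily (Ψ : Family ι) : Prop :=
  ∀ (n : ℕ) (σ : Equiv.Perm (Fin n)) (i : Fin n → ι), Ψ n (i ∘ σ) = Ψ n i

theorem creation_zero (f : H) (Ψ : Family ι) (i : Fin 0 → ι) : creation b f Ψ 0 i = 0 := rfl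

theorem creation_succ (f : H) (Ψ : Family ι) (n : ℕ) (i : Fin (n + 1) → ι) :
    creation b f Ψ (n + 1) i = ((√(n + 1 : ℝ))⁻¹ : ℝ) *
      ∑ j : Fin (n + 1), ⟪b (i j), f⟫_ℂ * Ψ n (fun l => i (j.succAbove l)) := rfl

theorem annihilation_apply (f : H) (Ψ : Family ι) (n : ℕ) (i : Fin n → ι) :
    annihilation b f Ψ n i =
      (√(n + 1 : ℝ) : ℝ) * ∑' p : ι, ⟪f, b p⟫_ℂ * Ψ (n + 1) (Fin.cons p i) := rfl

theorem sqrt_succ_ne_zero (n : ℕ) : ((√(n + 1 : ℝ) : ℝ) : ℂ) ≠ 0 := by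
  have : (0 : ℝ) < √(n + 1 : ℝ) := Real.sqrt_pos.2 (by positivity)
  exact_mod_cast this.ne'

theorem creation_add (f : H) (Ψ Φ : Family ι) :
    creation b f (Ψ + Φ) = creation b f Ψ + creation b f Φ := by
  funext n i
  cases n with
  | zero => simp [creation]
  | succ n => simp [creation, mul_add, Finset.sum_add_distrib]

theorem creation_smul (f : H) (c : ℂ) (Ψ : Family ι) :
    creation b f (c • Ψ) = c • creation b f Ψ := by
  funext n i
  cases n with
  | zero => simp [creation]
  | succ n => simp [creation, Finset.mul_sum, mul_left_comm]

theorem creation_add_left (f g : H) (Ψ : Family ι) :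
    creation b (f + g) Ψ = creation b f Ψ + creation b g Ψ := by
  funext n i
  cases n with
  | zero => simp [creation]
  | succ n => simp [creation, add_mul, mul_add, Finset.sum_add_distrib]

theorem cons_sqSum {Ψ : Family ι} (hΨ : SectorSq Ψ) (n : ℕ) (i : Fin n → ι) :
    SqSum fun p => Ψ (n + 1) (Fin.cons p i) :=
  ((sqSum_equiv (Fin.consEquiv fun _ => ι)).2 (hΨ (n + 1))).fiber' i

theorem summable_annihilation (f : H) {Ψ : Family ι} (hΨ : SectorSq Ψ) (n : ℕ) (i : Fin n → ι) :
    Summable fun p : ι => ⟪f, b p⟫_ℂ * Ψ (n + 1) (Fin.cons p i) :=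
  (sqSum_coord_left b f).summable_mul (cons_sqSum hΨ n i)

theorem annihilation_add (f : H) {Ψ Φ : Family ι} (hΨ : SectorSq Ψ) (hΦ : SectorSq Φ) :
    annihilation b f (Ψ + Φ) = annihilation b f Ψ + annihilation b f Φ := by
  funext n i
  simp only [annihilation_apply, Pi.add_apply, mul_add]
  rw [(summable_annihilation b f hΨ n i).tsum_add (summable_annihilation b f hΦ n i), mul_add]

theorem annihilation_smul (f : H) (c : ℂ) (Ψ : Family ι) :
    annihilation b f (c • Ψ) = c • annihilation b f Ψ := by
  funext n i
  simp only [annihilation_apply, Pi.smul_apply, smul_eq_mul, mul_left_comm _ c, tsum_mul_left]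

theorem annihilation_add_left (f g : H) {Ψ : Family ι} (hΨ : SectorSq Ψ) :
    annihilation b (f + g) Ψ = annihilation b f Ψ + annihilation b g Ψ := by
  funext n i
  simp only [annihilation_apply, Pi.add_apply, inner_add_left, add_mul]
  rw [(summable_annihilation b f hΨ n i).tsum_add (summable_annihilation b g hΨ n i), mul_add]

/-- Each of the `n + 1` slots contributes a function of squared norm `‖f‖²‖Ψₙ‖²`. Cauchy–Schwarz
over the slots costs a factor `n + 1`, which the squared prefactor cancels. -/
theorem creation_sector (f : H) {Ψ : Family ι} {n : ℕ} (hΨ : SqSum (Ψ n)) :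
    SqSum (creation b f Ψ (n + 1)) ∧
      sqNorm (creation b f Ψ (n + 1)) ≤ (n + 1) * ‖f‖ ^ 2 * sqNorm (Ψ n) := by
  let G : Fin (n + 1) → (Fin (n + 1) → ι) → ℂ := fun j i =>
    ⟪b (i j), f⟫_ℂ * Ψ n (fun l => i (j.succAbove l))
  have ht := (sqSum_coord b f).tensor hΨ
  have hGe : ∀ j, (fun x => G j (Fin.insertNthEquiv (fun _ => ι) j x)) =
      fun x : ι × (Fin n → ι) => ⟪b x.1, f⟫_ℂ * Ψ n x.2 := by
    intro j
    funext x
    simp [G]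
  have hG : ∀ j, SqSum (G j) := by
    intro j
    rw [← sqSum_equiv (Fin.insertNthEquiv (fun _ => ι) j), hGe]
    exact ht
  have hGn : ∀ j, sqNorm (G j) = ‖f‖ ^ 2 * sqNorm (Ψ n) := by
    intro j
    rw [← sqNorm_equiv _ (Fin.insertNthEquiv (fun _ => ι) j), hGe,
      (sqSum_coord b f).sqNorm_tensor hΨ, sqNorm_coord]
  have hle : ∀ i, ‖creation b f Ψ (n + 1) i‖ ^ 2 ≤ ∑ j, ‖G j i‖ ^ 2 := by
    intro i
    have hp : (0 : ℝ) < n + 1 := by positivity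
    rw [creation_succ, norm_mul, mul_pow, Complex.norm_real, Real.norm_eq_abs, sq_abs, inv_pow,
      Real.sq_sqrt hp.le, inv_mul_le_iff₀ hp]
    have h := norm_sum_sq_le_card fun j => G j i
    push_cast at h
    exact h
  have hsum : Summable fun i => ∑ j, ‖G j i‖ ^ 2 := summable_sum fun j _ => hG j
  have hsq : SqSum (creation b f Ψ (n + 1)) := SqSum.of_le hsum hle
  refine ⟨hsq, (Summable.tsum_le_tsum hle hsq hsum).trans ?_⟩
  rw [Summable.tsum_finsetSum fun j _ => hG j]
  refine le_of_eq ((Finset.sum_congr rfl fun j _ => hGn j).trans ?_)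
  simp [mul_assoc]

/-- Cauchy–Schwarz in the contracted index, followed by summation over the remaining ones. -/
theorem annihilation_sector (f : H) {Ψ : Family ι} {n : ℕ} (hΨ : SqSum (Ψ (n + 1))) :
    SqSum (annihilation b f Ψ n) ∧
      sqNorm (annihilation b f Ψ n) ≤ (n + 1) * ‖f‖ ^ 2 * sqNorm (Ψ (n + 1)) := by
  have he := (sqSum_equiv (Fin.consEquiv fun _ => ι)).2 hΨ
  have hs := he.hasSum_sqNorm_snd
  rw [sqNorm_equiv] at hs
  have hle : ∀ i, ‖annihilation b f Ψ n i‖ ^ 2 ≤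
      (n + 1) * ‖f‖ ^ 2 * sqNorm fun p => Ψ (n + 1) (Fin.cons p i) := by
    intro i
    have hp : (0 : ℝ) < n + 1 := by positivity
    rw [annihilation_apply, norm_mul, mul_pow, Complex.norm_real, Real.norm_eq_abs, sq_abs,
      Real.sq_sqrt hp.le, mul_assoc]
    refine mul_le_mul_of_nonneg_left ?_ hp.le
    rw [← sqNorm_coord_left b f]
    exact (sqSum_coord_left b f).norm_tsum_mul_sq_le (he.fiber' i)
  have hsum := hs.mul_left ((n + 1) * ‖f‖ ^ 2)
  have hsq : SqSum (annihilation b f Ψ n) := SqSum.of_le hsum.summable hle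
  refine ⟨hsq, (Summable.tsum_le_tsum hle hsq hsum.summable).trans ?_⟩
  exact hsum.tsum_eq.le

theorem SectorSq.creation (f : H) {Ψ : Family ι} (hΨ : SectorSq Ψ) :
    SectorSq (creation b f Ψ)
  | 0 => sqSum_zero
  | n + 1 => (creation_sector b f (hΨ n)).1

theorem SectorSq.annihilation (f : H) {Ψ : Family ι} (hΨ : SectorSq Ψ) :
    SectorSq (annihilation b f Ψ) := fun n => (annihilation_sector b f (hΨ (n + 1))).1

theorem cons_comp_succ_succAbove {n : ℕ} (p : ι) (i : Fin (n + 1) → ι) (j : Fin (n + 1)) :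
    (fun l => (Fin.cons p i : Fin (n + 2) → ι) (j.succ.succAbove l)) =
      Fin.cons p fun l => i (j.succAbove l) := by
  funext l
  refine Fin.cases ?_ (fun l => ?_) l
  · simp
  · simp

/-- The canonical commutation relation. -/
theorem annihilation_creation (x f : H) {Ψ : Family ι} (hΨ : SectorSq Ψ) :
    annihilation b x (creation b f Ψ) = creation b f (annihilation b x Ψ) + ⟪x, f⟫_ℂ • Ψ := by
  funext n i
  -- Slot `0`, which holds the index `p` to be contracted, produces the scalar `(x, f)`; the other
  -- slots keep `p` inside `Ψ` and rebuild `a⁺[f] a⁻[x]`.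
  have h₀ : ∀ p, creation b f Ψ (n + 1) (Fin.cons p i) = ((√(n + 1 : ℝ))⁻¹ : ℝ) *
      (⟪b p, f⟫_ℂ * Ψ n i +
        ∑ j : Fin n, ⟪b (i j), f⟫_ℂ * Ψ n (fun l => (Fin.cons p i : Fin (n + 1) → ι)
          (j.succ.succAbove l))) := by
    intro p
    rw [creation_succ, Fin.sum_univ_succ]
    simp
  have hs := b.hasSum_inner_mul_inner x f
  simp only [Pi.add_apply, Pi.smul_apply, smul_eq_mul]
  rw [annihilation_apply]
  simp only [h₀]
  cases n with
  | zero =>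
    simp only [Finset.univ_eq_empty, Finset.sum_empty, add_zero, creation_zero, zero_add]
    have : ∀ p, ⟪x, b p⟫_ℂ * (((√((0 : ℕ) + 1 : ℝ))⁻¹ : ℝ) * (⟪b p, f⟫_ℂ * Ψ 0 i)) =
        (⟪x, b p⟫_ℂ * ⟪b p, f⟫_ℂ) * Ψ 0 i := by
      intro p
      simp
      ring
    simp only [this, tsum_mul_right, hs.tsum_eq]
    simp
  | succ n =>
    simp only [cons_comp_succ_succAbove]
    have hne := sqrt_succ_ne_zero (n + 1)
    have hne' := sqrt_succ_ne_zero n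
    have : ∀ p, ⟪x, b p⟫_ℂ * (((√((n + 1 : ℕ) + 1 : ℝ))⁻¹ : ℝ) * (⟪b p, f⟫_ℂ * Ψ (n + 1) i +
        ∑ j, ⟪b (i j), f⟫_ℂ * Ψ (n + 1) (Fin.cons p fun l => i (j.succAbove l)))) =
        ((√((n + 1 : ℕ) + 1 : ℝ))⁻¹ : ℝ) * ((⟪x, b p⟫_ℂ * ⟪b p, f⟫_ℂ) * Ψ (n + 1) i +
        ∑ j, ⟪b (i j), f⟫_ℂ *
          (⟪x, b p⟫_ℂ * Ψ (n + 1) (Fin.cons p fun l => i (j.succAbove l)))) := by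
      intro p
      rw [mul_left_comm, mul_add, Finset.mul_sum, mul_assoc]
      simp only [mul_left_comm]
    simp only [this, tsum_mul_left]
    have hsj : ∀ j ∈ Finset.univ, Summable fun p => ⟪b (i j), f⟫_ℂ *
        (⟪x, b p⟫_ℂ * Ψ (n + 1) (Fin.cons p fun l => i (j.succAbove l))) := fun j _ =>
      (summable_annihilation b x hΨ n fun l => i (j.succAbove l)).mul_left _
    rw [(hs.summable.mul_right _).tsum_add (summable_sum hsj), tsum_mul_right, hs.tsum_eq,
      Summable.tsum_finsetSum hsj, creation_succ]
    simp only [tsum_mul_left, annihilation_apply, mul_left_comm _ ((√(n + 1 : ℝ) : ℝ) : ℂ),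
      ← Finset.mul_sum]
    push_cast at hne hne' ⊢
    field_simp
    ring

/-- Both sides are sums over ordered pairs of distinct slots; the bijection exchanges the order in
which the two slots are removed. -/
theorem creation_comm (f g : H) (Ψ : Family ι) :
    creation b f (creation b g Ψ) = creation b g (creation b f Ψ) := by
  funext n i
  match n with
  | 0 => rfl
  | 1 => simp [creation]
  | n + 2 =>
    simp only [creation_succ, Finset.mul_sum]
    rw [← Finset.sum_product', ← Finset.sum_product']
    refine Finset.sum_bij' (fun x _ => (x.1.succAbove x.2, x.2.predAbove x.1))
      (fun x _ => (x.1.succAbove x.2, x.2.predAbove x.1)) (by simp) (by simp) ?_ ?_ ?_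
    · rintro ⟨j, k⟩ -
      simp [Fin.succAbove_succAbove_predAbove, Fin.predAbove_predAbove_succAbove]
    · rintro ⟨j, k⟩ -
      simp [Fin.succAbove_succAbove_predAbove, Fin.predAbove_predAbove_succAbove]
    · rintro ⟨j, k⟩ -
      simp only [Fin.succAbove_succAbove_predAbove, Fin.succAbove_succAbove_succAbove_predAbove]
      ring

end Families

theorem tsum_prod_snd {α β : Type*} {F : α × β → ℂ} (hF : Summable F) :
    ∑' x, F x = ∑' y, ∑' x, F (x, y) := by
  rw [← (Equiv.prodComm β α).tsum_eq]
  exact Summable.tsum_prod ((Equiv.prodComm β α).summable_iff.2 hF)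

/-! ### Permutation symmetry and adjointness. -/

section Families

variable {ι H : Type*} [NormedAddCommGroup H] [InnerProductSpace ℂ H] (b : HilbertBasis ι ℂ H)

/-- The permutation of the remaining indices when `j` is removed from the source of `σ` and `σ j`
from its target. -/
def removePerm {n : ℕ} (σ : Equiv.Perm (Fin (n + 1))) (j : Fin (n + 1)) : Equiv.Perm (Fin n) :=
  (finSuccAboveEquiv j).trans ((σ.subtypeEquiv fun a => by simp).trans
    (finSuccAboveEquiv (σ j)).symm)

theorem succAbove_removePerm {n : ℕ} (σ : Equiv.Perm (Fin (n + 1))) (j : Fin (n + 1)) (l : Fin n) :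
    (σ j).succAbove (removePerm σ j l) = σ (j.succAbove l) := by
  have h := congrArg Subtype.val ((finSuccAboveEquiv (σ j)).apply_symm_apply
    ((σ.subtypeEquiv (p := fun x => x ≠ j) (q := fun x => x ≠ σ j) fun a => by simp)
      (finSuccAboveEquiv j l)))
  exact h

theorem IsSymmFamily.creation (f : H) {Ψ : Family ι} (hΨ : IsSymmFamily Ψ) :
    IsSymmFamily (creation b f Ψ) := by
  intro n σ i
  cases n with
  | zero => rfl
  | succ n =>
    rw [creation_succ, creation_succ]
    congr 1
    refine Fintype.sum_equiv σ _ _ fun j => ?_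
    have h := hΨ n (removePerm σ j) fun l => i ((σ j).succAbove l)
    rw [← h]
    simp only [Function.comp_def, succAbove_removePerm]

theorem cons_comp_perm {n : ℕ} (σ : Equiv.Perm (Fin n)) (p : ι) (i : Fin n → ι) :
    (Fin.cons p (i ∘ σ) : Fin (n + 1) → ι) =
      (Fin.cons p i : Fin (n + 1) → ι) ∘ (Equiv.Perm.decomposeFin.symm (0, σ)) := by
  funext l
  refine Fin.cases ?_ (fun l => ?_) l <;> simp

theorem IsSymmFamily.annihilation (f : H) {Ψ : Family ι} (hΨ : IsSymmFamily Ψ) :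
    IsSymmFamily (annihilation b f Ψ) := by
  intro n σ i
  rw [annihilation_apply, annihilation_apply]
  simp only [cons_comp_perm, hΨ (n + 1)]

theorem IsSymmFamily.insertNth {Ψ : Family ι} (hΨ : IsSymmFamily Ψ) {n : ℕ} (j : Fin (n + 1))
    (p : ι) (i : Fin n → ι) :
    Ψ (n + 1) (j.insertNth p i) = Ψ (n + 1) (Fin.cons p i) := by
  have e : (j.insertNth p i : Fin (n + 1) → ι) = (Fin.cons p i : Fin (n + 1) → ι) ∘
      ((finSuccEquiv' j).trans (finSuccEquiv' 0).symm) := by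
    funext l
    refine Fin.succAboveCases j ?_ (fun l => ?_) l
    · simp
    · simp
  rw [e, hΨ]

theorem IsSymmFamily.cons_cons {Ψ : Family ι} (hΨ : IsSymmFamily Ψ) {n : ℕ}
    (p q : ι) (i : Fin n → ι) :
    Ψ (n + 2) (Fin.cons p (Fin.cons q i)) = Ψ (n + 2) (Fin.cons q (Fin.cons p i)) := by
  have e : (Fin.cons p (Fin.cons q i) : Fin (n + 2) → ι) =
      (Fin.cons q (Fin.cons p i) : Fin (n + 2) → ι) ∘ (Equiv.swap 0 1) := by
    funext l
    refine Fin.cases ?_ (fun l => ?_) l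
    · simp
    · refine Fin.cases ?_ (fun l => ?_) l
      · simp
      · rw [Function.comp_apply, Equiv.swap_apply_of_ne_of_ne]
        · simp
        · exact Fin.succ_ne_zero _
        · rw [← Fin.succ_zero_eq_one]
          exact (Fin.succ_injective _).ne (Fin.succ_ne_zero _)
  rw [e, hΨ]

theorem cons_cons_sqSum {Ψ : Family ι} (hΨ : SectorSq Ψ) (n : ℕ) (i : Fin n → ι) :
    SqSum fun x : ι × ι => Ψ (n + 2) (Fin.cons x.1 (Fin.cons x.2 i)) := by
  refine (hΨ (n + 2)).comp_injective (e := fun x : ι × ι =>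
    (Fin.cons x.1 (Fin.cons x.2 i) : Fin (n + 2) → ι)) ?_
  rintro ⟨p, q⟩ ⟨p', q'⟩ h
  have h := (Fin.cons_injective2 h)
  have h' := (Fin.cons_injective2 h.2)
  exact Prod.ext h.1 h'.1

theorem annihilation_annihilation (f g : H) {Ψ : Family ι} (hΨ : SectorSq Ψ) (n : ℕ)
    (i : Fin n → ι) : annihilation b f (annihilation b g Ψ) n i =
      (√(n + 1 : ℝ) * √(n + 1 + 1 : ℝ) : ℝ) * ∑' x : ι × ι, (⟪g, b x.1⟫_ℂ * ⟪f, b x.2⟫_ℂ) *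
        Ψ (n + 2) (Fin.cons x.1 (Fin.cons x.2 i)) := by
  have hs := ((sqSum_coord_left b g).tensor (sqSum_coord_left b f)).summable_mul
    (cons_cons_sqSum hΨ n i)
  rw [tsum_prod_snd hs]
  have e : ∀ p, ⟪f, b p⟫_ℂ * annihilation b g Ψ (n + 1) (Fin.cons p i) =
      (√(n + 1 + 1 : ℝ) : ℝ) * ∑' q, (⟪g, b q⟫_ℂ * ⟪f, b p⟫_ℂ) *
        Ψ (n + 2) (Fin.cons q (Fin.cons p i)) := by
    intro p
    rw [annihilation_apply, mul_left_comm, ← tsum_mul_left]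
    push_cast
    congr 1
    exact tsum_congr fun q => by ring
  rw [annihilation_apply b f]
  simp only [e, tsum_mul_left]
  push_cast
  rw [mul_assoc]

theorem annihilation_comm (f g : H) {Ψ : Family ι} (hΨ : SectorSq Ψ) (hs : IsSymmFamily Ψ) :
    annihilation b f (annihilation b g Ψ) = annihilation b g (annihilation b f Ψ) := by
  funext n i
  rw [annihilation_annihilation b f g hΨ, annihilation_annihilation b g f hΨ,
    ← (Equiv.prodComm ι ι).tsum_eq]
  congr 1
  refine tsum_congr fun x => ?_
  simp only [Equiv.prodComm_apply, Prod.fst_swap, Prod.snd_swap]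
  rw [hs.cons_cons, mul_comm ⟪g, b x.2⟫_ℂ]

/-- `a⁺[f]` and `a⁻[f]` are adjoint on each sector. -/
theorem tsum_conj_mul_creation (f : H) {Φ Ψ : Family ι} (hΦ : IsSymmFamily Φ) {n : ℕ}
    (hΦn : SqSum (Φ (n + 1))) (hΨn : SqSum (Ψ n)) :
    ∑' i, starRingEnd ℂ (Φ (n + 1) i) * creation b f Ψ (n + 1) i =
      ∑' i, starRingEnd ℂ (annihilation b f Φ n i) * Ψ n i := by
  have ht := (sqSum_coord b f).tensor hΨn
  have hc := ((sqSum_equiv (Fin.consEquiv fun _ => ι)).2 hΦn).conj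
  set F : ι × (Fin n → ι) → ℂ := fun x =>
    starRingEnd ℂ (Φ (n + 1) (Fin.cons x.1 x.2)) * (⟪b x.1, f⟫_ℂ * Ψ n x.2) with hF
  have hFs : Summable F := hc.summable_mul ht
  -- By symmetry of `Φ` every slot gives the same sum, so the total is `n + 1` copies of it; `(n +
  -- 1) / √(n + 1)` is the prefactor of the annihilation operator.
  have hG : ∀ (j : Fin (n + 1)) (x : ι × (Fin n → ι)),
      starRingEnd ℂ (Φ (n + 1) (Fin.insertNthEquiv (fun _ => ι) j x)) *
        (⟪b (Fin.insertNthEquiv (fun _ => ι) j x j), f⟫_ℂ *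
          Ψ n (fun l => Fin.insertNthEquiv (fun _ => ι) j x (j.succAbove l))) = F x := by
    intro j x
    have h : Φ (n + 1) (Fin.insertNthEquiv (fun _ => ι) j x) = Φ (n + 1) (Fin.cons x.1 x.2) :=
      hΦ.insertNth j x.1 x.2
    rw [h]
    simp [hF]
  have hGs : ∀ j : Fin (n + 1), Summable fun i : Fin (n + 1) → ι => starRingEnd ℂ (Φ (n + 1) i) *
      (⟪b (i j), f⟫_ℂ * Ψ n (fun l => i (j.succAbove l))) := by
    intro j
    rw [← (Fin.insertNthEquiv (fun _ => ι) j).summable_iff]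
    simpa only [Function.comp_def, hG] using hFs
  have hGt : ∀ j : Fin (n + 1), ∑' i : Fin (n + 1) → ι, starRingEnd ℂ (Φ (n + 1) i) *
      (⟪b (i j), f⟫_ℂ * Ψ n (fun l => i (j.succAbove l))) = ∑' x, F x := by
    intro j
    rw [← (Fin.insertNthEquiv (fun _ => ι) j).tsum_eq]
    simp only [hG]
  have e₁ : ∀ i, starRingEnd ℂ (Φ (n + 1) i) * creation b f Ψ (n + 1) i =
      ((√(n + 1 : ℝ))⁻¹ : ℝ) * ∑ j : Fin (n + 1), starRingEnd ℂ (Φ (n + 1) i) *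
      (⟪b (i j), f⟫_ℂ * Ψ n (fun l => i (j.succAbove l))) := by
    intro i
    rw [creation_succ, mul_left_comm, Finset.mul_sum]
  have e₂ : ∀ i, starRingEnd ℂ (annihilation b f Φ n i) * Ψ n i =
      (√(n + 1 : ℝ) : ℝ) * ∑' p, F (p, i) := by
    intro i
    rw [annihilation_apply, map_mul, Complex.conj_ofReal, Complex.conj_tsum, mul_assoc,
      ← tsum_mul_right]
    congr 1
    refine tsum_congr fun p => ?_
    simp only [hF, map_mul, inner_conj_symm]
    ring
  simp only [e₁, e₂, tsum_mul_left]
  rw [Summable.tsum_finsetSum fun j _ => hGs j]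
  simp only [hGt, Finset.sum_const, Finset.card_univ, Fintype.card_fin, nsmul_eq_mul]
  rw [tsum_prod_snd hFs, ← mul_assoc]
  congr 1
  have hp : (0 : ℝ) ≤ n + 1 := by positivity
  have hne := sqrt_succ_ne_zero n
  have h2 : ((√(n + 1 : ℝ) : ℝ) : ℂ) * ((√(n + 1 : ℝ) : ℝ) : ℂ) = (n + 1 : ℂ) := by
    rw [← Complex.ofReal_mul, Real.mul_self_sqrt hp]
    push_cast
    rfl
  push_cast
  rw [← h2]
  field_simp

end Families

/-! ### The space `S` and its operators -/

section Schwartz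

variable {ι H : Type*} [NormedAddCommGroup H] [InnerProductSpace ℂ H] (b : HilbertBasis ι ℂ H)

theorem sectorNorm_sq (Ψ : Family ι) (n : ℕ) : sectorNorm Ψ n ^ 2 = sqNorm (Ψ n) :=
  Real.sq_sqrt (sqNorm_nonneg _)

theorem sectorNorm_nonneg (Ψ : Family ι) (n : ℕ) : 0 ≤ sectorNorm Ψ n := Real.sqrt_nonneg _

theorem IsFock.sectorSq {Ψ : Family ι} (h : IsFock Ψ) : SectorSq Ψ := by
  intro n
  have h₁ := h.summable.comp_injective (sigma_mk_injective (β := fun n => Fin n → ι) (i := n))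
  exact h₁

theorem summable_inv_succ_sq : Summable fun n : ℕ => ((n : ℝ) + 1)⁻¹ ^ 2 := by
  have h := (summable_nat_add_iff 1).2 (Real.summable_nat_pow_inv.2 (one_lt_two))
  refine h.congr fun n => ?_
  push_cast
  rw [inv_pow]

/-- A form of the decay condition adapted to the operators: the weight `n + 1` does not vanish on
the vacuum sector, squared norms are what the sector bounds estimate, and summability over the
sectors becomes a consequence of the case `m = 2`. -/
theorem isSchwartz_iff {Ψ : Family ι} : IsSchwartz Ψ ↔ IsSymmFamily Ψ ∧ SectorSq Ψ ∧
    ∀ m : ℕ, ∃ C : ℝ, ∀ n : ℕ, ((n : ℝ) + 1) ^ m * sqNorm (Ψ n) ≤ C := by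
  constructor
  · intro h
    refine ⟨h.symm, h.toIsFock.sectorSq, fun m => ?_⟩
    obtain ⟨C, hC⟩ := h.decay m
    obtain ⟨D, hD⟩ := h.decay 0
    simp only [pow_zero, one_mul] at hD
    have hD0 : 0 ≤ D := (sectorNorm_nonneg Ψ 0).trans (hD 0)
    refine ⟨2 ^ m * |C| * D + D ^ 2, fun n => ?_⟩
    rw [← sectorNorm_sq]
    have hs := sectorNorm_nonneg Ψ n
    rcases Nat.eq_zero_or_pos n with rfl | hn
    · have := pow_le_pow_left₀ hs (hD 0) 2
      have h2 : 0 ≤ 2 ^ m * |C| * D := by positivity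
      simp only [Nat.cast_zero, zero_add, one_pow, one_mul]
      linarith
    · have h1 : (1 : ℝ) ≤ n := by exact_mod_cast hn
      have h2 : ((n : ℝ) + 1) ^ m ≤ 2 ^ m * (n : ℝ) ^ m := by
        rw [← mul_pow]
        exact pow_le_pow_left₀ (by positivity) (by linarith) m
      calc ((n : ℝ) + 1) ^ m * sectorNorm Ψ n ^ 2
          ≤ 2 ^ m * (n : ℝ) ^ m * sectorNorm Ψ n ^ 2 := by gcongr
        _ = 2 ^ m * ((n : ℝ) ^ m * sectorNorm Ψ n) * sectorNorm Ψ n := by ring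
        _ ≤ 2 ^ m * |C| * D := by
          gcongr
          · exact (hC n).trans (le_abs_self C)
          · exact hD n
        _ ≤ _ := by nlinarith [sq_nonneg D]
  · rintro ⟨hs, hsq, hd⟩
    have hsum : Summable fun x : (n : ℕ) × (Fin n → ι) => ‖Ψ x.1 x.2‖ ^ 2 := by
      rw [summable_sigma_of_nonneg fun _ => by positivity]
      refine ⟨hsq, ?_⟩
      obtain ⟨C, hC⟩ := hd 2
      refine Summable.of_nonneg_of_le (fun n => sqNorm_nonneg (Ψ n)) (fun n => ?_)
        (summable_inv_succ_sq.mul_left C)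
      have hp : (0 : ℝ) < ((n : ℝ) + 1) ^ 2 := by positivity
      change sqNorm (Ψ n) ≤ _
      rw [inv_pow, ← div_eq_mul_inv, le_div_iff₀ hp, mul_comm]
      exact hC n
    refine ⟨⟨hs, hsum⟩, fun m => ?_⟩
    obtain ⟨C, hC⟩ := hd (2 * m)
    refine ⟨C + 1, fun n => ?_⟩
    have h₁ : ((n : ℝ) ^ m * sectorNorm Ψ n) ^ 2 ≤ C := by
      refine le_trans ?_ (hC n)
      rw [mul_pow, sectorNorm_sq, ← pow_mul, mul_comm m 2]
      have := sqNorm_nonneg (Ψ n)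
      gcongr
      linarith
    nlinarith [sq_nonneg ((n : ℝ) ^ m * sectorNorm Ψ n - 1)]

variable (ι) in
/-- The space `S` as a subspace of the space of families. -/
def schwartzSubmodule : Submodule ℂ (Family ι) where
  carrier := {Ψ | IsSchwartz Ψ}
  zero_mem' := isSchwartz_iff.2 ⟨fun _ _ _ => rfl, fun _ => sqSum_zero, fun m => ⟨0, fun n => by
    simp [sqNorm_zero]⟩⟩
  add_mem' := by
    intro Ψ Φ hΨ hΦ
    obtain ⟨s₁, q₁, d₁⟩ := isSchwartz_iff.1 hΨ
    obtain ⟨s₂, q₂, d₂⟩ := isSchwartz_iff.1 hΦ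
    refine isSchwartz_iff.2 ⟨fun n σ i => ?_, fun n => (q₁ n).add (q₂ n), fun m => ?_⟩
    · simp only [Pi.add_apply, s₁ n σ i, s₂ n σ i]
    · obtain ⟨C, hC⟩ := d₁ m
      obtain ⟨D, hD⟩ := d₂ m
      refine ⟨2 * C + 2 * D, fun n => ?_⟩
      have h := mul_le_mul_of_nonneg_left (sqNorm_add_le (q₁ n) (q₂ n))
        (by positivity : 0 ≤ ((n : ℝ) + 1) ^ m)
      have := hC n
      have := hD n
      exact h.trans (by linarith)
  smul_mem' := by
    intro c Ψ hΨ
    obtain ⟨s₁, q₁, d₁⟩ := isSchwartz_iff.1 hΨ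
    refine isSchwartz_iff.2 ⟨fun n σ i => ?_, fun n => (q₁ n).smul c, fun m => ?_⟩
    · simp only [Pi.smul_apply, s₁ n σ i]
    · obtain ⟨C, hC⟩ := d₁ m
      refine ⟨‖c‖ ^ 2 * C, fun n => ?_⟩
      have h := mul_le_mul_of_nonneg_left (hC n) (sq_nonneg ‖c‖)
      have e : sqNorm ((c • Ψ) n) = ‖c‖ ^ 2 * sqNorm (Ψ n) := sqNorm_smul c (Ψ n)
      rw [e]
      linarith

variable (ι) in
/-- The space `S` as a complex vector space. -/
def schwartz : Type _ := schwartzSubmodule ι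

instance : AddCommGroup (schwartz ι) := inferInstanceAs (AddCommGroup (schwartzSubmodule ι))

instance : Module ℂ (schwartz ι) := inferInstanceAs (Module ℂ (schwartzSubmodule ι))

/-- The underlying family. -/
def schwartz.toFamily (x : schwartz ι) : Family ι := (show schwartzSubmodule ι from x).1

instance : CoeOut (schwartz ι) (Family ι) := ⟨schwartz.toFamily⟩

/-- Families in `S` as elements of `S`. -/
def schwartz.mk (Ψ : Family ι) (h : IsSchwartz Ψ) : schwartz ι :=
  show schwartzSubmodule ι from ⟨Ψ, h⟩

@[simp]
theorem schwartz.coe_mk (Ψ : Family ι) (h : IsSchwartz Ψ) :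
    (schwartz.mk Ψ h : Family ι) = Ψ := rfl

theorem schwartz.isSchwartz (x : schwartz ι) : IsSchwartz (x : Family ι) :=
  (show schwartzSubmodule ι from x).2

theorem schwartz.ext {x y : schwartz ι} (h : (x : Family ι) = y) : x = y := Subtype.ext h

theorem coe_add_schwartz (x y : schwartz ι) : ((x + y : schwartz ι) : Family ι) = x + y := rfl

theorem coe_smul_schwartz (c : ℂ) (x : schwartz ι) :
    ((c • x : schwartz ι) : Family ι) = c • (x : Family ι) := rfl

theorem schwartz_sectorSq (x : schwartz ι) : SectorSq (x : Family ι) :=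
  (isSchwartz_iff.1 x.isSchwartz).2.1

theorem schwartz_symm (x : schwartz ι) : IsSymmFamily (x : Family ι) :=
  (isSchwartz_iff.1 x.isSchwartz).1

theorem creation_mem_schwartz (f : H) {Ψ : Family ι} (hΨ : IsSchwartz Ψ) :
    IsSchwartz (creation b f Ψ) := by
  obtain ⟨s₁, q₁, d₁⟩ := isSchwartz_iff.1 hΨ
  refine isSchwartz_iff.2 ⟨s₁.creation b f, q₁.creation b f, fun m => ?_⟩
  obtain ⟨C, hC⟩ := d₁ (m + 1)
  have hC0 : 0 ≤ C := le_trans (mul_nonneg (by positivity) (sqNorm_nonneg _)) (hC 0)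
  refine ⟨2 ^ m * ‖f‖ ^ 2 * C, fun n => ?_⟩
  cases n with
  | zero =>
    have : sqNorm (creation b f Ψ 0) = 0 := by simp [sqNorm, creation_zero]
    rw [this, mul_zero]
    positivity
  | succ n =>
    have h := (creation_sector b f (q₁ n)).2
    have h2 : (((n + 1 : ℕ) : ℝ) + 1) ^ m ≤ 2 ^ m * ((n : ℝ) + 1) ^ m := by
      rw [← mul_pow]
      push_cast
      exact pow_le_pow_left₀ (by positivity) (by linarith [n.cast_nonneg (α := ℝ)]) m
    have h3 := sqNorm_nonneg (Ψ n)
    have h4 := sqNorm_nonneg (creation b f Ψ (n + 1))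
    calc _ ≤ 2 ^ m * ((n : ℝ) + 1) ^ m * ((n + 1) * ‖f‖ ^ 2 * sqNorm (Ψ n)) := by gcongr
      _ = 2 ^ m * ‖f‖ ^ 2 * (((n : ℝ) + 1) ^ (m + 1) * sqNorm (Ψ n)) := by ring
      _ ≤ _ := by gcongr; exact hC n

theorem annihilation_mem_schwartz (f : H) {Ψ : Family ι} (hΨ : IsSchwartz Ψ) :
    IsSchwartz (annihilation b f Ψ) := by
  obtain ⟨s₁, q₁, d₁⟩ := isSchwartz_iff.1 hΨ
  refine isSchwartz_iff.2 ⟨s₁.annihilation b f, q₁.annihilation b f, fun m => ?_⟩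
  obtain ⟨C, hC⟩ := d₁ (m + 1)
  refine ⟨‖f‖ ^ 2 * C, fun n => ?_⟩
  have h := (annihilation_sector b f (q₁ (n + 1))).2
  have h3 := sqNorm_nonneg (Ψ (n + 1))
  calc _ ≤ ((n : ℝ) + 1) ^ m * ((n + 1) * ‖f‖ ^ 2 * sqNorm (Ψ (n + 1))) := by gcongr
    _ = ‖f‖ ^ 2 * (((n : ℝ) + 1) ^ (m + 1) * sqNorm (Ψ (n + 1))) := by ring
    _ ≤ ‖f‖ ^ 2 * ((((n + 1 : ℕ) : ℝ) + 1) ^ (m + 1) * sqNorm (Ψ (n + 1))) := by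
      gcongr
      linarith
    _ ≤ _ := by gcongr; exact hC (n + 1)

theorem truncate_apply (N : ℕ) (Ψ : Family ι) (n : ℕ) :
    truncate N Ψ n = if n ≤ N then Ψ n else 0 := by
  funext i
  simp only [truncate]
  split_ifs <;> rfl

theorem truncate_mem_schwartz (N : ℕ) {Ψ : Family ι} (hΨ : IsSchwartz Ψ) :
    IsSchwartz (truncate N Ψ) := by
  obtain ⟨s₁, q₁, d₁⟩ := isSchwartz_iff.1 hΨ
  refine isSchwartz_iff.2 ⟨fun n σ i => ?_, fun n => ?_, fun m => ?_⟩
  · simp only [truncate, s₁ n σ i]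
  · rw [truncate_apply]
    split_ifs
    exacts [q₁ n, sqSum_zero]
  · obtain ⟨C, hC⟩ := d₁ m
    refine ⟨C, fun n => le_trans ?_ (hC n)⟩
    rw [truncate_apply]
    split_ifs
    · exact le_rfl
    · rw [sqNorm_zero, mul_zero]
      exact mul_nonneg (by positivity) (sqNorm_nonneg _)

/-- `a⁺[f]` on `S`. -/
def cr (f : H) : Module.End ℂ (schwartz ι) where
  toFun x := schwartz.mk (creation b f x) (creation_mem_schwartz b f x.isSchwartz)
  map_add' x y := schwartz.ext (creation_add b f x y)
  map_smul' c x := schwartz.ext (creation_smul b f c x)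

/-- `a⁻[f]` on `S`. -/
def an (f : H) : Module.End ℂ (schwartz ι) where
  toFun x := schwartz.mk (annihilation b f x) (annihilation_mem_schwartz b f x.isSchwartz)
  map_add' x y := schwartz.ext
    (annihilation_add b f (schwartz_sectorSq x) (schwartz_sectorSq y))
  map_smul' c x := schwartz.ext (annihilation_smul b f c x)

/-- Truncation on `S`. -/
def trunc (N : ℕ) : Module.End ℂ (schwartz ι) where
  toFun x := schwartz.mk (truncate N x) (truncate_mem_schwartz N x.isSchwartz)
  map_add' x y := by
    refine schwartz.ext (funext fun n => funext fun i => ?_)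
    simp only [schwartz.coe_mk, truncate, coe_add_schwartz, Pi.add_apply]
    split_ifs <;> simp
  map_smul' c x := by
    refine schwartz.ext (funext fun n => funext fun i => ?_)
    simp only [schwartz.coe_mk, truncate, coe_smul_schwartz, Pi.smul_apply, RingHom.id_apply]
    split_ifs <;> simp

theorem an_mul_cr (f g : H) : an b g * cr b f = cr b f * an b g + ⟪g, f⟫_ℂ • 1 :=
  LinearMap.ext fun x => schwartz.ext (annihilation_creation b g f (schwartz_sectorSq x))

theorem cr_mul_cr (f g : H) : cr b f * cr b g = cr b g * cr b f :=
  LinearMap.ext fun x => schwartz.ext (creation_comm b f g (x : Family ι))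

theorem an_mul_an (f g : H) : an b f * an b g = an b g * an b f :=
  LinearMap.ext fun x =>
    schwartz.ext (annihilation_comm b f g (schwartz_sectorSq x) (schwartz_symm x))

/-- The operator `i Ω[f] = a⁺[f] - a⁻[f]` on `S`. -/
def skewOp (f : H) : Module.End ℂ (schwartz ι) := cr b f - an b f

theorem an_mul_skewOp (f g : H) : an b g * skewOp b f = skewOp b f * an b g + ⟪g, f⟫_ℂ • 1 := by
  rw [skewOp, mul_sub, sub_mul, an_mul_cr, an_mul_an b g f]
  abel

theorem cr_mul_skewOp (f g : H) : cr b g * skewOp b f = skewOp b f * cr b g + ⟪f, g⟫_ℂ • 1 := by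
  rw [skewOp, mul_sub, sub_mul, an_mul_cr, cr_mul_cr b g f]
  abel

/-- The commutator is the scalar `(g, f) - (f, g)`. This is where isotropy of `ℒ` makes its Weyl
operators an abelian family. -/
theorem skewOp_commute {f g : H} (h : sympl f g = 0) : Commute (skewOp b f) (skewOp b g) := by
  have h' : ⟪f, g⟫_ℂ = ⟪g, f⟫_ℂ := by
    rw [sympl, mul_eq_zero, or_iff_right Complex.I_ne_zero, sub_eq_zero] at h
    exact h
  change skewOp b f * skewOp b g = skewOp b g * skewOp b f
  nth_rw 1 [skewOp]
  rw [sub_mul, an_mul_skewOp, cr_mul_skewOp, skewOp, skewOp, mul_sub, h']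
  abel

theorem creation_sub_left (f g : H) (Ψ : Family ι) :
    creation b (f - g) Ψ = creation b f Ψ - creation b g Ψ := by
  rw [eq_sub_iff_add_eq, ← creation_add_left, sub_add_cancel]

theorem annihilation_sub_left (f g : H) {Ψ : Family ι} (hΨ : SectorSq Ψ) :
    annihilation b (f - g) Ψ = annihilation b f Ψ - annihilation b g Ψ := by
  rw [eq_sub_iff_add_eq, ← annihilation_add_left b _ _ hΨ, sub_add_cancel]

theorem cr_sub (f g : H) : cr b (f - g) = cr b f - cr b g :=
  LinearMap.ext fun x => schwartz.ext (creation_sub_left b f g (x : Family ι))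

theorem an_sub (f g : H) : an b (f - g) = an b f - an b g :=
  LinearMap.ext fun x => schwartz.ext (annihilation_sub_left b f g (schwartz_sectorSq x))

theorem skewOp_sub (f g : H) : skewOp b (f - g) = skewOp b f - skewOp b g := by
  simp only [skewOp, cr_sub, an_sub]
  abel

/-! ### The Hilbert space containing `S` and adjointness on `S`. -/

variable (ι) in
/-- The Hilbert space `⊕ₙ H^{⊗n}` in coordinates. -/
abbrev FullFock := lp (fun _ : (n : ℕ) × (Fin n → ι) => ℂ) 2

theorem schwartz_sqSum (x : schwartz ι) :
    SqSum fun y : (n : ℕ) × (Fin n → ι) => (x : Family ι) y.1 y.2 :=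
  x.isSchwartz.summable

/-- The embedding of `S`. -/
def emb : schwartz ι →ₗ[ℂ] FullFock ι where
  toFun x := (schwartz_sqSum x).toLp
  map_add' _ _ := rfl
  map_smul' _ _ := rfl

theorem inner_emb (x : schwartz ι) (y : FullFock ι) :
    ⟪emb x, y⟫_ℂ = fockInner (x : Family ι) fun n i => y ⟨n, i⟩ := by
  rw [lp.inner_eq_tsum, fockInner]
  refine tsum_congr fun z => ?_
  rw [RCLike.inner_apply, mul_comm]
  rfl

theorem hasSum_inner_emb (x y : schwartz ι) : HasSum
    (fun n => ∑' i, starRingEnd ℂ ((x : Family ι) n i) * (y : Family ι) n i) ⟪emb x, emb y⟫_ℂ := by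
  have h := (schwartz_sqSum x).conj.summable_mul (schwartz_sqSum y)
  rw [inner_emb]
  exact h.hasSum.sigma fun n =>
    ((schwartz_sectorSq x n).conj.summable_mul (schwartz_sectorSq y n)).hasSum

theorem hasSum_norm_emb_sq (x : schwartz ι) :
    HasSum (fun n => sqNorm ((x : Family ι) n)) (‖emb x‖ ^ 2) := by
  have h := x.isSchwartz.summable.hasSum.sigma fun n =>
    (schwartz_sectorSq x n).hasSum
  have e : ‖emb x‖ ^ 2 = _ := (schwartz_sqSum x).norm_toLp_sq
  rw [e]
  exact h

theorem inner_emb_an (f : H) (x y : schwartz ι) :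
    ⟪emb (an b f x), emb y⟫_ℂ = ⟪emb x, emb (cr b f y)⟫_ℂ := by
  have h := hasSum_inner_emb x (cr b f y)
  -- The vacuum sector of `a⁺[f] y` is zero, so the sum may start at one particle, where sectorwise
  -- adjointness applies.
  rw [← hasSum_nat_add_iff' 1] at h
  have h0 : ∑ n ∈ Finset.range 1, ∑' i, starRingEnd ℂ ((x : Family ι) n i) *
      ((cr b f y : schwartz ι) : Family ι) n i = 0 := by
    rw [Finset.sum_range_one]
    have : ∀ i, ((cr b f y : schwartz ι) : Family ι) 0 i = 0 := fun i => rfl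
    simp [this]
  rw [h0, sub_zero] at h
  refine (hasSum_inner_emb (an b f x) y).unique (h.congr_fun fun n => ?_)
  exact (tsum_conj_mul_creation b f (schwartz_symm x) (schwartz_sectorSq x (n + 1))
    (schwartz_sectorSq y n)).symm

theorem inner_emb_cr (f : H) (x y : schwartz ι) :
    ⟪emb (cr b f x), emb y⟫_ℂ = ⟪emb x, emb (an b f y)⟫_ℂ := by
  rw [← inner_conj_symm, ← inner_emb_an, inner_conj_symm]

theorem inner_emb_skewOp (f : H) (x y : schwartz ι) :
    ⟪emb (skewOp b f x), emb y⟫_ℂ = -⟪emb x, emb (skewOp b f y)⟫_ℂ := by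
  simp only [skewOp, LinearMap.sub_apply, map_sub, inner_sub_left, inner_sub_right, inner_emb_cr,
    inner_emb_an, neg_sub]

/-- At most `N` particles. -/
def AtMost (N : ℕ) (x : schwartz ι) : Prop := ∀ n, N < n → (x : Family ι) n = 0

theorem atMost_trunc (N : ℕ) (x : schwartz ι) : AtMost N (trunc N x) := fun n hn => by
  change truncate N (x : Family ι) n = 0
  rw [truncate_apply, if_neg (not_le.2 hn)]

theorem AtMost.mono {N N' : ℕ} {x : schwartz ι} (h : AtMost N x) (hN : N ≤ N') : AtMost N' x :=
  fun n hn => h n (hN.trans_lt hn)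

theorem AtMost.cr (f : H) {N : ℕ} {x : schwartz ι} (h : AtMost N x) :
    AtMost (N + 1) (cr b f x) := by
  intro n hn
  obtain ⟨n, rfl⟩ : ∃ m, n = m + 1 := ⟨n - 1, by omega⟩
  funext i
  change creation b f (x : Family ι) (n + 1) i = 0
  rw [creation_succ, h n (by omega)]
  simp

theorem AtMost.an (f : H) {N : ℕ} {x : schwartz ι} (h : AtMost N x) :
    AtMost N (an b f x) := by
  intro n hn
  funext i
  change annihilation b f (x : Family ι) n i = 0
  rw [annihilation_apply, h (n + 1) (by omega)]
  simp

theorem AtMost.sub {N : ℕ} {x y : schwartz ι} (hx : AtMost N x) (hy : AtMost N y) :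
    AtMost N (x - y) := fun n hn => by
  change (x : Family ι) n - (y : Family ι) n = 0
  rw [hx n hn, hy n hn, sub_zero]

theorem AtMost.skewOp (f : H) {N : ℕ} {x : schwartz ι} (h : AtMost N x) :
    AtMost (N + 1) (skewOp b f x) :=
  (h.cr b f).sub ((h.an b f).mono (Nat.le_succ N))

theorem AtMost.norm_cr_le (f : H) {N : ℕ} {x : schwartz ι} (h : AtMost N x) :
    ‖emb (ConstrainedFock.cr b f x)‖ ≤ √(N + 1) * ‖f‖ * ‖emb x‖ := by
  refine le_of_sq_le_sq ?_ (by positivity)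
  rw [mul_pow, mul_pow, Real.sq_sqrt (by positivity)]
  have h₁ := hasSum_norm_emb_sq (ConstrainedFock.cr b f x)
  rw [← hasSum_nat_add_iff' 1] at h₁
  have h0 : ∑ n ∈ Finset.range 1,
      sqNorm (((ConstrainedFock.cr b f x : schwartz ι) : Family ι) n) = 0 := by
    rw [Finset.sum_range_one]
    exact sqNorm_zero
  rw [h0, sub_zero] at h₁
  refine hasSum_le (fun n => ?_) h₁ ((hasSum_norm_emb_sq x).mul_left ((N + 1) * ‖f‖ ^ 2))
  refine (creation_sector b f (schwartz_sectorSq x n)).2.trans ?_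
  rcases le_or_gt n N with hn | hn
  · have := sqNorm_nonneg ((x : Family ι) n)
    have : (n : ℝ) ≤ N := by exact_mod_cast hn
    gcongr
  · rw [h n hn, sqNorm_zero]
    simp

theorem AtMost.norm_an_le (f : H) {N : ℕ} {x : schwartz ι} (h : AtMost N x) :
    ‖emb (ConstrainedFock.an b f x)‖ ≤ √(N + 1) * ‖f‖ * ‖emb x‖ := by
  refine le_of_sq_le_sq ?_ (by positivity)
  rw [mul_pow, mul_pow, Real.sq_sqrt (by positivity)]
  have h₁ := hasSum_norm_emb_sq x
  rw [← hasSum_nat_add_iff' 1] at h₁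
  have hle : ‖emb x‖ ^ 2 - ∑ n ∈ Finset.range 1, sqNorm ((x : Family ι) n) ≤ ‖emb x‖ ^ 2 := by
    rw [Finset.sum_range_one]
    linarith [sqNorm_nonneg ((x : Family ι) 0)]
  refine le_trans ?_ (mul_le_mul_of_nonneg_left hle (by positivity))
  refine hasSum_le (fun n => ?_) (hasSum_norm_emb_sq (ConstrainedFock.an b f x))
    (h₁.mul_left ((N + 1) * ‖f‖ ^ 2))
  refine (annihilation_sector b f (schwartz_sectorSq x (n + 1))).2.trans ?_
  rcases le_or_gt (n + 1) N with hn | hn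
  · have := sqNorm_nonneg ((x : Family ι) (n + 1))
    have : (n : ℝ) ≤ N := by exact_mod_cast (Nat.le_succ n).trans hn
    gcongr
  · rw [h (n + 1) hn, sqNorm_zero]
    simp

theorem AtMost.norm_skewOp_le (f : H) {N : ℕ} {x : schwartz ι} (h : AtMost N x) :
    ‖emb (ConstrainedFock.skewOp b f x)‖ ≤ 2 * √(N + 1) * ‖f‖ * ‖emb x‖ := by
  rw [ConstrainedFock.skewOp, LinearMap.sub_apply, map_sub]
  refine (norm_sub_le _ _).trans ?_
  linarith [h.norm_cr_le b f, h.norm_an_le b f]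

end Schwartz

/-! ### The Weyl operators on `S` -/

section Weyl

variable {ι H : Type*} [NormedAddCommGroup H] [InnerProductSpace ℂ H] (b : HilbertBasis ι ℂ H)

/-- The growth of the powers of `i Ω[f]` on `N`-particle vectors. -/
def growth (N m : ℕ) : ℝ := ∏ k ∈ Finset.range m, 2 * √((N + k : ℕ) + 1)

theorem growth_nonneg (N m : ℕ) : 0 ≤ growth N m := Finset.prod_nonneg fun _ _ => by positivity

theorem summable_growth (N : ℕ) {r : ℝ} (hr : 0 ≤ r) :
    Summable fun m : ℕ => ((m.factorial : ℝ))⁻¹ * (growth N m * r ^ m) := by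
  refine summable_of_ratio_norm_eventually_le (r := 1 / 2) (by norm_num) ?_
  -- The ratio of consecutive terms is `2r√(N + m + 1) / (m + 1)`. As `√(N + m + 1) ≤ √(N + 1) √(m +
  -- 1)`, it is at most `1/2` once `√(m + 1) ≥ 4r√(N + 1)`.
  filter_upwards [eventually_ge_atTop ⌈(4 * r * √(N + 1)) ^ 2⌉₊] with m hm
  have hm' : (4 * r * √(N + 1)) ^ 2 ≤ (m : ℝ) + 1 := (Nat.ceil_le.1 hm).trans (by linarith)
  have h₁ : 4 * r * √(N + 1) ≤ √(m + 1) := Real.le_sqrt_of_sq_le hm'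
  have h₂ : √((N + m : ℕ) + 1) ≤ √(N + 1) * √(m + 1) := by
    rw [← Real.sqrt_mul (by positivity)]
    refine Real.sqrt_le_sqrt ?_
    push_cast
    nlinarith [N.cast_nonneg (α := ℝ), m.cast_nonneg (α := ℝ),
      mul_nonneg (N.cast_nonneg (α := ℝ)) (m.cast_nonneg (α := ℝ))]
  have h₃ : 2 * √((N + m : ℕ) + 1) * r ≤ 1 / 2 * (m + 1) := by
    have h₄ : √((m : ℝ) + 1) * √(m + 1) = m + 1 := Real.mul_self_sqrt (by positivity)
    have h₅ := mul_le_mul_of_nonneg_right h₁ (Real.sqrt_nonneg ((m : ℝ) + 1))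
    have h₆ := mul_le_mul_of_nonneg_right h₂ hr
    nlinarith
  have hg := growth_nonneg N m
  have hf : (0 : ℝ) < m.factorial := by exact_mod_cast m.factorial_pos
  rw [Real.norm_of_nonneg (mul_nonneg (by positivity)
    (mul_nonneg (growth_nonneg _ _) (by positivity))), Real.norm_of_nonneg (by positivity), growth,
    Finset.prod_range_succ, ← growth, Nat.factorial_succ]
  push_cast at h₃ ⊢
  have hm1 : (0 : ℝ) < m + 1 := by positivity
  calc (((m : ℝ) + 1) * m.factorial)⁻¹ * (growth N m * (2 * √(N + m + 1)) * r ^ (m + 1))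
      = (m + 1 : ℝ)⁻¹ * (2 * √(N + m + 1) * r) * ((m.factorial : ℝ)⁻¹ * (growth N m * r ^ m)) := by
        rw [mul_inv, pow_succ]
        ring
    _ ≤ 1 / 2 * ((m.factorial : ℝ)⁻¹ * (growth N m * r ^ m)) := by
        gcongr
        rw [inv_mul_le_iff₀ hm1]
        linarith

theorem AtMost.pow_skewOp (f : H) {N : ℕ} {x : schwartz ι} (h : AtMost N x) (m : ℕ) :
    AtMost (N + m) ((ConstrainedFock.skewOp b f ^ m) x) ∧
      ‖emb ((ConstrainedFock.skewOp b f ^ m) x)‖ ≤ growth N m * ‖f‖ ^ m * ‖emb x‖ := by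
  induction m with
  | zero => simpa [growth] using h
  | succ m ih =>
    rw [pow_succ', Module.End.mul_apply]
    refine ⟨ih.1.skewOp b f, (ih.1.norm_skewOp_le b f).trans ?_⟩
    have h₁ := mul_le_mul_of_nonneg_left ih.2
      (by positivity : 0 ≤ 2 * √((N + m : ℕ) + 1 : ℝ) * ‖f‖)
    refine h₁.trans (le_of_eq ?_)
    rw [growth, growth, Finset.prod_range_succ, pow_succ]
    ring

/-- Vectors with boundedly many particles. -/
def FinPart (x : schwartz ι) : Prop := ∃ N, AtMost N x

theorem finPart_trunc (N : ℕ) (x : schwartz ι) : FinPart (trunc N x) := ⟨N, atMost_trunc N x⟩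

theorem FinPart.sub {x y : schwartz ι} (hx : FinPart x) (hy : FinPart y) : FinPart (x - y) := by
  obtain ⟨N, hN⟩ := hx
  obtain ⟨N', hN'⟩ := hy
  exact ⟨max N N', (hN.mono (le_max_left _ _)).sub (hN'.mono (le_max_right _ _))⟩

/-- The terms of the exponential series. -/
def expTerm (f : H) (x : schwartz ι) (m : ℕ) : FullFock ι :=
  ((m.factorial : ℂ))⁻¹ • emb ((skewOp b f ^ m) x)

/-- The exponential series of `i Ω[f]`. -/
def expSeries (f : H) (x : schwartz ι) : FullFock ι := ∑' m : ℕ, expTerm b f x m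

theorem AtMost.norm_expTerm_le (f : H) {N : ℕ} {x : schwartz ι} (h : AtMost N x) (m : ℕ) :
    ‖expTerm b f x m‖ ≤ ((m.factorial : ℝ))⁻¹ * (growth N m * ‖f‖ ^ m) * ‖emb x‖ := by
  rw [expTerm, norm_smul, norm_inv, Complex.norm_natCast, mul_assoc]
  exact mul_le_mul_of_nonneg_left (h.pow_skewOp b f m).2 (by positivity)

theorem FinPart.summable_norm_expTerm (f : H) {x : schwartz ι} (hx : FinPart x) :
    Summable fun m => ‖expTerm b f x m‖ := by
  obtain ⟨N, hN⟩ := hx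
  exact Summable.of_nonneg_of_le (fun _ => norm_nonneg _) (hN.norm_expTerm_le b f)
    ((summable_growth N (norm_nonneg f)).mul_right _)

theorem FinPart.summable_expTerm (f : H) {x : schwartz ι} (hx : FinPart x) :
    Summable fun m => expTerm b f x m := (hx.summable_norm_expTerm b f).of_norm

theorem FinPart.hasSum_expTerm (f : H) {x : schwartz ι} (hx : FinPart x) :
    HasSum (fun m => expTerm b f x m) (expSeries b f x) := (hx.summable_expTerm b f).hasSum

theorem expTerm_sub (f : H) (x y : schwartz ι) (m : ℕ) :
    expTerm b f (x - y) m = expTerm b f x m - expTerm b f y m := by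
  simp only [expTerm, map_sub, smul_sub]

theorem expSeries_sub (f : H) {x y : schwartz ι} (hx : FinPart x) (hy : FinPart y) :
    expSeries b f (x - y) = expSeries b f x - expSeries b f y := by
  simp only [expSeries, expTerm_sub]
  exact (hx.summable_expTerm b f).tsum_sub (hy.summable_expTerm b f)

theorem inner_emb_pow_skewOp (f : H) (x y : schwartz ι) (m : ℕ) :
    ⟪emb ((skewOp b f ^ m) x), emb y⟫_ℂ = ⟪emb x, emb (((-skewOp b f) ^ m) y)⟫_ℂ := by
  induction m generalizing x with
  | zero => simp
  | succ m ih =>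
    rw [pow_succ, Module.End.mul_apply, ih, inner_emb_skewOp, pow_succ', Module.End.mul_apply,
      LinearMap.neg_apply, map_neg, inner_neg_right]

theorem inner_expTerm (f g : H) (x y : schwartz ι) (m l : ℕ) :
    ⟪expTerm b f x m, expTerm b g y l⟫_ℂ = ((m.factorial : ℂ))⁻¹ * ((l.factorial : ℂ))⁻¹ *
      ⟪emb x, emb (((-skewOp b f) ^ m * skewOp b g ^ l) y)⟫_ℂ := by
  rw [expTerm, expTerm, inner_smul_left, inner_smul_right, inner_emb_pow_skewOp, map_inv₀,
    Complex.conj_natCast, Module.End.mul_apply]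
  ring

/-- Binomial theorem for the commuting operators `-iΩ[f]` and `iΩ[g]`, after the powers of `iΩ[f]`
have been moved to the right factor by skew-adjointness. -/
theorem sum_antidiagonal_inner_expTerm {f g : H} (h : sympl f g = 0) (x y : schwartz ι) (n : ℕ) :
    ∑ p ∈ Finset.HasAntidiagonal.antidiagonal n, ⟪expTerm b f x p.1, expTerm b g y p.2⟫_ℂ =
      ⟪emb x, expTerm b (g - f) y n⟫_ℂ := by
  have hc : Commute (-skewOp b f) (skewOp b g) := (skewOp_commute b h).neg_left
  have e : skewOp b (g - f) = -skewOp b f + skewOp b g := by rw [skewOp_sub]; abel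
  rw [expTerm, e, hc.add_pow', inner_smul_right, LinearMap.sum_apply, map_sum, inner_sum,
    Finset.mul_sum]
  refine Finset.sum_congr rfl fun p hp => ?_
  rw [inner_expTerm, LinearMap.smul_apply, map_nsmul, ← Nat.cast_smul_eq_nsmul ℂ, inner_smul_right,
    ← mul_assoc]
  congr 1
  have hn : p.1 + p.2 = n := Finset.HasAntidiagonal.mem_antidiagonal.1 hp
  have h₁ := Nat.add_choose_mul_factorial_mul_factorial p.1 p.2
  rw [hn, ← Nat.choose_symm_of_eq_add hn.symm] at h₁
  have h₂ : ((n.choose p.1 : ℕ) : ℂ) * p.1.factorial * p.2.factorial = n.factorial := by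
    exact_mod_cast h₁
  have n₁ : (p.1.factorial : ℂ) ≠ 0 := by exact_mod_cast p.1.factorial_ne_zero
  have n₂ : (p.2.factorial : ℂ) ≠ 0 := by exact_mod_cast p.2.factorial_ne_zero
  have n₃ : (n.factorial : ℂ) ≠ 0 := by exact_mod_cast n.factorial_ne_zero
  field_simp
  linear_combination -h₂

/-- The group law in weak form, by a Cauchy product of two absolutely convergent series. With `f =
g` it yields isometry. -/
theorem inner_expSeries {f g : H} (h : sympl f g = 0) {x y : schwartz ι} (hx : FinPart x)
    (hy : FinPart y) :
    ⟪expSeries b f x, expSeries b g y⟫_ℂ = ⟪emb x, expSeries b (g - f) y⟫_ℂ := by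
  have hX := hx.summable_norm_expTerm b f
  have hY := hy.summable_norm_expTerm b g
  let F : ℕ × ℕ → ℂ := fun p => ⟪expTerm b f x p.1, expTerm b g y p.2⟫_ℂ
  have hF : Summable F := by
    refine Summable.of_norm_bounded
      (hX.mul_of_nonneg hY (fun _ => norm_nonneg _) fun _ => norm_nonneg _) fun p => ?_
    exact norm_inner_le_norm _ _
  have h₁ : ∑' p, F p = ⟪expSeries b f x, expSeries b g y⟫_ℂ := by
    rw [hF.tsum_prod]
    have e₁ : ∀ m, ∑' l, F (m, l) = ⟪expTerm b f x m, expSeries b g y⟫_ℂ := fun m =>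
      ((hy.hasSum_expTerm b g).mapL (innerSL ℂ (expTerm b f x m))).tsum_eq
    simp only [e₁]
    have e₂ := (hx.hasSum_expTerm b f).mapL (innerSL ℂ (expSeries b g y))
    have e₃ := (Complex.hasSum_conj'.2 e₂).tsum_eq
    simpa using e₃
  have h₂ : ∑' p, F p = ∑' n, ∑ p ∈ Finset.HasAntidiagonal.antidiagonal n, F p := by
    rw [← Finset.HasAntidiagonal.sigmaAntidiagonalEquivProd.tsum_eq]
    refine ((Finset.HasAntidiagonal.sigmaAntidiagonalEquivProd.summable_iff.2 hF).tsum_sigma'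
      fun n => (hasSum_fintype _).summable).trans ?_
    refine tsum_congr fun n => ?_
    rw [tsum_fintype]
    exact Finset.sum_coe_sort (Finset.HasAntidiagonal.antidiagonal n) F
  rw [← h₁, h₂]
  simp only [F, sum_antidiagonal_inner_expTerm b h]
  exact ((hy.hasSum_expTerm b (g - f)).mapL (innerSL ℂ (emb x))).tsum_eq

theorem skewOp_zero : skewOp b (0 : H) = 0 := by
  have h := skewOp_sub b (0 : H) 0
  rwa [sub_self, sub_self] at h

theorem expSeries_zero (x : schwartz ι) : expSeries b (0 : H) x = emb x := by
  rw [expSeries, tsum_eq_single 0]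
  · simp [expTerm]
  · intro m hm
    rw [expTerm, skewOp_zero, zero_pow hm]
    simp

theorem norm_expSeries (f : H) {x : schwartz ι} (hx : FinPart x) :
    ‖expSeries b f x‖ = ‖emb x‖ := by
  have h := inner_expSeries b (f := f) (g := f) (by simp [sympl]) hx hx
  rw [sub_self, expSeries_zero, inner_self_eq_norm_sq_to_K, inner_self_eq_norm_sq_to_K] at h
  have h' : ‖expSeries b f x‖ ^ 2 = ‖emb x‖ ^ 2 := by exact_mod_cast h
  exact (pow_left_inj₀ (norm_nonneg _) (norm_nonneg _) two_ne_zero).1 h'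

theorem tendsto_emb_trunc (x : schwartz ι) :
    Tendsto (fun N => emb (trunc N x)) atTop (𝓝 (emb x)) := by
  rw [tendsto_iff_norm_sub_tendsto_zero]
  have hsq : Tendsto (fun N => ‖emb (trunc N x) - emb x‖ ^ 2) atTop (𝓝 0) := by
    have e : ∀ N, ‖emb (trunc N x) - emb x‖ ^ 2 = ∑' n, sqNorm ((x : Family ι) (n + (N + 1))) := by
      intro N
      rw [← norm_neg, neg_sub, ← map_sub]
      have h := hasSum_norm_emb_sq (x - trunc N x)
      have hz : ∀ n, ((x - trunc N x : schwartz ι) : Family ι) n =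
          (x : Family ι) n - truncate N (x : Family ι) n := fun _ => rfl
      rw [← hasSum_nat_add_iff' (N + 1)] at h
      have h0 : ∑ n ∈ Finset.range (N + 1), sqNorm (((x - trunc N x : schwartz ι) : Family ι) n)
          = 0 := by
        refine Finset.sum_eq_zero fun n hn => ?_
        rw [hz, truncate_apply, if_pos (Nat.lt_succ_iff.1 (Finset.mem_range.1 hn)), sub_self,
          sqNorm_zero]
      rw [h0, sub_zero] at h
      rw [← h.tsum_eq]
      refine tsum_congr fun n => ?_
      rw [hz, truncate_apply, if_neg (by omega), sub_zero]
    simp only [e]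
    exact (tendsto_sum_nat_add fun n => sqNorm ((x : Family ι) n)).comp (tendsto_add_atTop_nat 1)
  have := hsq.sqrt
  simpa [Real.sqrt_sq] using this

/-- The Weyl operator on `S`, with values in the Hilbert space. -/
def weylOp (f : H) (x : schwartz ι) : FullFock ι :=
  limUnder atTop fun N => expSeries b f (trunc N x)

theorem tendsto_expSeries_trunc (f : H) (x : schwartz ι) :
    Tendsto (fun N => expSeries b f (trunc N x)) atTop (𝓝 (weylOp b f x)) := by
  refine CauchySeq.tendsto_limUnder ?_
  have h := (tendsto_emb_trunc x).cauchySeq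
  rw [Metric.cauchySeq_iff] at h ⊢
  intro ε hε
  obtain ⟨N, hN⟩ := h ε hε
  refine ⟨N, fun m hm n hn => ?_⟩
  have := hN m hm n hn
  rwa [dist_eq_norm, ← expSeries_sub b f (finPart_trunc _ _) (finPart_trunc _ _),
    norm_expSeries b f ((finPart_trunc _ _).sub (finPart_trunc _ _)), map_sub, ← dist_eq_norm]

/-- By isometry the limit does not depend on the approximating vectors. This is needed for images of
truncations under creation and annihilation operators, which need not be the truncations of the same
index. -/
theorem tendsto_expSeries (f : H) {α : Type*} {l : Filter α} {z : α → schwartz ι}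
    (hz : ∀ a, FinPart (z a)) {x : schwartz ι} (h : Tendsto (fun a => emb (z a)) l (𝓝 (emb x))) :
    Tendsto (fun a => expSeries b f (z a)) l (𝓝 (weylOp b f x)) := by
  rw [tendsto_iff_norm_sub_tendsto_zero] at h ⊢
  refine h.congr fun a => ?_
  have h₁ := ((tendsto_expSeries_trunc b f x).const_sub (expSeries b f (z a))).norm
  have h₂ := ((tendsto_emb_trunc x).const_sub (emb (z a))).norm
  refine tendsto_nhds_unique h₂ (h₁.congr fun N => ?_)
  rw [← expSeries_sub b f (hz a) (finPart_trunc _ _),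
    norm_expSeries b f ((hz a).sub (finPart_trunc _ _)), map_sub]

theorem FinPart.weylOp_eq (f : H) {x : schwartz ι} (hx : FinPart x) :
    weylOp b f x = expSeries b f x :=
  tendsto_nhds_unique (tendsto_expSeries b f (fun _ : ℕ => hx) (tendsto_const_nhds (f := atTop)))
    tendsto_const_nhds

theorem inner_weylOp {f g : H} (h : sympl f g = 0) (x y : schwartz ι) :
    ⟪weylOp b f x, weylOp b g y⟫_ℂ = ⟪emb x, weylOp b (g - f) y⟫_ℂ := by
  refine tendsto_nhds_unique
    ((tendsto_expSeries_trunc b f x).inner (tendsto_expSeries_trunc b g y)) ?_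
  simp only [inner_expSeries b h (finPart_trunc _ _) (finPart_trunc _ _)]
  exact (tendsto_emb_trunc x).inner (tendsto_expSeries_trunc b (g - f) y)

theorem weylOp_zero (x : schwartz ι) : weylOp b (0 : H) x = emb x := by
  refine tendsto_nhds_unique (tendsto_expSeries_trunc b 0 x) ?_
  simp only [expSeries_zero]
  exact tendsto_emb_trunc x

theorem norm_weylOp (f : H) (x : schwartz ι) : ‖weylOp b f x‖ = ‖emb x‖ := by
  refine tendsto_nhds_unique (tendsto_expSeries_trunc b f x).norm ?_
  simp only [norm_expSeries b f (finPart_trunc _ _)]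
  exact (tendsto_emb_trunc x).norm

theorem weylOp_sub (f : H) (x y : schwartz ι) :
    weylOp b f (x - y) = weylOp b f x - weylOp b f y := by
  refine tendsto_nhds_unique (tendsto_expSeries_trunc b f (x - y)) ?_
  simp only [map_sub, expSeries_sub b f (finPart_trunc _ _) (finPart_trunc _ _)]
  exact (tendsto_expSeries_trunc b f x).sub (tendsto_expSeries_trunc b f y)

theorem weylOp_smul (f : H) (c : ℂ) (x : schwartz ι) :
    weylOp b f (c • x) = c • weylOp b f x := by
  refine tendsto_nhds_unique (tendsto_expSeries_trunc b f (c • x)) ?_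
  have e : ∀ N, expSeries b f (trunc N (c • x)) = c • expSeries b f (trunc N x) := by
    intro N
    simp only [expSeries, expTerm, map_smul, smul_comm _ c]
    exact ((finPart_trunc N x).summable_expTerm b f).tsum_const_smul c
  simp only [e]
  exact (tendsto_expSeries_trunc b f x).const_smul c

theorem weylOp_add (f : H) (x y : schwartz ι) :
    weylOp b f (x + y) = weylOp b f x + weylOp b f y := by
  have h := weylOp_sub b f x ((-1 : ℂ) • y)
  rwa [weylOp_smul, neg_one_smul, neg_one_smul, sub_neg_eq_add, sub_neg_eq_add] at h

/-! ### Identification with the coordinate definition of the Weyl operator. -/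

theorem I_smul_fieldOp (f : H) (Ψ : Family ι) :
    Complex.I • fieldOp b f Ψ = creation b f Ψ - annihilation b f Ψ := by
  rw [fieldOp, smul_smul]
  simp

theorem iterate_fieldOp (f : H) (x : schwartz ι) (m : ℕ) :
    (fun Φ : Family ι => Complex.I • fieldOp b f Φ)^[m] (x : Family ι) =
      ((skewOp b f ^ m) x : schwartz ι) := by
  induction m with
  | zero => rfl
  | succ m ih =>
    rw [Function.iterate_succ_apply', ih, I_smul_fieldOp, pow_succ']
    rfl

/-- The coordinates of the Weyl operator. -/
theorem weyl_eq (f : H) (x : schwartz ι) (n : ℕ) (i : Fin n → ι) :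
    weyl b f (x : Family ι) n i = weylOp b f x ⟨n, i⟩ := by
  let ev : FullFock ι →L[ℂ] ℂ := lp.evalCLM ℂ (fun _ : (n : ℕ) × (Fin n → ι) => ℂ) 2 ⟨n, i⟩
  have hev : ∀ z, ev z = z ⟨n, i⟩ := fun _ => rfl
  have h := (ev.continuous.tendsto _).comp (tendsto_expSeries_trunc b f x)
  refine Tendsto.limUnder_eq (h.congr fun N => ?_)
  have h₁ := ((finPart_trunc N x).hasSum_expTerm b f).mapL ev
  refine h₁.tsum_eq.symm.trans (tsum_congr fun m => ?_)
  have h₂ := iterate_fieldOp b f (trunc N x) m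
  have h₃ : ((trunc N x : schwartz ι) : Family ι) = truncate N (x : Family ι) := rfl
  rw [h₃] at h₂
  rw [h₂]
  rfl

theorem fockInner_weyl (f : H) (x y : schwartz ι) :
    fockInner (x : Family ι) (weyl b f (y : Family ι)) = ⟪emb x, weylOp b f y⟫_ℂ := by
  rw [inner_emb]
  congr 1
  funext n i
  exact weyl_eq b f y n i

/-- When the commutator with `T` is a scalar, commutation with `P` differentiates the powers of `T`;
on the exponential series it therefore reproduces the series times the scalar. -/
theorem mul_pow_skew {R : Type*} [Ring R] [Algebra ℂ R] {P T : R} {c : ℂ}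
    (h : P * T = T * P + c • 1) (m : ℕ) :
    P * T ^ (m + 1) = T ^ (m + 1) * P + ((m + 1 : ℂ) * c) • T ^ m := by
  induction m with
  | zero => simpa using h
  | succ m ih =>
    rw [pow_succ T (m + 1), ← mul_assoc, ih, add_mul, mul_assoc, h, smul_mul_assoc, ← pow_succ,
      mul_add, ← mul_assoc, mul_smul_comm, mul_one, add_assoc, ← add_smul]
    congr 2
    push_cast
    ring

/-- Intertwining of the Weyl operators with an operator `P` adjoint to `P'`. -/
theorem inner_weylOp_of_adjoint (f : H) {P P' : Module.End ℂ (schwartz ι)} {c : ℂ}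
    (hadj : ∀ x y, ⟪emb (P x), emb y⟫_ℂ = ⟪emb x, emb (P' y)⟫_ℂ)
    (hcomm : P' * skewOp b f = skewOp b f * P' + c • 1)
    (hfin : ∀ x, FinPart x → FinPart (P' x))
    (htr : ∀ x, Tendsto (fun N => emb (P' (trunc N x))) atTop (𝓝 (emb (P' x))))
    (x y : schwartz ι) :
    ⟪emb (P x), weylOp b f y⟫_ℂ = ⟪emb x, weylOp b f (P' y)⟫_ℂ + c * ⟪emb x, weylOp b f y⟫_ℂ := by
  have key : ∀ y, FinPart y → ⟪emb (P x), expSeries b f y⟫_ℂ =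
      ⟪emb x, expSeries b f (P' y)⟫_ℂ + c * ⟪emb x, expSeries b f y⟫_ℂ := by
    intro y hy
    have h₁ := (hy.hasSum_expTerm b f).mapL (innerSL ℂ (emb (P x)))
    have h₂ := ((hfin y hy).hasSum_expTerm b f).mapL (innerSL ℂ (emb x))
    have h₃ := ((hy.hasSum_expTerm b f).mapL (innerSL ℂ (emb x))).mul_left c
    simp only [innerSL_apply_apply] at h₁ h₂ h₃
    have h₄ := h₁.sub h₂
    -- The zeroth terms cancel by adjointness. Shifting the index by one turns `(m + 1) / (m + 1)!`
    -- into `1 / m!`.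
    have hz : ⟪emb (P x), expTerm b f y 0⟫_ℂ - ⟪emb x, expTerm b f (P' y) 0⟫_ℂ = 0 := by
      simp [expTerm, hadj]
    rw [← hasSum_nat_add_iff' 1, Finset.sum_range_one, hz, sub_zero] at h₄
    have hs : ∀ m, ⟪emb (P x), expTerm b f y (m + 1)⟫_ℂ - ⟪emb x, expTerm b f (P' y) (m + 1)⟫_ℂ =
        c * ⟪emb x, expTerm b f y m⟫_ℂ := by
      intro m
      have e : P' ((skewOp b f ^ (m + 1)) y) = (skewOp b f ^ (m + 1)) (P' y) +
          ((m + 1 : ℂ) * c) • (skewOp b f ^ m) y :=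
        congrArg (fun T : Module.End ℂ (schwartz ι) => T y) (mul_pow_skew hcomm m)
      simp only [expTerm, inner_smul_right, hadj]
      rw [e, map_add, map_smul, inner_add_right, inner_smul_right, Nat.factorial_succ]
      have hf : (m.factorial : ℂ) ≠ 0 := by exact_mod_cast m.factorial_ne_zero
      have hm : ((m : ℂ) + 1) ≠ 0 := by exact_mod_cast m.succ_ne_zero
      push_cast
      field_simp
      ring
    simp only [hs] at h₄
    linear_combination h₄.unique h₃
  have l₁ := (tendsto_const_nhds (x := emb (P x))).inner (𝕜 := ℂ) (tendsto_expSeries_trunc b f y)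
  have l₂ := (tendsto_const_nhds (x := emb x)).inner (𝕜 := ℂ)
    (tendsto_expSeries b f (fun N => hfin _ (finPart_trunc N y)) (htr y))
  have l₃ := ((tendsto_const_nhds (x := emb x)).inner (𝕜 := ℂ)
    (tendsto_expSeries_trunc b f y)).const_mul c
  refine tendsto_nhds_unique l₁ ((l₂.add l₃).congr fun N => ?_)
  exact (key _ (finPart_trunc N y)).symm

theorem an_trunc_succ (g : H) (N : ℕ) (x : schwartz ι) :
    an b g (trunc (N + 1) x) = trunc N (an b g x) := by
  refine schwartz.ext (funext fun n => funext fun i => ?_)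
  change annihilation b g (truncate (N + 1) (x : Family ι)) n i =
    truncate N (annihilation b g (x : Family ι)) n i
  rw [annihilation_apply, truncate_apply, truncate_apply]
  by_cases h : n ≤ N
  · rw [if_pos h, if_pos (Nat.succ_le_succ h)]
    rfl
  · rw [if_neg h, if_neg (by omega)]
    simp

theorem cr_trunc (g : H) (N : ℕ) (x : schwartz ι) :
    cr b g (trunc N x) = trunc (N + 1) (cr b g x) := by
  refine schwartz.ext (funext fun n => funext fun i => ?_)
  change creation b g (truncate N (x : Family ι)) n i =
    truncate (N + 1) (creation b g (x : Family ι)) n i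
  cases n with
  | zero => simp [truncate_apply, creation_zero]
  | succ n =>
    rw [creation_succ, truncate_apply, truncate_apply]
    by_cases h : n ≤ N
    · rw [if_pos h, if_pos (Nat.succ_le_succ h)]
      rfl
    · rw [if_neg h, if_neg (by omega)]
      simp

theorem inner_cr_weylOp (f g : H) (x y : schwartz ι) : ⟪emb (cr b g x), weylOp b f y⟫_ℂ =
    ⟪emb x, weylOp b f (an b g y)⟫_ℂ + ⟪g, f⟫_ℂ * ⟪emb x, weylOp b f y⟫_ℂ := by
  refine inner_weylOp_of_adjoint b f (inner_emb_cr b g) (an_mul_skewOp b f g)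
    (fun x ⟨N, hN⟩ => ⟨N, hN.an b g⟩) (fun x => ?_) x y
  rw [← tendsto_add_atTop_iff_nat 1]
  simp only [an_trunc_succ]
  exact tendsto_emb_trunc _

theorem inner_an_weylOp (f g : H) (x y : schwartz ι) : ⟪emb (an b g x), weylOp b f y⟫_ℂ =
    ⟪emb x, weylOp b f (cr b g y)⟫_ℂ + ⟪f, g⟫_ℂ * ⟪emb x, weylOp b f y⟫_ℂ := by
  refine inner_weylOp_of_adjoint b f (inner_emb_an b g) (cr_mul_skewOp b f g)
    (fun x ⟨N, hN⟩ => ⟨N + 1, hN.cr b g⟩) (fun x => ?_) x y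
  simp only [cr_trunc]
  exact (tendsto_emb_trunc _).comp (tendsto_add_atTop_nat 1)

/-- Every term after the zeroth carries at least one factor `‖f‖`, and the remaining powers are at
most `1`. -/
theorem FinPart.exists_norm_expSeries_sub_le {x : schwartz ι} (hx : FinPart x) :
    ∃ C : ℝ, ∀ f : H, ‖f‖ ≤ 1 → ‖expSeries b f x - emb x‖ ≤ ‖f‖ * C := by
  obtain ⟨N, hN⟩ := hx
  have hs := (summable_growth N zero_le_one).mul_right ‖emb x‖
  have hs' := (summable_nat_add_iff 1).2 hs
  refine ⟨∑' m : ℕ, ((m + 1).factorial : ℝ)⁻¹ * (growth N (m + 1) * 1 ^ (m + 1)) * ‖emb x‖,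
    fun f hf => ?_⟩
  have h := (FinPart.hasSum_expTerm b f ⟨N, hN⟩)
  rw [← hasSum_nat_add_iff' 1, Finset.sum_range_one] at h
  have h0 : expTerm b f x 0 = emb x := by simp [expTerm]
  rw [h0] at h
  rw [← h.tsum_eq]
  refine tsum_of_norm_bounded (hs'.hasSum.mul_left ‖f‖) fun m => ?_
  refine (hN.norm_expTerm_le b f (m + 1)).trans ?_
  have hg := growth_nonneg N (m + 1)
  have hp : ‖f‖ ^ (m + 1) ≤ ‖f‖ := by
    rw [pow_succ]
    exact mul_le_of_le_one_left (norm_nonneg _) (pow_le_one₀ (norm_nonneg _) hf)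
  calc _ ≤ ((m + 1).factorial : ℝ)⁻¹ * (growth N (m + 1) * ‖f‖) * ‖emb x‖ := by gcongr
    _ = _ := by rw [one_pow]; ring

/-- A three-epsilon argument: isometry makes the error of truncation uniform in `f`, and on the
truncated vector the series is explicit. -/
theorem tendsto_weylOp_zero (x : schwartz ι) :
    Tendsto (fun f : H => weylOp b f x) (𝓝 0) (𝓝 (emb x)) := by
  rw [Metric.tendsto_nhds]
  intro ε hε
  have h := Metric.tendsto_nhds.1 (tendsto_emb_trunc x) (ε / 3) (by positivity)
  obtain ⟨N, hN⟩ := h.exists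
  obtain ⟨C, hC⟩ := (finPart_trunc N x).exists_norm_expSeries_sub_le b
  have hlim : Tendsto (fun f : H => ‖f‖ * C) (𝓝 0) (𝓝 0) := by
    have : Tendsto (fun f : H => ‖f‖ * C) (𝓝 0) (𝓝 (‖(0 : H)‖ * C)) :=
      (Continuous.tendsto (by fun_prop) _)
    simpa using this
  filter_upwards [hlim.eventually_lt_const (by positivity : 0 < ε / 3),
    Metric.closedBall_mem_nhds (0 : H) zero_lt_one] with f hf₁ hf₂
  have h₁ : dist (weylOp b f x) (weylOp b f (trunc N x)) = dist (emb (trunc N x)) (emb x) := by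
    rw [dist_eq_norm, ← weylOp_sub, norm_weylOp, map_sub, dist_comm, dist_eq_norm]
  have h₂ : dist (weylOp b f (trunc N x)) (emb (trunc N x)) < ε / 3 := by
    rw [dist_eq_norm, (finPart_trunc N x).weylOp_eq]
    exact (hC f (by simpa using hf₂)).trans_lt hf₁
  calc dist (weylOp b f x) (emb x)
      ≤ dist (weylOp b f x) (weylOp b f (trunc N x)) +
        dist (weylOp b f (trunc N x)) (emb (trunc N x)) + dist (emb (trunc N x)) (emb x) :=
        dist_triangle4 _ _ _ _
    _ < ε := by rw [h₁]; linarith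

/-- Strong continuity of the Weyl operators on isotropic subspaces. -/
theorem continuous_weylOp (ℒ : Submodule ℝ H) (hiso : ∀ φ ∈ ℒ, ∀ ψ ∈ ℒ, sympl φ ψ = 0)
    (x : schwartz ι) : Continuous fun φ : ℒ => weylOp b (φ : H) x := by
  rw [continuous_iff_continuousAt]
  intro φ
  -- The group law reduces continuity at `φ` to weak continuity at `0`.
  have hd : ∀ ψ : ℒ, ‖weylOp b (ψ : H) x - weylOp b (φ : H) x‖ ^ 2 =
      2 * ‖emb x‖ ^ 2 - 2 * (⟪emb x, weylOp b ((φ : H) - ψ) x⟫_ℂ).re := by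
    intro ψ
    rw [@norm_sub_sq ℂ, norm_weylOp, norm_weylOp, inner_weylOp b (hiso ψ ψ.2 φ φ.2)]
    change _ - 2 * (⟪emb x, weylOp b ((φ : H) - ψ) x⟫_ℂ).re + _ = _
    ring
  have h0 : Tendsto (fun ψ : ℒ => (φ : H) - ψ) (𝓝 φ) (𝓝 0) := by
    have : Tendsto (fun ψ : ℒ => (φ : H) - ψ) (𝓝 φ) (𝓝 ((φ : H) - φ)) :=
      Continuous.tendsto (by fun_prop) φ
    simpa using this
  have h₁ := (tendsto_weylOp_zero b x).comp h0
  have h₂ : Tendsto (fun ψ : ℒ => ‖weylOp b (ψ : H) x - weylOp b (φ : H) x‖ ^ 2) (𝓝 φ) (𝓝 0) := by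
    simp only [hd]
    have h₃ := (Complex.continuous_re.tendsto _).comp
      ((tendsto_const_nhds (x := emb x)).inner (𝕜 := ℂ) h₁)
    have h₄ := (h₃.const_mul 2).const_sub (2 * ‖emb x‖ ^ 2)
    have e : (⟪emb x, emb x⟫_ℂ).re = ‖emb x‖ ^ 2 := inner_self_eq_norm_sq (𝕜 := ℂ) (emb x)
    rw [e, sub_self] at h₄
    exact h₄
  rw [ContinuousAt, tendsto_iff_norm_sub_tendsto_zero]
  simpa [Real.sqrt_sq] using h₂.sqrt

end Weyl

/-! ### The physical inner product -/

section Physical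

variable {ι H : Type*} [NormedAddCommGroup H] [InnerProductSpace ℂ H] (b : HilbertBasis ι ℂ H)

/-! ### Decay and integrability along `ℒ`. -/

theorem exists_norm_le_sum_inner (ℒ : Submodule ℝ H) [FiniteDimensional ℝ ℒ] :
    ∃ (n : ℕ) (e : Fin n → ℒ), ∀ φ : ℒ, ‖φ‖ ≤ ∑ j, ‖⟪(e j : H), (φ : H)⟫_ℂ‖ := by
  let : InnerProductSpace ℝ H := InnerProductSpace.complexToReal
  let e := stdOrthonormalBasis ℝ ℒ
  refine ⟨_, e, fun φ => ?_⟩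
  calc ‖φ‖ = ‖∑ j, ⟪e j, φ⟫_ℝ • e j‖ := by rw [e.sum_repr']
    _ ≤ ∑ j, ‖⟪e j, φ⟫_ℝ • e j‖ := norm_sum_le _ _
    _ ≤ _ := by
      refine Finset.sum_le_sum fun j _ => ?_
      rw [norm_smul, e.norm_eq_one, mul_one]
      exact Complex.abs_re_le_norm _

/-- Matrix elements of the Weyl operators decay rapidly along `ℒ`. -/
theorem exists_pow_mul_norm_inner_weylOp_le (ℒ : Submodule ℝ H) [FiniteDimensional ℝ ℒ] (m : ℕ)
    (x y : schwartz ι) :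
    ∃ C : ℝ, ∀ φ : ℒ, ‖φ‖ ^ m * ‖⟪emb x, weylOp b (φ : H) y⟫_ℂ‖ ≤ C := by
  obtain ⟨n, e, he⟩ := exists_norm_le_sum_inner ℒ
  induction m generalizing x y with
  | zero =>
    refine ⟨‖emb x‖ * ‖emb y‖, fun φ => ?_⟩
    rw [pow_zero, one_mul, ← norm_weylOp b (φ : H) y]
    exact norm_inner_le_norm _ _
  | succ m ih =>
    choose C hC using ih
    refine ⟨∑ j, (C (cr b (e j : H) x) y + C x (an b (e j : H) y)), fun φ => ?_⟩
    set k := ⟪emb x, weylOp b (φ : H) y⟫_ℂ with hk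
    have h₁ : ∀ j, ‖φ‖ ^ m * (‖⟪(e j : H), (φ : H)⟫_ℂ‖ * ‖k‖) ≤
        C (cr b (e j : H) x) y + C x (an b (e j : H) y) := by
      intro j
      -- The intertwining relation trades a factor `(eⱼ, φ)` for operators acting on `x` and `y`;
      -- since these preserve `S`, induction gives every power.
      have h₂ := inner_cr_weylOp b (φ : H) (e j : H) x y
      rw [← norm_mul, ← sub_eq_iff_eq_add'.2 h₂]
      have h₃ := mul_le_mul_of_nonneg_left (norm_sub_le ⟪emb (cr b (e j : H) x), weylOp b (φ : H) y⟫_ℂ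
        ⟪emb x, weylOp b (φ : H) (an b (e j : H) y)⟫_ℂ) (by positivity : 0 ≤ ‖φ‖ ^ m)
      rw [mul_add] at h₃
      exact h₃.trans (add_le_add (hC _ _ φ) (hC _ _ φ))
    calc ‖φ‖ ^ (m + 1) * ‖k‖ = ‖φ‖ ^ m * (‖φ‖ * ‖k‖) := by ring
      _ ≤ ‖φ‖ ^ m * ((∑ j, ‖⟪(e j : H), (φ : H)⟫_ℂ‖) * ‖k‖) := by
        gcongr
        exact he φ
      _ = ∑ j, ‖φ‖ ^ m * (‖⟪(e j : H), (φ : H)⟫_ℂ‖ * ‖k‖) := by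
        rw [Finset.sum_mul, Finset.mul_sum]
      _ ≤ _ := Finset.sum_le_sum fun j _ => h₁ j

theorem integrable_of_decay {E F : Type*} [NormedAddCommGroup E] [NormedSpace ℝ E]
    [FiniteDimensional ℝ E] [MeasurableSpace E] [BorelSpace E] (μ : Measure E)
    [μ.IsAddHaarMeasure] [NormedAddCommGroup F] {f : E → F} (hf : Continuous f)
    (h : ∀ m : ℕ, ∃ C : ℝ, ∀ x, ‖x‖ ^ (2 * m) * ‖f x‖ ≤ C) : Integrable f μ := by
  set d := Module.finrank ℝ E with hd
  obtain ⟨C₀, h₀⟩ := h 0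
  obtain ⟨C₁, h₁⟩ := h (d + 1)
  -- The exponent `2(d + 1)` is even, to match the hypothesis, and exceeds the dimension `d`.
  have hi : Integrable (fun x : E => (1 + ‖x‖) ^ (-((2 * (d + 1) : ℕ) : ℝ))) μ := by
    refine integrable_one_add_norm ?_
    rw [← hd]
    push_cast
    linarith [d.cast_nonneg (α := ℝ)]
  refine (hi.const_mul (2 ^ (2 * (d + 1) - 1) * (C₀ + C₁))).mono' hf.aestronglyMeasurable
    (Eventually.of_forall fun x => ?_)
  have hp : 0 < (1 + ‖x‖) ^ (2 * (d + 1)) := by positivity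
  rw [Real.rpow_neg (by positivity), Real.rpow_natCast, ← div_eq_mul_inv, le_div_iff₀ hp]
  have h₂ := add_pow_le (zero_le_one' ℝ) (norm_nonneg x) (2 * (d + 1))
  have h₃ := mul_le_mul_of_nonneg_left h₂ (norm_nonneg (f x))
  refine h₃.trans ?_
  have h₄ := h₀ x
  have h₅ := h₁ x
  rw [mul_zero, pow_zero, one_mul] at h₄
  rw [one_pow]
  have h₆ : (0 : ℝ) < 2 ^ (2 * (d + 1) - 1) := by positivity
  calc ‖f x‖ * (2 ^ (2 * (d + 1) - 1) * (1 + ‖x‖ ^ (2 * (d + 1))))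
      = 2 ^ (2 * (d + 1) - 1) * (‖f x‖ + ‖x‖ ^ (2 * (d + 1)) * ‖f x‖) := by ring
    _ ≤ _ := by gcongr

theorem integrable_gaussian_norm {E : Type*} [NormedAddCommGroup E] [NormedSpace ℝ E]
    [FiniteDimensional ℝ E] [MeasurableSpace E] [BorelSpace E] (μ : Measure E)
    [μ.IsAddHaarMeasure] {s : ℝ} (hs : 0 < s) :
    Integrable (fun x : E => Real.exp (-s * ‖x‖ ^ 2)) μ := by
  refine integrable_of_decay μ (by fun_prop) fun m => ⟨m.factorial / s ^ m, fun x => ?_⟩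
  have h := Real.pow_div_factorial_le_exp (s * ‖x‖ ^ 2) (by positivity) m
  have hf : (0 : ℝ) < m.factorial := by exact_mod_cast m.factorial_pos
  rw [Real.norm_of_nonneg (Real.exp_pos _).le, neg_mul, Real.exp_neg, ← div_eq_mul_inv,
    div_le_div_iff₀ (Real.exp_pos _) (by positivity)]
  rw [div_le_iff₀ hf, mul_pow, ← pow_mul] at h
  linarith

theorem continuous_inner_weylOp {ℒ : Submodule ℝ H}
    (hiso : ∀ φ ∈ ℒ, ∀ ψ ∈ ℒ, sympl φ ψ = 0) (x y : schwartz ι) :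
    Continuous fun φ : ℒ => ⟪emb x, weylOp b (φ : H) y⟫_ℂ :=
  continuous_const.inner (continuous_weylOp b ℒ hiso y)

theorem inner_weylOp_neg {ℒ : Submodule ℝ H} (φ : ℒ) (x y : schwartz ι) :
    ⟪emb x, weylOp b ((-φ : ℒ) : H) y⟫_ℂ = starRingEnd ℂ ⟪emb y, weylOp b (φ : H) x⟫_ℂ := by
  have h := inner_weylOp b (f := (φ : H)) (g := 0) (by simp [sympl]) x y
  rw [weylOp_zero, zero_sub] at h
  rw [inner_conj_symm, h]
  rfl

/-- Completing the square, as the parallelogram law for `ψ - η/2` and `η/2`. -/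
theorem norm_sub_sq_add_norm_sq {ℒ : Submodule ℝ H} (ψ η : ℒ) :
    ‖ψ - η‖ ^ 2 + ‖ψ‖ ^ 2 = ‖η‖ ^ 2 / 2 + 2 * ‖ψ - (2⁻¹ : ℝ) • η‖ ^ 2 := by
  have e₀ : ((ψ - η : ℒ) : H) = (ψ - (2⁻¹ : ℝ) • η : ℒ) - ((2⁻¹ : ℝ) • η : ℒ) := by
    rw [← Submodule.coe_sub, sub_sub, ← add_smul]
    norm_num
  have e₁ : (ψ : H) = (ψ - (2⁻¹ : ℝ) • η : ℒ) + ((2⁻¹ : ℝ) • η : ℒ) := by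
    rw [← Submodule.coe_add, sub_add_cancel]
  have h := parallelogram_law_with_norm ℂ ((ψ - (2⁻¹ : ℝ) • η : ℒ) : H) ((2⁻¹ : ℝ) • η : ℒ)
  rw [← e₀, ← e₁] at h
  have h₂ : ‖(((2⁻¹ : ℝ) • η : ℒ) : H)‖ = 2⁻¹ * ‖η‖ := by
    rw [Submodule.coe_norm, Submodule.coe_smul, norm_smul]
    norm_num
  rw [h₂] at h
  simp only [Submodule.coe_norm] at h ⊢
  nlinarith

/-! ### Positivity, null vectors and adjoints for the integrated form. -/

section Haar

variable [MeasurableSpace H] {ℒ : Submodule ℝ H}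

/-- The physical inner product on `S`. -/
def phys (μ : Measure ℒ) (x y : schwartz ι) : ℂ := ∫ φ : ℒ, ⟪emb x, weylOp b (φ : H) y⟫_ℂ ∂μ

theorem integrable_inner_weylOp [BorelSpace H] [FiniteDimensional ℝ ℒ]
    (hiso : ∀ φ ∈ ℒ, ∀ ψ ∈ ℒ, sympl φ ψ = 0) (μ : Measure ℒ) [μ.IsAddHaarMeasure]
    (x y : schwartz ι) : Integrable (fun φ : ℒ => ⟪emb x, weylOp b (φ : H) y⟫_ℂ) μ :=
  integrable_of_decay μ (continuous_inner_weylOp b hiso x y)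
    fun m => exists_pow_mul_norm_inner_weylOp_le b ℒ (2 * m) x y

theorem phys_conj_symm [BorelSpace H] [FiniteDimensional ℝ ℒ] (μ : Measure ℒ) [μ.IsAddHaarMeasure]
    (x y : schwartz ι) : phys b μ x y = starRingEnd ℂ (phys b μ y x) := by
  rw [phys, phys, ← integral_neg_eq_self, ← integral_conj]
  exact integral_congr_ae (Eventually.of_forall fun φ => inner_weylOp_neg b φ x y)

/-- The squared norm of the smeared vector `∫ g(φ) W(φ) x dμ`, with `W` the Weyl operators and `g` a
Gaussian, is a double integral of `g(ψ) g(φ) κ(φ - ψ)`. Translating `φ` by `ψ` and completing the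
square factors it as a positive constant times the weighted integral, so the latter has nonnegative
real part. -/
theorem phys_weighted_nonneg [BorelSpace H] [FiniteDimensional ℝ ℒ]
    (hiso : ∀ φ ∈ ℒ, ∀ ψ ∈ ℒ, sympl φ ψ = 0) (μ : Measure ℒ) [μ.IsAddHaarMeasure]
    (x : schwartz ι) {s : ℝ} (hs : 0 < s) :
    0 ≤ (∫ η : ℒ, (Real.exp (-s * (‖η‖ ^ 2 / 2)) : ℂ) * ⟪emb x, weylOp b (η : H) x⟫_ℂ ∂μ).re := by
  set g : ℒ → ℝ := fun φ => Real.exp (-s * ‖φ‖ ^ 2) with hg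
  have hgc : Continuous g := by fun_prop
  have hgi : Integrable g μ := integrable_gaussian_norm μ hs
  have hgC : Integrable (fun φ => (g φ : ℂ)) μ := hgi.ofReal
  set κ : ℒ → ℂ := fun φ => ⟪emb x, weylOp b (φ : H) x⟫_ℂ with hκ
  have hκc : Continuous κ := continuous_inner_weylOp b hiso x x
  have hκi : Integrable κ μ := integrable_inner_weylOp b hiso μ x x
  have hWc := continuous_weylOp b ℒ hiso x
  have hWi : Integrable (fun φ : ℒ => (g φ : ℂ) • weylOp b (φ : H) x) μ := by
    refine (hgi.mul_const ‖emb x‖).mono' ?_ (Eventually.of_forall fun φ => ?_)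
    · exact ((Complex.continuous_ofReal.comp hgc).smul hWc).aestronglyMeasurable
    · rw [norm_smul, norm_weylOp, Complex.norm_real, Real.norm_of_nonneg (Real.exp_pos _).le]
  set v := ∫ φ : ℒ, (g φ : ℂ) • weylOp b (φ : H) x ∂μ with hv
  have h₁ : ⟪v, v⟫_ℂ = ∫ ψ : ℒ, ∫ φ : ℒ, (g ψ : ℂ) * (g φ * κ (φ - ψ)) ∂μ ∂μ := by
    nth_rw 1 [hv]
    have e₁ : ∀ ψ : ℒ, ⟪(g ψ : ℂ) • weylOp b (ψ : H) x, v⟫_ℂ =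
        ∫ φ : ℒ, (g ψ : ℂ) * (g φ * κ (φ - ψ)) ∂μ := by
      intro ψ
      rw [hv, ← integral_inner hWi]
      refine integral_congr_ae (Eventually.of_forall fun φ => ?_)
      simp only
      rw [inner_smul_left, inner_smul_right, inner_weylOp b (hiso ψ ψ.2 φ φ.2),
        Complex.conj_ofReal]
      rfl
    rw [← inner_conj_symm, ← integral_inner hWi, ← integral_conj]
    refine integral_congr_ae (Eventually.of_forall fun ψ => ?_)
    simp only [inner_conj_symm]
    exact e₁ ψ
  have h₂ : ∀ ψ : ℒ, ∫ φ : ℒ, (g ψ : ℂ) * (g φ * κ (φ - ψ)) ∂μ =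
      ∫ η : ℒ, (g ψ : ℂ) * (g (η + ψ) * κ η) ∂μ := by
    intro ψ
    rw [← integral_add_right_eq_self (fun φ : ℒ => (g ψ : ℂ) * (g φ * κ (φ - ψ))) ψ]
    simp only [add_sub_cancel_right]
  simp only [h₂] at h₁
  -- Only one Gaussian is needed for the bound: `g(η + ψ) ≤ 1`, while `g` is integrable in `ψ` and
  -- `κ` in `η`.
  have hinteg : Integrable (Function.uncurry fun ψ η : ℒ => (g ψ : ℂ) * (g (η + ψ) * κ η))
      (μ.prod μ) := by
    refine (hgi.mul_prod hκi.norm).mono' ?_ (Eventually.of_forall fun z => ?_)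
    · refine Continuous.aestronglyMeasurable ?_
      simp only [Function.uncurry_def]
      fun_prop
    · simp only [Function.uncurry_def, norm_mul, Complex.norm_real]
      rw [Real.norm_of_nonneg (Real.exp_pos _).le, Real.norm_of_nonneg (Real.exp_pos _).le]
      have hle : g (z.2 + z.1) ≤ 1 := by
        rw [hg, Real.exp_le_one_iff]
        have : 0 ≤ s * ‖z.2 + z.1‖ ^ 2 := by positivity
        linarith
      refine mul_le_mul_of_nonneg_left ?_ (Real.exp_pos _).le
      exact mul_le_of_le_one_left (norm_nonneg _) hle
  rw [integral_integral_swap hinteg] at h₁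
  set c : ℝ := ∫ ψ : ℒ, Real.exp (-(2 * s) * ‖ψ‖ ^ 2) ∂μ with hc
  have hcpos : 0 < c := integral_exp_pos (integrable_gaussian_norm μ (by positivity))
  have h₃ : ∀ η : ℒ, ∫ ψ : ℒ, (g ψ : ℂ) * (g (η + ψ) * κ η) ∂μ =
      c * ((Real.exp (-s * (‖η‖ ^ 2 / 2)) : ℂ) * κ η) := by
    intro η
    have e : ∀ ψ : ℒ, (g ψ : ℂ) * (g (η + ψ) * κ η) =
        ((Real.exp (-(2 * s) * ‖ψ - (2⁻¹ : ℝ) • (-η)‖ ^ 2) : ℝ) : ℂ) *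
          ((Real.exp (-s * (‖η‖ ^ 2 / 2)) : ℂ) * κ η) := by
      intro ψ
      rw [← mul_assoc, ← mul_assoc, ← Complex.ofReal_mul, ← Complex.ofReal_mul, hg]
      simp only
      rw [← Real.exp_add, ← Real.exp_add]
      have h := norm_sub_sq_add_norm_sq ψ (-η)
      rw [sub_neg_eq_add, norm_neg] at h
      rw [add_comm η ψ]
      congr 3
      linear_combination (-s) * h
    simp only [e]
    rw [integral_mul_const, integral_complex_ofReal, integral_sub_right_eq_self
      (fun ψ : ℒ => Real.exp (-(2 * s) * ‖ψ‖ ^ 2))]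
  simp only [h₃] at h₁
  rw [integral_const_mul] at h₁
  have h₄ : 0 ≤ (⟪v, v⟫_ℂ).re := inner_self_nonneg (𝕜 := ℂ)
  rw [h₁, Complex.re_ofReal_mul] at h₄
  exact nonneg_of_mul_nonneg_right h₄ hcpos

/-- The Gaussian weight is removed by letting its exponent tend to zero under dominated convergence.
-/
theorem phys_self_nonneg [BorelSpace H] [FiniteDimensional ℝ ℒ]
    (hiso : ∀ φ ∈ ℒ, ∀ ψ ∈ ℒ, sympl φ ψ = 0) (μ : Measure ℒ) [μ.IsAddHaarMeasure]
    (x : schwartz ι) : 0 ≤ (phys b μ x x).re := by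
  have hκi := integrable_inner_weylOp b hiso μ x x
  have hκc := continuous_inner_weylOp b hiso x x
  have hlim : Tendsto (fun n : ℕ => ∫ η : ℒ, (Real.exp (-(1 / ((n : ℝ) + 1)) * (‖η‖ ^ 2 / 2)) : ℂ) *
      ⟪emb x, weylOp b (η : H) x⟫_ℂ ∂μ) atTop (𝓝 (phys b μ x x)) := by
    refine tendsto_integral_of_dominated_convergence _ (fun n => ?_) hκi.norm (fun n => ?_) ?_
    · exact (Continuous.mul (by fun_prop) hκc).aestronglyMeasurable
    · refine Eventually.of_forall fun η => ?_
      rw [norm_mul, Complex.norm_real, Real.norm_of_nonneg (Real.exp_pos _).le]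
      refine mul_le_of_le_one_left (norm_nonneg _) ?_
      rw [Real.exp_le_one_iff]
      have : 0 ≤ 1 / ((n : ℝ) + 1) * (‖η‖ ^ 2 / 2) := by positivity
      linarith
    · refine Eventually.of_forall fun η => ?_
      have h₁ : Tendsto (fun n : ℕ => 1 / ((n : ℝ) + 1)) atTop (𝓝 0) :=
        tendsto_one_div_add_atTop_nhds_zero_nat
      have hc : Continuous fun t : ℝ => (Real.exp (-t * (‖η‖ ^ 2 / 2)) : ℂ) *
          ⟪emb x, weylOp b (η : H) x⟫_ℂ := by fun_prop
      simpa [Function.comp_def] using (hc.tendsto 0).comp h₁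
  exact ge_of_tendsto' ((Complex.continuous_re.tendsto _).comp hlim)
    fun n => phys_weighted_nonneg b hiso μ x (by positivity)

/-- Null vectors are orthogonal to `S` in the physical inner product. -/
theorem phys_eq_zero_of_null [BorelSpace H] [FiniteDimensional ℝ ℒ]
    (hiso : ∀ φ ∈ ℒ, ∀ ψ ∈ ℒ, sympl φ ψ = 0) (μ : Measure ℒ) [μ.IsAddHaarMeasure]
    {x : schwartz ι} (hx : phys b μ x x = 0) (y : schwartz ι) : phys b μ y x = 0 := by
  have hi := integrable_inner_weylOp b hiso μ
  -- Since `⟨x, x⟩ = 0` there is no quadratic term in `t`; an affine function that is nonnegative in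
  -- all directions has no linear part.
  have hexp : ∀ t : ℂ, phys b μ (y + t • x) (y + t • x) =
      phys b μ y y + t * phys b μ y x + starRingEnd ℂ t * phys b μ x y := by
    intro t
    have e : ∀ φ : ℒ, ⟪emb (y + t • x), weylOp b (φ : H) (y + t • x)⟫_ℂ =
        ⟪emb y, weylOp b (φ : H) y⟫_ℂ + t * ⟪emb y, weylOp b (φ : H) x⟫_ℂ +
          starRingEnd ℂ t * ⟪emb x, weylOp b (φ : H) y⟫_ℂ +
          starRingEnd ℂ t * t * ⟪emb x, weylOp b (φ : H) x⟫_ℂ := by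
      intro φ
      rw [weylOp_add, weylOp_smul, map_add, map_smul]
      simp only [inner_add_left, inner_add_right, inner_smul_left, inner_smul_right]
      ring
    rw [phys]
    simp only [e]
    have i₁ : Integrable (fun φ : ℒ => ⟪emb y, weylOp b (φ : H) y⟫_ℂ +
        t * ⟪emb y, weylOp b (φ : H) x⟫_ℂ) μ := (hi y y).add ((hi y x).const_mul t)
    have i₂ : Integrable (fun φ : ℒ => ⟪emb y, weylOp b (φ : H) y⟫_ℂ +
        t * ⟪emb y, weylOp b (φ : H) x⟫_ℂ + starRingEnd ℂ t * ⟪emb x, weylOp b (φ : H) y⟫_ℂ) μ :=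
      i₁.add ((hi x y).const_mul _)
    rw [integral_add i₂ ((hi x x).const_mul _), integral_add i₁ ((hi x y).const_mul _),
      integral_add (hi y y) ((hi y x).const_mul t), integral_const_mul, integral_const_mul,
      integral_const_mul]
    change phys b μ y y + t * phys b μ y x + starRingEnd ℂ t * phys b μ x y +
      starRingEnd ℂ t * t * phys b μ x x = _
    rw [hx, mul_zero, add_zero]
  set a := phys b μ y x with ha
  have hpos : ∀ r : ℝ, 0 ≤ (phys b μ y y).re - 2 * r * Complex.normSq a := by
    intro r
    have h := phys_self_nonneg b hiso μ (y + (-(r : ℂ) * starRingEnd ℂ a) • x)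
    rw [hexp, phys_conj_symm b μ x y, ← ha] at h
    refine h.trans (le_of_eq ?_)
    rw [Complex.normSq_apply]
    simp
    ring
  by_contra hne
  have hpos' : 0 < Complex.normSq a := Complex.normSq_pos.2 hne
  -- This `r` makes the right side of `hpos` equal to `-1`.
  have h := hpos (((phys b μ y y).re + 1) / (2 * Complex.normSq a))
  have e : 2 * (((phys b μ y y).re + 1) / (2 * Complex.normSq a)) * Complex.normSq a =
      (phys b μ y y).re + 1 := by
    field_simp
  linarith

/-- The operator `a⁻[v] - a⁺[M v]`, which annihilates the Gaussian vector. -/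
def gaussAn (M : H →L⋆[ℂ] H) (v : H) : Module.End ℂ (schwartz ι) := an b v - cr b (M v)

/-- The adjoint of `gaussAn`. -/
def gaussCr (M : H →L⋆[ℂ] H) (v : H) : Module.End ℂ (schwartz ι) := cr b v - an b (M v)

/-- Moving `a⁻[v]` and `a⁺[M v]` through the Weyl operator of `φ` leaves the scalars `(v, φ)` and
`(φ, M v) = (v, M φ)`. Admissibility is exactly their cancellation on `ℒ`. -/
theorem phys_gaussAn (μ : Measure ℒ) {M : H →L⋆[ℂ] H} (hs : IsSymmKernel M) {v : H}
    (hv : IsAdmissible M ℒ v) (x y : schwartz ι) :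
    phys b μ x (gaussAn b M v y) = phys b μ (gaussCr b M v x) y := by
  refine integral_congr_ae (Eventually.of_forall fun φ => ?_)
  have h₁ := inner_cr_weylOp b (φ : H) v x y
  have h₂ := inner_an_weylOp b (φ : H) (M v) x y
  have h₃ := hv φ φ.2
  rw [inner_sub_right, hs] at h₃
  simp only [gaussAn, gaussCr, LinearMap.sub_apply, map_sub, inner_sub_left, weylOp_sub,
    inner_sub_right]
  linear_combination h₂ - h₁ - h₃ * ⟪emb x, weylOp b (φ : H) y⟫_ℂ

theorem phys_smul_right (μ : Measure ℒ) (c : ℂ) (x y : schwartz ι) :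
    phys b μ x (c • y) = c * phys b μ x y := by
  rw [phys, phys, ← integral_const_mul]
  simp only [weylOp_smul, inner_smul_right]

end Haar

end Physical

/-! ### Pair creation, pair annihilation and the Gaussian vector -/

section Pairs

variable {ι H : Type*} [NormedAddCommGroup H] [InnerProductSpace ℂ H] (b : HilbertBasis ι ℂ H)

theorem hasSum_creation (f : H) (Ψ : Family ι) (n : ℕ) (i : Fin n → ι) :
    HasSum (fun q => ⟪b q, f⟫_ℂ * creation b (b q) Ψ n i) (creation b f Ψ n i) := by
  classical
  cases n with
  | zero => simpa only [creation_zero, mul_zero] using hasSum_zero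
  | succ n =>
    have h : ∀ j ∈ Finset.univ, HasSum (fun q => ⟪b q, f⟫_ℂ * (⟪b (i j), b q⟫_ℂ *
        Ψ n (fun l => i (j.succAbove l)))) (⟪b (i j), f⟫_ℂ * Ψ n (fun l => i (j.succAbove l))) := by
      intro j _
      have h := hasSum_single (f := fun q => ⟪b q, f⟫_ℂ * (⟪b (i j), b q⟫_ℂ *
        Ψ n (fun l => i (j.succAbove l)))) (i j) (fun q hq => by
          rw [inner_basis b, if_neg (Ne.symm hq)]
          simp)
      have e : ⟪b (i j), b (i j)⟫_ℂ = 1 := by rw [inner_basis b, if_pos rfl]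
      simp only [e, one_mul] at h
      exact h
    have h₂ := (hasSum_sum h).mul_left (((√(n + 1 : ℝ))⁻¹ : ℝ) : ℂ)
    rw [creation_succ]
    refine h₂.congr_fun fun q => ?_
    rw [creation_succ, mul_left_comm, Finset.mul_sum]

/-- At a fixed entry `i` the outer creation operator in slot `j` forces its basis index to be `i j`,
and the inner sum assembles into `a⁺[M b_{i j}]`. The identity holds entrywise, without any
summability of `Ψ`. -/
theorem hasSum_createPair_succ {M : H →L⋆[ℂ] H} (hs : IsSymmKernel M) (Ψ : Family ι) (n : ℕ)
    (i : Fin (n + 1) → ι) :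
    HasSum (fun x : ι × ι => ⟪b x.1, M (b x.2)⟫_ℂ *
        creation b (b x.1) (creation b (b x.2) Ψ) (n + 1) i)
      (((√(n + 1 : ℝ))⁻¹ : ℝ) * ∑ j, creation b (M (b (i j))) Ψ n fun l => i (j.succAbove l)) := by
  classical
  have h : ∀ j ∈ Finset.univ, HasSum (fun x : ι × ι => ⟪b x.1, M (b x.2)⟫_ℂ *
      (⟪b (i j), b x.1⟫_ℂ * creation b (b x.2) Ψ n fun l => i (j.succAbove l)))
      (creation b (M (b (i j))) Ψ n fun l => i (j.succAbove l)) := by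
    intro j _
    rw [← (Prod.mk_right_injective (i j)).hasSum_iff]
    · refine (hasSum_creation b (M (b (i j))) Ψ n _).congr_fun fun q => ?_
      simp only [Function.comp_apply]
      rw [inner_basis b, if_pos rfl, one_mul, hs]
    · rintro ⟨p, q⟩ hx
      have : i j ≠ p := by
        rintro rfl
        exact hx ⟨q, rfl⟩
      rw [inner_basis b, if_neg this]
      simp
  refine ((hasSum_sum h).mul_left (((√(n + 1 : ℝ))⁻¹ : ℝ) : ℂ)).congr_fun fun x => ?_
  rw [creation_succ, mul_left_comm, Finset.mul_sum]

theorem createPair_succ {M : H →L⋆[ℂ] H} (hs : IsSymmKernel M) (Ψ : Family ι) (n : ℕ)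
    (i : Fin (n + 1) → ι) : createPair b M Ψ (n + 1) i =
      ((√(n + 1 : ℝ))⁻¹ : ℝ) * ∑ j, creation b (M (b (i j))) Ψ n fun l => i (j.succAbove l) :=
  (hasSum_createPair_succ b hs Ψ n i).tsum_eq

theorem createPair_zero (M : H →L⋆[ℂ] H) (Ψ : Family ι) (i : Fin 0 → ι) :
    createPair b M Ψ 0 i = 0 := by
  simp [createPair, creation_zero]

theorem hasSum_createPair {M : H →L⋆[ℂ] H} (hs : IsSymmKernel M) (Ψ : Family ι) (n : ℕ)
    (i : Fin n → ι) :
    HasSum (fun x : ι × ι => ⟪b x.1, M (b x.2)⟫_ℂ *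
        creation b (b x.1) (creation b (b x.2) Ψ) n i) (createPair b M Ψ n i) := by
  cases n with
  | zero =>
    rw [createPair_zero]
    simpa only [creation_zero, mul_zero] using hasSum_zero
  | succ n =>
    rw [createPair_succ b hs]
    exact hasSum_createPair_succ b hs Ψ n i

theorem createPair_smul (M : H →L⋆[ℂ] H) (c : ℂ) (Ψ : Family ι) :
    createPair b M (c • Ψ) = c • createPair b M Ψ := by
  funext n i
  simp only [createPair, creation_smul, Pi.smul_apply, smul_eq_mul, mul_left_comm _ c,
    tsum_mul_left]

theorem createPair_creation {M : H →L⋆[ℂ] H} (hs : IsSymmKernel M) (f : H) (Ψ : Family ι) :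
    createPair b M (creation b f Ψ) = creation b f (createPair b M Ψ) := by
  funext n i
  refine (hasSum_createPair b hs _ n i).unique ?_
  have e : ∀ x : ι × ι, creation b (b x.1) (creation b (b x.2) (creation b f Ψ)) =
      creation b f (creation b (b x.1) (creation b (b x.2) Ψ)) := by
    intro x
    rw [creation_comm b (b x.2) f, creation_comm b (b x.1) f]
  simp only [e]
  cases n with
  | zero => simpa only [creation_zero, mul_zero] using hasSum_zero
  | succ n =>
    rw [creation_succ]
    have h := (hasSum_sum (s := Finset.univ) fun (j : Fin (n + 1)) _ =>
      (hasSum_createPair b hs Ψ n fun l => i (j.succAbove l)).mul_left ⟪b (i j), f⟫_ℂ).mul_left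
        (((√(n + 1 : ℝ))⁻¹ : ℝ) : ℂ)
    refine h.congr_fun fun x => ?_
    rw [creation_succ, mul_left_comm, Finset.mul_sum]
    simp only [mul_left_comm]

theorem SqSum.sum {α κ : Type*} (s : Finset κ) {F : κ → α → ℂ} (h : ∀ j ∈ s, SqSum (F j)) :
    SqSum fun a => ∑ j ∈ s, F j a := by
  classical
  induction s using Finset.induction_on with
  | empty => exact sqSum_zero
  | insert j s hj ih =>
    simp only [Finset.sum_insert hj]
    exact (h j (Finset.mem_insert_self _ _)).add (ih fun k hk => h k (Finset.mem_insert_of_mem hk))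

theorem SectorSq.createPair {M : H →L⋆[ℂ] H} (hs : IsSymmKernel M)
    (hM : Summable fun p => ‖M (b p)‖ ^ 2) {Ψ : Family ι} (hΨ : SectorSq Ψ) :
    SectorSq (createPair b M Ψ) := by
  intro n
  cases n with
  | zero =>
    have : ConstrainedFock.createPair b M Ψ 0 = 0 := funext (createPair_zero b M Ψ)
    rw [this]
    exact sqSum_zero
  | succ n =>
    let F : ι × (Fin n → ι) → ℂ := fun x => ConstrainedFock.creation b (M (b x.1)) Ψ n x.2
    have hF : SqSum F := by
      refine sqSum_prod_of_fiberwise (fun q => hΨ.creation b (M (b q)) n) ?_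
      cases n with
      | zero =>
        refine summable_zero.congr fun q => ?_
        exact sqNorm_zero.symm
      | succ n =>
        refine Summable.of_nonneg_of_le (fun q => sqNorm_nonneg _)
          (fun q => (creation_sector b (M (b q)) (hΨ n)).2) ?_
        exact (hM.mul_left _).mul_right _
    have hG : ∀ j : Fin (n + 1), SqSum fun i : Fin (n + 1) → ι =>
        F (i j, fun l => i (j.succAbove l)) := by
      intro j
      rw [← sqSum_equiv (Fin.insertNthEquiv (fun _ => ι) j)]
      simpa using hF
    have h := (SqSum.sum Finset.univ fun j _ => hG j).smul (((√(n + 1 : ℝ))⁻¹ : ℝ) : ℂ)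
    convert h using 1
    funext i
    exact createPair_succ b hs Ψ n i

theorem hasSum_creation_conj {M : H →L⋆[ℂ] H} (hs : IsSymmKernel M) (x : H) (Ψ : Family ι) (n : ℕ)
    (i : Fin n → ι) :
    HasSum (fun p => ⟪x, b p⟫_ℂ * creation b (M (b p)) Ψ n i) (creation b (M x) Ψ n i) := by
  cases n with
  | zero => simpa only [creation_zero, mul_zero] using hasSum_zero
  | succ n =>
    have h : ∀ j ∈ Finset.univ, HasSum (fun p => ⟪x, b p⟫_ℂ * ⟪b p, M (b (i j))⟫_ℂ *
        Ψ n (fun l => i (j.succAbove l)))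
        (⟪b (i j), M x⟫_ℂ * Ψ n (fun l => i (j.succAbove l))) := by
      intro j _
      rw [hs]
      exact (b.hasSum_inner_mul_inner x (M (b (i j)))).mul_right _
    rw [creation_succ]
    refine ((hasSum_sum h).mul_left (((√(n + 1 : ℝ))⁻¹ : ℝ) : ℂ)).congr_fun fun p => ?_
    rw [creation_succ, mul_left_comm, Finset.mul_sum]
    simp only [mul_assoc, hs (b p)]

/-- The factor `2` comes from the two creation operators of a pair: `a⁻[x]` contracts either the
outer slot, through `hasSum_creation_conj`, or the inner one, through the commutation relation. -/
theorem annihilation_createPair {M : H →L⋆[ℂ] H} (hs : IsSymmKernel M)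
    (x : H) {Ψ : Family ι} (hΨ : SectorSq Ψ) :
    annihilation b x (createPair b M Ψ) =
      createPair b M (annihilation b x Ψ) + (2 : ℂ) • creation b (M x) Ψ := by
  funext n i
  have hne := sqrt_succ_ne_zero n
  have e : ∀ p, ⟪x, b p⟫_ℂ * createPair b M Ψ (n + 1) (Fin.cons p i) =
      ((√(n + 1 : ℝ))⁻¹ : ℝ) * (⟪x, b p⟫_ℂ * creation b (M (b p)) Ψ n i + ∑ j : Fin n,
        ⟪x, b p⟫_ℂ * creation b (M (b (i j))) Ψ n fun l =>
          (Fin.cons p i : Fin (n + 1) → ι) (j.succ.succAbove l)) := by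
    intro p
    rw [createPair_succ b hs, Fin.sum_univ_succ, mul_left_comm, mul_add, Finset.mul_sum]
    simp
  rw [annihilation_apply]
  simp only [e, tsum_mul_left]
  have h₁ := hasSum_creation_conj b hs x Ψ n i
  simp only [Pi.add_apply, Pi.smul_apply, smul_eq_mul]
  cases n with
  | zero =>
    simp [creation_zero, createPair_zero]
  | succ n =>
    simp only [cons_comp_succ_succAbove]
    have hsj : ∀ j ∈ Finset.univ, Summable fun p => ⟪x, b p⟫_ℂ *
        creation b (M (b (i j))) Ψ (n + 1) (Fin.cons p fun l => i (j.succAbove l)) := fun j _ =>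
      summable_annihilation b x (hΨ.creation b (M (b (i j)))) n fun l => i (j.succAbove l)
    rw [h₁.summable.tsum_add (summable_sum hsj), h₁.tsum_eq, Summable.tsum_finsetSum hsj]
    have hne' := sqrt_succ_ne_zero n
    have hj : ∀ j, ∑' p, ⟪x, b p⟫_ℂ *
        creation b (M (b (i j))) Ψ (n + 1) (Fin.cons p fun l => i (j.succAbove l)) =
        ((√(n + 1 : ℝ))⁻¹ : ℝ) * (creation b (M (b (i j))) (annihilation b x Ψ) n
          (fun l => i (j.succAbove l)) + ⟪b (i j), M x⟫_ℂ * Ψ n fun l => i (j.succAbove l)) := by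
      intro j
      have h := congrFun (congrFun (annihilation_creation b x (M (b (i j))) hΨ) n)
        fun l => i (j.succAbove l)
      rw [annihilation_apply, hs x] at h
      simp only [Pi.add_apply, Pi.smul_apply, smul_eq_mul] at h
      rw [← h]
      push_cast
      field_simp
    have hsum : ∑ j : Fin (n + 1), ((√(n + 1 : ℝ))⁻¹ : ℝ) * (creation b (M (b (i j)))
          (annihilation b x Ψ) n (fun l => i (j.succAbove l)) +
          ⟪b (i j), M x⟫_ℂ * Ψ n fun l => i (j.succAbove l)) =
        createPair b M (annihilation b x Ψ) (n + 1) i + creation b (M x) Ψ (n + 1) i := by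
      rw [createPair_succ b hs, creation_succ, ← Finset.mul_sum, Finset.sum_add_distrib, mul_add]
    simp only [hj]
    rw [hsum]
    push_cast at hne ⊢
    field_simp
    ring

/-- The summands of the Gaussian vector. -/
def gaussTerm (M : H →L⋆[ℂ] H) (m : ℕ) : Family ι :=
  (fun Φ : Family ι => (1 / 2 : ℂ) • createPair b M Φ)^[m] vacuum

theorem gaussTerm_succ (M : H →L⋆[ℂ] H) (m : ℕ) :
    gaussTerm b M (m + 1) = (1 / 2 : ℂ) • createPair b M (gaussTerm b M m) :=
  Function.iterate_succ_apply' _ _ _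

theorem vacuum_succ (n : ℕ) : (vacuum : Family ι) (n + 1) = 0 := by
  funext i
  simp [vacuum]

theorem creation_succ_eq_zero (f : H) {Ψ : Family ι} {n : ℕ} (h : Ψ n = 0) :
    creation b f Ψ (n + 1) = 0 := by
  funext i
  rw [creation_succ, h]
  simp

theorem gaussTerm_eq_zero {M : H →L⋆[ℂ] H} (hs : IsSymmKernel M) {m n : ℕ} (h : n ≠ 2 * m) :
    gaussTerm b M m n = 0 := by
  induction m generalizing n with
  | zero =>
    obtain ⟨n, rfl⟩ : ∃ k, n = k + 1 := ⟨n - 1, by omega⟩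
    exact vacuum_succ n
  | succ m ih =>
    rw [gaussTerm_succ]
    funext i
    simp only [Pi.smul_apply, Pi.zero_apply, smul_eq_mul]
    match n, i with
    | 0, i => rw [createPair_zero, mul_zero]
    | 1, i => simp [createPair_succ b hs, creation_zero]
    | n + 2, i =>
      rw [createPair_succ b hs]
      have hz : ∀ f, creation b f (gaussTerm b M m) (n + 1) = 0 := fun f =>
        creation_succ_eq_zero b f (ih (by omega))
      simp [hz]

theorem sectorSq_vacuum : SectorSq (vacuum : Family ι) := by
  intro n
  cases n with
  | zero => exact (hasSum_fintype _).summable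
  | succ n =>
    rw [vacuum_succ]
    exact sqSum_zero

theorem sectorSq_gaussTerm {M : H →L⋆[ℂ] H} (hs : IsSymmKernel M)
    (hM : Summable fun p => ‖M (b p)‖ ^ 2) (m : ℕ) : SectorSq (gaussTerm b M m) := by
  induction m with
  | zero => exact sectorSq_vacuum
  | succ m ih =>
    rw [gaussTerm_succ]
    exact fun n => (ih.createPair b hs hM n).smul _

theorem annihilation_vacuum (x : H) : annihilation b x (vacuum : Family ι) = 0 := by
  funext n i
  rw [annihilation_apply, vacuum_succ]
  simp

/-- Each factor `½ a⁺Ma⁺` has commutator `a⁺[M x]` with `a⁻[x]`, and this commutes with the other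
factors; the vacuum ends the induction. -/
theorem annihilation_gaussTerm {M : H →L⋆[ℂ] H} (hs : IsSymmKernel M)
    (hM : Summable fun p => ‖M (b p)‖ ^ 2) (x : H) (m : ℕ) :
    annihilation b x (gaussTerm b M (m + 1)) =
      ((m + 1 : ℕ) : ℂ) • creation b (M x) (gaussTerm b M m) := by
  induction m with
  | zero =>
    rw [gaussTerm_succ, annihilation_smul,
      annihilation_createPair b hs x (sectorSq_gaussTerm b hs hM 0)]
    have h0 : annihilation b x (gaussTerm b M 0) = 0 := annihilation_vacuum b x
    have h1 : createPair b M (0 : Family ι) = 0 := by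
      simpa using createPair_smul b M 0 (0 : Family ι)
    rw [h0, h1, zero_add, smul_smul]
    norm_num
  | succ m ih =>
    rw [gaussTerm_succ b M (m + 1), annihilation_smul,
      annihilation_createPair b hs x (sectorSq_gaussTerm b hs hM (m + 1)), ih, createPair_smul,
      createPair_creation b hs, smul_add, smul_comm (1 / 2 : ℂ), ← creation_smul,
      ← gaussTerm_succ, smul_smul, ← add_smul]
    congr 1
    push_cast
    ring

/-- The `m`-th term lives in the sector `2m`. For odd `n` the index `n / 2` is only a default and
the term is zero. -/
theorem gaussian_apply {M : H →L⋆[ℂ] H} (hs : IsSymmKernel M) (n : ℕ) (i : Fin n → ι) :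
    gaussian b M n i = ((n / 2).factorial : ℂ)⁻¹ * gaussTerm b M (n / 2) n i := by
  refine tsum_eq_single (n / 2) fun m hm => ?_
  have h : gaussTerm b M m n = 0 := gaussTerm_eq_zero b hs (by omega)
  have h' : (fun Φ : Family ι => (1 / 2 : ℂ) • createPair b M Φ)^[m] vacuum n i = 0 :=
    congrFun h i
  rw [h', mul_zero]

/-- The operators `a⁻[x] - a⁺[M x]` annihilate the Gaussian vector. -/
theorem annihilation_gaussian {M : H →L⋆[ℂ] H} (hs : IsSymmKernel M)
    (hM : Summable fun p => ‖M (b p)‖ ^ 2) (x : H) :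
    annihilation b x (gaussian b M) = creation b (M x) (gaussian b M) := by
  funext n i
  have e : annihilation b x (gaussian b M) n i =
      (((n + 1) / 2).factorial : ℂ)⁻¹ * annihilation b x (gaussTerm b M ((n + 1) / 2)) n i := by
    simp only [annihilation_apply, gaussian_apply b hs, mul_left_comm _ ((Nat.factorial _ : ℂ)⁻¹),
      tsum_mul_left]
  rw [e]
  cases n with
  | zero =>
    have h0 : annihilation b x (gaussTerm b M 0) = 0 := annihilation_vacuum b x
    simp [h0, creation_zero]
  | succ n =>
    have hk : (n + 1 + 1) / 2 = n / 2 + 1 := by omega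
    rw [hk, annihilation_gaussTerm b hs hM]
    simp only [Pi.smul_apply, smul_eq_mul, creation_succ, gaussian_apply b hs,
      mul_left_comm _ ((Nat.factorial _ : ℂ)⁻¹), ← Finset.mul_sum]
    rw [Nat.factorial_succ]
    have hf : ((n / 2).factorial : ℂ) ≠ 0 := by exact_mod_cast (n / 2).factorial_ne_zero
    have hm : (((n / 2 : ℕ) : ℂ) + 1) ≠ 0 := by exact_mod_cast (n / 2).succ_ne_zero
    push_cast
    field_simp

end Pairs

/-! ### Pair annihilation -/

section AnnihilatePair

variable {ι H : Type*} [NormedAddCommGroup H] [InnerProductSpace ℂ H] (b : HilbertBasis ι ℂ H)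

theorem SectorSq.add {Ψ Φ : Family ι} (hΨ : SectorSq Ψ) (hΦ : SectorSq Φ) : SectorSq (Ψ + Φ) :=
  fun n => (hΨ n).add (hΦ n)

theorem SectorSq.sub {Ψ Φ : Family ι} (hΨ : SectorSq Ψ) (hΦ : SectorSq Φ) : SectorSq (Ψ - Φ) :=
  fun n => (hΨ n).sub (hΦ n)

theorem SectorSq.smul {Ψ : Family ι} (c : ℂ) (hΨ : SectorSq Ψ) : SectorSq (c • Ψ) :=
  fun n => (hΨ n).smul c

theorem annihilation_basis (p : ι) (Ψ : Family ι) (n : ℕ) (i : Fin n → ι) :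
    annihilation b (b p) Ψ n i = (√(n + 1 : ℝ) : ℝ) * Ψ (n + 1) (Fin.cons p i) := by
  rw [annihilation_apply, tsum_inner_basis_mul]

theorem annihilation_annihilation_basis (p q : ι) (Ψ : Family ι) (n : ℕ) (i : Fin n → ι) :
    annihilation b (b p) (annihilation b (b q) Ψ) n i =
      ((√(n + 1 : ℝ) : ℝ) * (√(n + 1 + 1 : ℝ) : ℝ) : ℂ) *
        Ψ (n + 2) (Fin.cons q (Fin.cons p i)) := by
  rw [annihilation_basis, annihilation_basis]
  push_cast
  ring

theorem sqSum_kernel {A : H →L⋆[ℂ] H} (hA : Summable fun p => ‖A (b p)‖ ^ 2) :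
    SqSum fun x : ι × ι => starRingEnd ℂ ⟪b x.1, A (b x.2)⟫_ℂ := by
  rw [← sqSum_equiv (Equiv.prodComm ι ι)]
  refine SqSum.conj (sqSum_prod_of_fiberwise (fun q => sqSum_coord b (A (b q))) ?_)
  exact hA.congr fun q => (sqNorm_coord b (A (b q))).symm

theorem cons_cons_injective (n : ℕ) : Function.Injective fun x : (ι × ι) × (Fin n → ι) =>
    (Fin.cons x.1.2 (Fin.cons x.1.1 x.2) : Fin (n + 2) → ι) := by
  rintro ⟨⟨p, q⟩, i⟩ ⟨⟨p', q'⟩, i'⟩ h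
  have h := Fin.cons_injective2 h
  have h' := Fin.cons_injective2 h.2
  exact Prod.ext (Prod.ext h'.1 h.1) h'.2

theorem sqSum_annihilation_basis {Ψ : Family ι} (hΨ : SectorSq Ψ) (n : ℕ) (i : Fin n → ι) :
    SqSum fun x : ι × ι => annihilation b (b x.1) (annihilation b (b x.2) Ψ) n i := by
  simp only [annihilation_annihilation_basis]
  exact (((hΨ (n + 2)).comp_injective (cons_cons_injective n)).fiber' i).smul _

theorem summable_annihilatePair {A : H →L⋆[ℂ] H} (hA : Summable fun p => ‖A (b p)‖ ^ 2)
    {Ψ : Family ι} (hΨ : SectorSq Ψ) (n : ℕ) (i : Fin n → ι) :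
    Summable fun x : ι × ι => starRingEnd ℂ ⟪b x.1, A (b x.2)⟫_ℂ *
      annihilation b (b x.1) (annihilation b (b x.2) Ψ) n i :=
  (sqSum_kernel b hA).summable_mul (sqSum_annihilation_basis b hΨ n i)

theorem SectorSq.annihilatePair {A : H →L⋆[ℂ] H} (hA : Summable fun p => ‖A (b p)‖ ^ 2)
    {Ψ : Family ι} (hΨ : SectorSq Ψ) : SectorSq (annihilatePair b A Ψ) := by
  intro n
  have h : SqSum fun x : (ι × ι) × (Fin n → ι) =>
      ConstrainedFock.annihilation b (b x.1.1)
        (ConstrainedFock.annihilation b (b x.1.2) Ψ) n x.2 := by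
    simp only [annihilation_annihilation_basis]
    exact ((hΨ (n + 2)).comp_injective (cons_cons_injective n)).smul _
  refine SqSum.of_le (h.hasSum_sqNorm_snd.summable.mul_left
    (sqNorm fun x : ι × ι => starRingEnd ℂ ⟪b x.1, A (b x.2)⟫_ℂ)) fun i => ?_
  exact (sqSum_kernel b hA).norm_tsum_mul_sq_le (h.fiber' i)

/-- Annihilation operators commute on symmetric families; the kernel sum and the contraction with
`w` are interchanged by absolute summability over triples of indices. -/
theorem annihilation_annihilatePair {A : H →L⋆[ℂ] H} (hA : Summable fun p => ‖A (b p)‖ ^ 2)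
    (w : H) {Ψ : Family ι} (hΨ : SectorSq Ψ) (hs : IsSymmFamily Ψ) :
    annihilation b w (annihilatePair b A Ψ) = annihilatePair b A (annihilation b w Ψ) := by
  funext n i
  have e : ∀ x : ι × ι, annihilation b (b x.1) (annihilation b (b x.2) (annihilation b w Ψ)) =
      annihilation b w (annihilation b (b x.1) (annihilation b (b x.2) Ψ)) := by
    intro x
    rw [annihilation_comm b (b x.2) w hΨ hs, annihilation_comm b (b x.1) w
      (hΨ.annihilation b _) (hs.annihilation b _)]
  have h : SqSum fun y : ι × (ι × ι) =>
      annihilation b (b y.2.1) (annihilation b (b y.2.2) Ψ) (n + 1) (Fin.cons y.1 i) := by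
    simp only [annihilation_annihilation_basis]
    refine ((hΨ (n + 1 + 2)).comp_injective (e := fun y : ι × (ι × ι) =>
      (Fin.cons y.2.2 (Fin.cons y.2.1 (Fin.cons y.1 i)) : Fin (n + 1 + 2) → ι)) ?_).smul _
    rintro ⟨r, p, q⟩ ⟨r', p', q'⟩ h
    have h := Fin.cons_injective2 h
    have h' := Fin.cons_injective2 h.2
    have h'' := Fin.cons_injective2 h'.2
    exact Prod.ext h''.1 (Prod.ext h'.1 h.1)
  have hsum := ((sqSum_coord_left b w).tensor (sqSum_kernel b hA)).summable_mul h
  have hL : annihilation b w (annihilatePair b A Ψ) n i = (√(n + 1 : ℝ) : ℝ) *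
      ∑' p, ∑' x : ι × ι, ⟪w, b p⟫_ℂ * starRingEnd ℂ ⟪b x.1, A (b x.2)⟫_ℂ *
        annihilation b (b x.1) (annihilation b (b x.2) Ψ) (n + 1) (Fin.cons p i) := by
    rw [annihilation_apply]
    simp only [annihilatePair, ← tsum_mul_left, mul_assoc]
  have hR : annihilatePair b A (annihilation b w Ψ) n i = (√(n + 1 : ℝ) : ℝ) *
      ∑' x : ι × ι, ∑' p, ⟪w, b p⟫_ℂ * starRingEnd ℂ ⟪b x.1, A (b x.2)⟫_ℂ *
        annihilation b (b x.1) (annihilation b (b x.2) Ψ) (n + 1) (Fin.cons p i) := by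
    rw [annihilatePair]
    simp only [e]
    rw [← tsum_mul_left]
    refine tsum_congr fun x => ?_
    rw [annihilation_apply b w, mul_left_comm, ← tsum_mul_left]
    congr 1
    exact tsum_congr fun p => by ring
  rw [hL, hR]
  congr 1
  exact (hsum.tsum_comm (f := fun (p : ι) (x : ι × ι) => ⟪w, b p⟫_ℂ *
    starRingEnd ℂ ⟪b x.1, A (b x.2)⟫_ℂ *
      annihilation b (b x.1) (annihilation b (b x.2) Ψ) (n + 1) (Fin.cons p i))).symm

theorem hasSum_kernel_mul_annihilation {A : H →L⋆[ℂ] H} (hA : Summable fun p => ‖A (b p)‖ ^ 2)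
    (hs : IsSymmKernel A) (g : H) {Ψ : Family ι} (hΨ : SectorSq Ψ) (n : ℕ) (i : Fin n → ι) :
    HasSum (fun x : ι × ι => starRingEnd ℂ ⟪b x.1, A (b x.2)⟫_ℂ *
      (⟪b x.1, g⟫_ℂ * annihilation b (b x.2) Ψ n i)) (annihilation b (A g) Ψ n i) := by
  have h₁ : SqSum fun q => annihilation b (b q) Ψ n i := by
    simp only [annihilation_basis]
    exact (cons_sqSum hΨ n i).smul _
  have h := (sqSum_kernel b hA).summable_mul ((sqSum_coord b g).tensor h₁)
  convert h.hasSum using 1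
  rw [tsum_prod_snd h, annihilation_apply, ← tsum_mul_left]
  refine tsum_congr fun q => ?_
  have e : ∀ p, starRingEnd ℂ ⟪b p, A (b q)⟫_ℂ * (⟪b p, g⟫_ℂ * annihilation b (b q) Ψ n i) =
      ⟪A (b q), b p⟫_ℂ * ⟪b p, g⟫_ℂ * annihilation b (b q) Ψ n i := by
    intro p
    rw [inner_conj_symm, mul_assoc]
  have e' : ⟪A (b q), g⟫_ℂ = ⟪A g, b q⟫_ℂ := by
    rw [← inner_conj_symm, hs, inner_conj_symm]
  simp only [e]
  rw [tsum_mul_right, (b.hasSum_inner_mul_inner _ _).tsum_eq, e', annihilation_basis]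
  ring

/-- Dual to `annihilation_createPair`: `g` is contracted with either index of the kernel, and
symmetry of `A` makes both contractions equal to `a⁻[A g]`. -/
theorem annihilatePair_creation {A : H →L⋆[ℂ] H} (hA : Summable fun p => ‖A (b p)‖ ^ 2)
    (hs : IsSymmKernel A) (g : H) {Ψ : Family ι} (hΨ : SectorSq Ψ) :
    annihilatePair b A (creation b g Ψ) =
      creation b g (annihilatePair b A Ψ) + (2 : ℂ) • annihilation b (A g) Ψ := by
  have e : ∀ x : ι × ι, annihilation b (b x.1) (annihilation b (b x.2) (creation b g Ψ)) =
      creation b g (annihilation b (b x.1) (annihilation b (b x.2) Ψ)) +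
        ⟪b x.1, g⟫_ℂ • annihilation b (b x.2) Ψ + ⟪b x.2, g⟫_ℂ • annihilation b (b x.1) Ψ := by
    intro x
    rw [annihilation_creation b _ g hΨ, annihilation_add b _
      ((hΨ.annihilation b _).creation b g) (hΨ.smul _), annihilation_smul,
      annihilation_creation b _ g (hΨ.annihilation b _)]
  funext n i
  have h₁ : HasSum (fun x : ι × ι => starRingEnd ℂ ⟪b x.1, A (b x.2)⟫_ℂ *
      creation b g (annihilation b (b x.1) (annihilation b (b x.2) Ψ)) n i)
      (creation b g (annihilatePair b A Ψ) n i) := by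
    cases n with
    | zero => simpa only [creation_zero, mul_zero] using hasSum_zero
    | succ n =>
      have h := (hasSum_sum (s := Finset.univ) fun (j : Fin (n + 1)) _ =>
        (summable_annihilatePair b hA hΨ n fun l => i (j.succAbove l)).hasSum.mul_left
          ⟪b (i j), g⟫_ℂ).mul_left (((√(n + 1 : ℝ))⁻¹ : ℝ) : ℂ)
      refine h.congr_fun fun x => ?_
      rw [creation_succ, mul_left_comm, Finset.mul_sum]
      simp only [mul_left_comm]
  have h₂ := hasSum_kernel_mul_annihilation b hA hs g hΨ n i
  have h₃ : HasSum (fun x : ι × ι => starRingEnd ℂ ⟪b x.1, A (b x.2)⟫_ℂ *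
      (⟪b x.2, g⟫_ℂ * annihilation b (b x.1) Ψ n i)) (annihilation b (A g) Ψ n i) := by
    rw [← (Equiv.prodComm ι ι).hasSum_iff]
    refine h₂.congr_fun fun x => ?_
    simp only [Function.comp_apply, Equiv.prodComm_apply, Prod.fst_swap, Prod.snd_swap]
    rw [hs]
  refine (((h₁.add h₂).add h₃).congr_fun fun x => ?_).tsum_eq.trans ?_
  · simp only [e, Pi.add_apply, Pi.smul_apply, smul_eq_mul]
    ring
  · simp only [Pi.add_apply, Pi.smul_apply, smul_eq_mul]
    ring

end AnnihilatePair

/-! ### Second quantization -/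

section SecondQuantization

variable {ι H : Type*} [NormedAddCommGroup H] [InnerProductSpace ℂ H] (b : HilbertBasis ι ℂ H)

theorem sqSum_prod_coord {n : ℕ} (h : Fin n → H) :
    SqSum fun i : Fin n → ι => ∏ l, ⟪h l, b (i l)⟫_ℂ := by
  induction n with
  | zero => exact (hasSum_fintype _).summable
  | succ n ih =>
    rw [← sqSum_equiv (Fin.consEquiv fun _ => ι)]
    have h' := (sqSum_coord_left b (h 0)).tensor (ih fun l => h l.succ)
    convert h' using 2 with x
    simp [Fin.prod_univ_succ]

theorem summable_tensorPairing {n : ℕ} (h : Fin n → H) {T : (Fin n → ι) → ℂ} (hT : SqSum T) :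
    Summable fun i => (∏ l, ⟪h l, b (i l)⟫_ℂ) * T i :=
  (sqSum_prod_coord b h).summable_mul hT

theorem tensorPairing_add {n : ℕ} (h : Fin n → H) {T U : (Fin n → ι) → ℂ} (hT : SqSum T)
    (hU : SqSum U) : tensorPairing b h (T + U) = tensorPairing b h T + tensorPairing b h U := by
  simp only [tensorPairing, Pi.add_apply, mul_add]
  exact (summable_tensorPairing b h hT).tsum_add (summable_tensorPairing b h hU)

theorem tensorPairing_sub {n : ℕ} (h : Fin n → H) {T U : (Fin n → ι) → ℂ} (hT : SqSum T)
    (hU : SqSum U) : tensorPairing b h (T - U) = tensorPairing b h T - tensorPairing b h U := by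
  simp only [tensorPairing, Pi.sub_apply, mul_sub]
  exact (summable_tensorPairing b h hT).tsum_sub (summable_tensorPairing b h hU)

theorem tensorPairing_annihilation {n : ℕ} (h : Fin n → H) (w : H) {Ψ : Family ι}
    (hΨ : SectorSq Ψ) : tensorPairing b h (annihilation b w Ψ n) =
      (√(n + 1 : ℝ) : ℝ) * tensorPairing b (Fin.cons w h : Fin (n + 1) → H) (Ψ (n + 1)) := by
  have hs := (Fin.consEquiv fun _ => ι).summable_iff.2
    (summable_tensorPairing b (Fin.cons w h : Fin (n + 1) → H) (hΨ (n + 1)))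
  have e : tensorPairing b (Fin.cons w h : Fin (n + 1) → H) (Ψ (n + 1)) =
      ∑' i : Fin n → ι, ∑' p, (⟪w, b p⟫_ℂ * ∏ l, ⟪h l, b (i l)⟫_ℂ) *
        Ψ (n + 1) (Fin.cons p i) := by
    rw [tensorPairing, ← (Fin.consEquiv fun _ => ι).tsum_eq]
    refine (tsum_prod_snd hs).trans ?_
    simp [Fin.prod_univ_succ]
    rfl
  rw [e, tensorPairing, ← tsum_mul_left]
  refine tsum_congr fun i => ?_
  rw [annihilation_apply, mul_left_comm, ← tsum_mul_left]
  congr 1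
  exact tsum_congr fun p => by ring

theorem tensorPairing_creation {n : ℕ} (h : Fin (n + 1) → H) (f : H) {Ψ : Family ι}
    (hΨ : SectorSq Ψ) : tensorPairing b h (creation b f Ψ (n + 1)) =
      ((√(n + 1 : ℝ))⁻¹ : ℝ) * ∑ j, ⟪h j, f⟫_ℂ *
        tensorPairing b (fun l => h (j.succAbove l)) (Ψ n) := by
  have hj : ∀ j ∈ Finset.univ, HasSum (fun i : Fin (n + 1) → ι => (∏ l, ⟪h l, b (i l)⟫_ℂ) *
      (⟪b (i j), f⟫_ℂ * Ψ n fun l => i (j.succAbove l)))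
      (⟪h j, f⟫_ℂ * tensorPairing b (fun l => h (j.succAbove l)) (Ψ n)) := by
    intro j _
    rw [← (Fin.insertNthEquiv (fun _ => ι) j).hasSum_iff]
    let F : ι → ℂ := fun p => ⟪h j, b p⟫_ℂ * ⟪b p, f⟫_ℂ
    let G : (Fin n → ι) → ℂ := fun i => (∏ l, ⟪h (j.succAbove l), b (i l)⟫_ℂ) * Ψ n i
    have h₁ : Summable fun p => ‖F p‖ :=
      (sqSum_coord_left b (h j)).summable_norm_mul (sqSum_coord b f)
    have h₂ : Summable fun i => ‖G i‖ :=
      (sqSum_prod_coord b fun l => h (j.succAbove l)).summable_norm_mul (hΨ n)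
    have h₃ := HasSum.mul (f := F) (g := G) (b.hasSum_inner_mul_inner (h j) f) h₂.of_norm.hasSum
      (summable_mul_of_summable_norm h₁ h₂)
    refine h₃.congr_fun fun x => ?_
    simp only [F, G, Function.comp_apply, Fin.insertNthEquiv_apply, Fin.prod_univ_succAbove _ j,
      Fin.insertNth_apply_same, Fin.insertNth_apply_succAbove]
    ring
  refine (((hasSum_sum hj).mul_left (((√(n + 1 : ℝ))⁻¹ : ℝ) : ℂ)).congr_fun fun i => ?_).tsum_eq
  rw [creation_succ, mul_left_comm, Finset.mul_sum]

/-- A square-summable component is determined by its pairings with the product vectors over a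
dense subspace. -/
theorem eq_zero_of_tensorPairing_eq_zero {D : Submodule ℂ H} (hD : Dense (D : Set H)) {n : ℕ}
    {Ψ : Family ι} (hΨ : SectorSq Ψ)
    (h : ∀ h : Fin n → D, tensorPairing b (fun l => (h l : H)) (Ψ n) = 0) : Ψ n = 0 := by
  induction n generalizing Ψ with
  | zero =>
    funext i
    have h₀ := h Fin.elim0
    rw [tensorPairing, tsum_fintype, Fintype.sum_unique] at h₀
    simpa [Subsingleton.elim i default] using h₀
  | succ n ih =>
    have hz : ∀ w : D, annihilation b (w : H) Ψ n = 0 := by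
      intro w
      refine ih (hΨ.annihilation b w) fun g => ?_
      rw [tensorPairing_annihilation b _ _ hΨ]
      have h₁ := h (Fin.cons w g)
      have e : (fun l => ((Fin.cons w g : Fin (n + 1) → D) l : H)) =
          (Fin.cons (w : H) fun l => (g l : H) : Fin (n + 1) → H) := by
        funext l
        refine Fin.cases ?_ (fun l => ?_) l <;> simp
      rw [← e, h₁, mul_zero]
    have hc : ∀ (i : Fin n → ι) (p : ι), Ψ (n + 1) (Fin.cons p i) = 0 := by
      intro i
      -- For fixed remaining indices the first slot is a vector `u` of `H`; by the induction
      -- hypothesis it is orthogonal to the dense subspace.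
      set u : H := b.repr.symm (cons_sqSum hΨ n i).toLp with hu
      have hup : ∀ p, ⟪b p, u⟫_ℂ = Ψ (n + 1) (Fin.cons p i) := by
        intro p
        rw [← b.repr_apply_apply, hu, LinearIsometryEquiv.apply_symm_apply, SqSum.toLp_apply]
      have hu0 : u = 0 := by
        refine hD.eq_zero_of_inner_right ℂ fun w hw => ?_
        have h₁ := congrFun (hz ⟨w, hw⟩) i
        rw [annihilation_apply, Pi.zero_apply, mul_eq_zero,
          or_iff_right (sqrt_succ_ne_zero n)] at h₁
        rw [← (b.hasSum_inner_mul_inner w u).tsum_eq]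
        simpa only [hup] using h₁
      intro p
      rw [← hup, hu0, inner_zero_right]
    funext i
    rw [← Fin.cons_self_tail i]
    exact hc _ _

/-- The quadratic form of `a⁺Ba⁻` on product vectors over `D(B)`. -/
def secondQuantForm (B : H →ₗ.[ℂ] H) {n : ℕ} (h : Fin n → B.domain) (T : (Fin n → ι) → ℂ) : ℂ :=
  ∑ j, tensorPairing b (Function.update (fun l => (h l : H)) j (B (h j))) T

theorem coe_cons_domain {B : H →ₗ.[ℂ] H} {n : ℕ} (w : B.domain) (h : Fin n → B.domain) :
    (fun l => ((Fin.cons w h : Fin (n + 1) → B.domain) l : H)) =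
      (Fin.cons (w : H) fun l => (h l : H) : Fin (n + 1) → H) := by
  funext l
  refine Fin.cases ?_ (fun l => ?_) l <;> simp

/-- The defining identity is tested on a product vector with `w` in slot `0`; the summand where `B`
hits slot `0` separates from the others. -/
theorem tensorPairing_annihilation_of_isSecondQuantization {B : H →ₗ.[ℂ] H} {Ψ Ξ : Family ι}
    (hΞ : IsSecondQuantization b B Ψ Ξ) (w : B.domain) {n : ℕ} (h : Fin n → B.domain) :
    tensorPairing b (fun l => (h l : H)) (annihilation b (w : H) Ξ n) =
      tensorPairing b (fun l => (h l : H)) (annihilation b (B w) Ψ n) +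
        secondQuantForm b B h (annihilation b (w : H) Ψ n) := by
  have hΨs := hΞ.1.sectorSq
  have h₁ := hΞ.2.2 (n + 1) (Fin.cons w h)
  rw [tensorPairing_annihilation b _ _ hΞ.2.1.sectorSq, tensorPairing_annihilation b _ _ hΨs,
    ← coe_cons_domain, ← h₁, Fin.sum_univ_succ, mul_add, secondQuantForm]
  congr 1
  · rw [coe_cons_domain, Fin.cons_zero, Fin.update_cons_zero]
  · rw [Finset.mul_sum]
    refine Finset.sum_congr rfl fun j _ => ?_
    rw [tensorPairing_annihilation b _ _ hΨs, coe_cons_domain, Fin.cons_succ, Fin.cons_update]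

theorem secondQuantForm_creation [CompleteSpace H] {B : H →ₗ.[ℂ] H} (hB : IsSelfAdjoint B)
    {Ψ Ξ : Family ι} (hΞ : IsSecondQuantization b B Ψ Ξ) (g : B.domain) {n : ℕ}
    (h : Fin n → B.domain) :
    secondQuantForm b B h (creation b (g : H) Ψ n) =
      tensorPairing b (fun l => (h l : H)) (creation b (B g) Ψ n) +
        tensorPairing b (fun l => (h l : H)) (creation b (g : H) Ξ n) := by
  have hΨs := hΞ.1.sectorSq
  cases n with
  | zero => simp [secondQuantForm, tensorPairing, creation_zero]
  | succ n =>
    simp only [secondQuantForm, tensorPairing_creation b _ _ hΨs,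
      tensorPairing_creation b _ _ hΞ.2.1.sectorSq]
    rw [← Finset.mul_sum, ← mul_add, Finset.sum_comm, ← Finset.sum_add_distrib]
    congr 1
    refine Finset.sum_congr rfl fun k _ => ?_
    -- If `B` hits the slot paired with `g`, self-adjointness moves it to `g`. The other slots give
    -- the defining identity on the product vector with slot `k` removed.
    rw [Fin.sum_univ_succAbove _ k, ← hΞ.2.2 n fun l => h (k.succAbove l), Finset.mul_sum]
    congr 1
    · rw [Function.update_self, inner_apply_of_isSelfAdjoint hB]
      simp only [Function.update_of_ne (Fin.succAbove_ne k _)]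
    · refine Finset.sum_congr rfl fun j _ => ?_
      rw [Function.update_of_ne (Fin.succAbove_ne k j).symm]
      congr 2
      exact Function.update_comp_eq_of_injective _ (Fin.succAbove_right_injective (p := k)) _ _

/-- The two commutators with `a⁺Ba⁻` are taken in the weak sense. The form of `a⁺Ba⁻` on `a⁻[w]Ψ =
a⁺[g]Ψ` occurs in both and cancels, so this vector need not be shown to lie in the operator domain.
-/
theorem annihilation_sub_creation_of_isSecondQuantization [CompleteSpace H] {B : H →ₗ.[ℂ] H}
    (hB : IsSelfAdjoint B) {Ψ Ξ : Family ι} (hΞ : IsSecondQuantization b B Ψ Ξ)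
    (w g : B.domain) (hw : annihilation b (w : H) Ψ = creation b (g : H) Ψ) :
    annihilation b (w : H) Ξ - creation b (g : H) Ξ =
      annihilation b (B w) Ψ + creation b (B g) Ψ := by
  have hΨs := hΞ.1.sectorSq
  have hΞs := hΞ.2.1.sectorSq
  have s₁ := hΞs.annihilation b (w : H)
  have s₂ := hΞs.creation b (g : H)
  have s₃ := hΨs.annihilation b (B w)
  have s₄ := hΨs.creation b (B g)
  rw [← sub_eq_zero]
  funext n
  refine eq_zero_of_tensorPairing_eq_zero b hB.dense_domain ((s₁.sub s₂).sub (s₃.add s₄))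
    fun h => ?_
  have e₁ := tensorPairing_annihilation_of_isSecondQuantization b hΞ w h
  have e₂ := secondQuantForm_creation b hB hΞ g h
  rw [← hw] at e₂
  have t₁ := tensorPairing_sub b (fun l => (h l : H)) ((s₁ n).sub (s₂ n)) ((s₃ n).add (s₄ n))
  rw [tensorPairing_sub b _ (s₁ n) (s₂ n), tensorPairing_add b _ (s₃ n) (s₄ n)] at t₁
  refine t₁.trans ?_
  linear_combination e₁ + e₂

end SecondQuantization

/-! ### The Riccati equation for the Gaussian eigenvector -/

section Riccati

variable {ι H : Type*} [NormedAddCommGroup H] [InnerProductSpace ℂ H] [CompleteSpace H]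
  {b : HilbertBasis ι ℂ H} (Q : QuadraticSystem b)

/-- The four terms of the Riccati expression arise as follows: `A v` from pair creation, `B M v` and
`M B v` from `a⁺Ba⁻`, and `M A M v` from pair annihilation. Each annihilation operator left on `Ψ`
is turned into a creation operator by `hΨ`. -/
theorem annihilation_hamiltonian {M : H →L⋆[ℂ] H} (hMd : ∀ f, M f ∈ Q.B.domain) {Ψ Θ : Family ι}
    (hΨ : ∀ x, annihilation b x Ψ = creation b (M x) Ψ) (hΘ : Q.IsHamiltonianImage Ψ Θ)
    (v : Q.B.domain) : annihilation b (v : H) Θ =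
      creation b (M v) Θ + creation b (riccatiForm Q.B Q.A M hMd v) Ψ := by
  obtain ⟨hΨS, -, Ξ, hΞ, rfl⟩ := hΘ
  have hA := Q.kernelA.1
  have hΨs := hΨS.toIsFock.sectorSq
  have hΨsymm : IsSymmFamily Ψ := hΨS.symm
  have s₁ := (hΨs.createPair b Q.symmA hA).smul (1 / 2 : ℂ)
  have s₂ := hΞ.2.1.sectorSq
  have s₃ := (hΨs.annihilatePair b hA).smul (1 / 2 : ℂ)
  have e₁ := annihilation_createPair b Q.symmA (v : H) hΨs
  rw [hΨ, createPair_creation b Q.symmA] at e₁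
  have e₂ := annihilation_sub_creation_of_isSecondQuantization b Q.selfAdjoint hΞ v
    ⟨M v, hMd v⟩ (hΨ v)
  rw [hΨ, sub_eq_iff_eq_add] at e₂
  have e₃ := annihilation_annihilatePair b hA (v : H) hΨs hΨsymm
  rw [hΨ, annihilatePair_creation b hA Q.symmA _ hΨs, hΨ] at e₃
  rw [annihilation_add b _ ((s₁.add s₂).add s₃) (hΨs.smul _), annihilation_add b _ (s₁.add s₂) s₃,
    annihilation_add b _ s₁ s₂, annihilation_smul, annihilation_smul, annihilation_smul, e₁, e₂, e₃,
    hΨ]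
  simp only [riccatiForm, creation_add, creation_smul, creation_add_left]
  module

/-- The operator `a⁻[v] - a⁺[M v]` is applied twice to the null vector `Θ - EΨ`. The first
application gives `a⁺[k]Ψ`, the second turns this into the scalar `(v, k)` times `Ψ`. -/
theorem inner_riccatiForm_eq_zero [MeasurableSpace H] [BorelSpace H] (μ : Measure Q.ℒ)
    [μ.IsAddHaarMeasure] {M : H →L⋆[ℂ] H} (hs : IsSymmKernel M)
    (hMd : ∀ f, M f ∈ Q.B.domain) {Ψ : Family ι}
    (hΨ : ∀ x, annihilation b x Ψ = creation b (M x) Ψ) (hE : Q.IsEigenvector μ Ψ)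
    (v : Q.B.domain) (hv : IsAdmissible M Q.ℒ v) :
    ⟪(v : H), riccatiForm Q.B Q.A M hMd v⟫_ℂ = 0 := by
  have := Q.finiteDimensional
  obtain ⟨hne, E, Θ, hΘ, hEq⟩ := hE
  set k := riccatiForm Q.B Q.A M hMd v with hk
  let x : schwartz ι := schwartz.mk Ψ hΘ.1
  let y : schwartz ι := schwartz.mk Θ hΘ.2.1
  have hphys : ∀ z z' : schwartz ι, Q.physInner μ (z : Family ι) z' = phys b μ z z' := by
    intro z z'
    simp only [QuadraticSystem.physInner, phys, fockInner_weyl]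
  have hx : phys b μ x x ≠ 0 := by
    intro h
    refine hne ?_
    rw [QuadraticSystem.Equivalent, sub_zero]
    exact (hphys x x).trans h
  have hnull : phys b μ (y - E • x) (y - E • x) = 0 := (hphys _ _).symm.trans hEq
  have hDx : gaussAn b M (v : H) x = 0 := by
    rw [gaussAn, LinearMap.sub_apply, sub_eq_zero]
    exact schwartz.ext (hΨ v)
  have hDy : gaussAn b M (v : H) y = cr b k x := by
    rw [gaussAn, LinearMap.sub_apply, sub_eq_iff_eq_add']
    exact schwartz.ext (annihilation_hamiltonian Q hMd hΨ hΘ v)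
  have hcomm : gaussAn b M (v : H) * cr b k = cr b k * gaussAn b M (v : H) + ⟪(v : H), k⟫_ℂ • 1 := by
    rw [gaussAn, sub_mul, mul_sub, an_mul_cr, cr_mul_cr b (M v) k]
    abel
  have hDD : gaussAn b M (v : H) (gaussAn b M (v : H) (y - E • x)) = ⟪(v : H), k⟫_ℂ • x := by
    rw [map_sub, map_smul, hDx, smul_zero, sub_zero, hDy]
    have h := LinearMap.congr_fun hcomm x
    simpa only [Module.End.mul_apply, LinearMap.add_apply, LinearMap.smul_apply,
      Module.End.one_apply, hDx, map_zero, zero_add] using h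
  have h := phys_smul_right b μ ⟪(v : H), k⟫_ℂ x x
  -- Both operators are moved to the left factor, which leaves a product with a null vector.
  rw [← hDD, phys_gaussAn b μ hs hv, phys_gaussAn b μ hs hv,
    phys_eq_zero_of_null b Q.isotropic μ hnull] at h
  exact (mul_eq_zero.1 h.symm).resolve_right hx

end Riccati

end ConstrainedFock

end

theorem lemma23 {ι H : Type*} [NormedAddCommGroup H] [InnerProductSpace ℂ H] [CompleteSpace H]
    [MeasurableSpace H] [BorelSpace H] (b : HilbertBasis ι ℂ H)
    (Q : ConstrainedFock.QuadraticSystem b)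
    (μ : MeasureTheory.Measure Q.ℒ) [μ.IsAddHaarMeasure]
    (M : H →L⋆[ℂ] H) (hMsymm : ConstrainedFock.IsSymmKernel M) (hMnorm : ‖M‖ < 1)
    (hMdom : ConstrainedFock.HasKernelInDomain b Q.B M)
    (hM : Q.IsEigenvector μ (ConstrainedFock.gaussian b M)) :
    Q.IsStable := by
  obtain ⟨hHS, hMd, -⟩ := hMdom
  exact Q.isStable_of_riccati hMnorm hMsymm hMd
    (ConstrainedFock.inner_riccatiForm_eq_zero Q μ hMsymm hMd
      (ConstrainedFock.annihilation_gaussian b hMsymm hHS) hM)
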